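/- **Theorem 3.1.** Let $d\ge 2$, $p,q\in(1,\infty)$. For $\rho>0$ and $(t,x)\in\mathbb R^{d+1}=\mathbb R\times\mathbb R^d$ put $B_\rho(x)=\{y\in\mathbb R^d:|y-x|<\rho\}$ and $C_\rho(t,x)=[t,t+\rho^2)\times B_\rho(x)$. Let $$\|g\|_{L_{p,q}(\Gamma)}=\Big(\int_{\mathbb R}\Big(\int_{\mathbb R^d}I_\Gamma|g|^p\,dx\Big)^{q/p}dt\Big)^{1/q},\qquad \|g\|_{E_{p,q,\beta}}=\sup_{0<\rho\le1}\ \sup_{(t,x)}\ \rho^\beta\,\frac{\|g\|_{L_{p,q}(C_\rho(t,x))}}{\|1\|_{L_{p,q}(C_\rho(t,x))}},$$ let $E_{p,q,\beta}$ be the set of measurable $g$ on $\mathbb R^{d+1}$ with $\|g\|_{E_{p,q,\beta}}<\infty$, and for functions $g$ on $\mathbb R^d$ let $$\|g\|_{E_{r,\beta}(\mathbb R^d)}=\sup_{0<\rho\le1}\ \sup_{x}\ \rho^\beta\Big(\frac1{|B_\rho(x)|}\int_{B_\rho(x)}|g|^r\,dy\Big)^{1/r}.$$ Let $E^{1,2}_{p,q,\beta}$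 be the set of real functions $u$ on $\mathbb R^{d+1}$ such that $u$ and its Sobolev derivatives $Du,D^2u$ (in $x$) and $\partial_tu$ belong to $E_{p,q,\beta}$, with norm $\|u\|_{E^{1,2}_{p,q,\beta}}=\|u\|_{E_{p,q,\beta}}+\|Du\|_{E_{p,q,\beta}}+\|D^2u\|_{E_{p,q,\beta}}+\|\partial_tu\|_{E_{p,q,\beta}}$, and write $\|\partial_tu,D^2u\|_{E_{p,q,\beta}}=\|\partial_tu\|_{E_{p,q,\beta}}+\|D^2u\|_{E_{p,q,\beta}}$. For a nonnegative $\zeta\in C_0^\infty(\mathbb R^{d+1})$ with unit integral put $\zeta_\varepsilon(t,x)=\varepsilon^{-d-2}\zeta(t/\varepsilon^2,x/\varepsilon)$ and $u^{(\varepsilon)}=u*\zeta_\varepsilon$. For $\gamma\in\{0,1\}$ let $D^\gamma=D$ (the gradient in $x$) if $\gamma=1$ and $D^\gamma=1$ if $\gamma=0$. Let $\gamma\in\{0,1\}$, $r\in[p,\infty)$, $\mu>0$ and assume that $$2-\gamma<\beta\le\frac dp+\frac2q<2-\gamma+\frac dr,\qquad \kappa:=\gamma+\frac dp+\frac2q-\frac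 dr\le\mu<2 .$$ Then for every $u\in E^{1,2}_{p,q,\beta}$ the trace $D^\gamma u(0,\cdot)$ is uniquely defined: as $\varepsilon\downarrow0$, $D^\gamma u^{(\varepsilon)}(0,\cdot)$ converges in $L_r(B)$ for every ball $B\subset\mathbb R^d$, to a limit which is unique up to a.e. equality and does not depend on $\zeta$. Moreover, for every $\varepsilon\in(0,1]$, $$\|D^\gamma u(0,\cdot)\|_{E_{r,\beta+\gamma-\mu}(\mathbb R^d)}\le N\varepsilon\,\|\partial_tu,D^2u\|_{E_{p,q,\beta}}+N\varepsilon^{-\mu/(2-\mu)}\,\|u\|_{E_{p,q,\beta}},\tag{3.2}$$ $$\|D^\gamma u(0,\cdot)\|_{E_{r,\beta+\gamma-2}(\mathbb R^d)}\le N\,\|u\|_{E^{1,2}_{p,q,\beta}},\tag{3.3}$$ where the constant $N$ depends only on $d,p,q,\beta,\mu$. -/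

import Mathlib

open MeasureTheory Filter Set Topology
open scoped ENNReal NNReal ContDiff Convolution

noncomputable section

namespace ParabolicMorrey

/-- The Euclidean space `ℝ^d`. -/
abbrev Space (d : ℕ) := EuclideanSpace ℝ (Fin d)

/-- The space-time `ℝ^{d+1} = ℝ × ℝ^d` of points `(t, x)`, with Lebesgue measure. -/
abbrev SpaceTime (d : ℕ) := ℝ × Space d

variable {d : ℕ}

/-- The parabolic cylinder `C_ρ(t, x) = [t, t + ρ²) × B_ρ(x)`. -/
def parCylinder (ρ t : ℝ) (x : Space d) : Set (SpaceTime d) :=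
  Ico t (t + ρ ^ 2) ×ˢ Metric.ball x ρ

/-- The mixed norm `‖g‖_{L_{p,q}(Γ)} = (∫ (∫ I_Γ |g|^p dx)^{q/p} dt)^{1/q}`,
with values in `[0, ∞]`. -/
def mixedNorm {F : Type*} [NormedAddCommGroup F] (p q : ℝ) (Γ : Set (SpaceTime d))
    (g : SpaceTime d → F) : ℝ≥0∞ :=
  (∫⁻ t : ℝ, (∫⁻ x : Space d, (Γ.indicator (fun z => ‖g z‖ₑ) (t, x)) ^ p) ^ (q / p)) ^ (1 / q)

/-- The normalized mixed norm `‖I_Γ‖_{L_{p,q}}⁻¹ ‖g‖_{L_{p,q}(Γ)}`. -/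
def avgMixedNorm {F : Type*} [NormedAddCommGroup F] (p q : ℝ) (Γ : Set (SpaceTime d))
    (g : SpaceTime d → F) : ℝ≥0∞ :=
  (mixedNorm p q Γ (fun _ => (1 : ℝ)))⁻¹ * mixedNorm p q Γ g

/-- The parabolic Morrey norm `‖g‖_{E_{p,q,β}}`: the supremum over `0 < ρ ≤ 1` and over all
cylinders `C` of radius `ρ` of `ρ^β` times the normalized mixed norm of `g` over `C`. -/
def morreyNorm {F : Type*} [NormedAddCommGroup F] (p q β : ℝ) (g : SpaceTime d → F) : ℝ≥0∞ :=
  ⨆ ρ ∈ Ioc (0 : ℝ) 1, ⨆ (t : ℝ) (x : Space d),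
    ENNReal.ofReal (ρ ^ β) * avgMixedNorm p q (parCylinder ρ t x) g

/-- `g ∈ E_{p,q,β}`. -/
def MemMorrey {F : Type*} [NormedAddCommGroup F] (p q β : ℝ) (g : SpaceTime d → F) : Prop :=
  AEStronglyMeasurable g volume ∧ morreyNorm p q β g < ⊤

/-- The norm `‖g‖_{E_{r,β}(ℝ^d)}` of functions of `x` alone:
`sup_{0 < ρ ≤ 1} ρ^β sup_x (⨍_{B_ρ(x)} |g|^r)^{1/r}`. For a function independent of `t` the
normalized mixed norm over a cylinder is the normalized `L_r` norm over its base. -/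
def spaceMorreyNorm {F : Type*} [NormedAddCommGroup F] (r β : ℝ) (g : Space d → F) : ℝ≥0∞ :=
  ⨆ ρ ∈ Ioc (0 : ℝ) 1, ⨆ x : Space d,
    ENNReal.ofReal (ρ ^ β) *
      ((volume (Metric.ball x ρ))⁻¹ * ∫⁻ y in Metric.ball x ρ, ‖g y‖ₑ ^ r) ^ (1 / r)

/-- `g` is the Sobolev (weak) derivative of `f` in the direction `e` on `ℝ^{d+1}`. -/
def HasWeakDeriv (e : SpaceTime d) (f g : SpaceTime d → ℝ) : Prop :=
  LocallyIntegrable f volume ∧ LocallyIntegrable g volume ∧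
    ∀ φ : SpaceTime d → ℝ, ContDiff ℝ ∞ φ → HasCompactSupport φ →
      ∫ z, f z * fderiv ℝ φ z e = - ∫ z, g z * φ z

/-- The unit vector of the time axis of `ℝ × ℝ^d`. -/
def timeDir : SpaceTime d := (1, 0)

/-- The `i`th spatial coordinate vector of `ℝ × ℝ^d`. -/
def spaceDir (i : Fin d) : SpaceTime d := (0, EuclideanSpace.single i 1)

/-- `u ∈ E^{1,2}_{p,q,β}`, with Sobolev derivatives `ut = ∂_t u`, `Du = (D_i u)` and
`D2u = (D_{ij} u)` (which `u` determines almost everywhere). -/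
structure MemMorreySobolev (p q β : ℝ) (u ut : SpaceTime d → ℝ)
    (Du : SpaceTime d → EuclideanSpace ℝ (Fin d))
    (D2u : SpaceTime d → EuclideanSpace ℝ (Fin d × Fin d)) : Prop where
  weak_time : HasWeakDeriv timeDir u ut
  weak_space : ∀ i, HasWeakDeriv (spaceDir i) u (fun z => Du z i)
  weak_space₂ : ∀ i j, HasWeakDeriv (spaceDir j) (fun z => Du z i) (fun z => D2u z (i, j))
  mem : MemMorrey p q β u
  mem_time : MemMorrey p q β ut
  mem_space : MemMorrey p q β Du
  mem_space₂ : MemMorrey p q β D2u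

/-- A mollification kernel: a nonnegative `ζ ∈ C_0^∞(ℝ^{d+1})` with unit integral. -/
structure IsMollifier (ζ : SpaceTime d → ℝ) : Prop where
  smooth : ContDiff ℝ ∞ ζ
  compact : HasCompactSupport ζ
  nonneg : ∀ z, 0 ≤ ζ z
  integral_eq_one : ∫ z, ζ z = 1

/-- The parabolic rescaling `ζ_ε(t, x) = ε^{-d-2} ζ(t/ε², x/ε)`. -/
def rescale (ζ : SpaceTime d → ℝ) (ε : ℝ) : SpaceTime d → ℝ :=
  fun z => (ε ^ (d + 2))⁻¹ * ζ (z.1 / ε ^ 2, ε⁻¹ • z.2)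

/-- The mollification `u^{(ε)} = u * ζ_ε`. -/
def mollify (ζ : SpaceTime d → ℝ) (ε : ℝ) (u : SpaceTime d → ℝ) : SpaceTime d → ℝ :=
  u ⋆[ContinuousLinearMap.mul ℝ ℝ, volume] rescale ζ ε

/-- `g` is the trace `D^γ u(0, ·)` computed with the kernel `ζ`: the limit of
`D^γ u^{(ε)}(0, ·)` in `L_r(B)` as `ε ↓ 0`, for every ball `B`. Here `D^γ v` is the `γ`th
derivative of `v` in `x`, a `γ`-linear form; its norm is `|v|` for `γ = 0` and the Euclidean
norm of the gradient for `γ = 1`. -/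
def IsTrace (r : ℝ) (γ : ℕ) (ζ u : SpaceTime d → ℝ)
    (g : Space d → ContinuousMultilinearMap ℝ (fun _ : Fin γ => Space d) ℝ) : Prop :=
  AEStronglyMeasurable g volume ∧
    ∀ (x₀ : Space d) (R : ℝ), 0 < R →
      Tendsto
        (fun ε : ℝ => eLpNorm
          (fun x => iteratedFDeriv ℝ γ (fun y => mollify ζ ε u (0, y)) x - g x)
          (ENNReal.ofReal r) (volume.restrict (Metric.ball x₀ R)))
        (𝓝[>] 0) (𝓝 0)

end ParabolicMorrey

end

open ParabolicMorrey

/-!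
The idea is to reach the trace through the scale of a mollification rather than through time.
Let `φ` be a mollification kernel, `P = D^γ φ` and `W(σ) = D^γ (u * φ_σ) = σ^{-γ} (u * P_σ)`.
Differentiating in the scale gives `-σ^{-1-γ}` times the convolution of `u` with a rescaling of
`∂_t (2tP) + div (xP) + γP`. If `φ` is a function of `t² + |x|²`, then `xφ` is the gradient in `x`
of another compactly supported kernel, so that this expression is a time derivative plus a
Laplacian (`exists_scaleKernel`, `IsScaleKernel.spatialDeriv`). Moving these derivatives onto `u`
yields `∂_σ W = -σ^{1-γ} (∂_t u * (R₁)_σ + Δu * (R₂)_σ)` (`IsScaleKernel.hasDerivAt_conv`), which is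
at most a constant times `σ^{1-γ}` times the averages of `F = |∂_t u| + |D²u|` over cylinders of
radius `σ`. Hence `|W(b) - W(a)|`, for `a ≤ b`, is bounded by the `potential` of `F` truncated at
the scale `b` (`IsScaleKernel.enorm_conv_sub_le`).

On a ball of radius `ρ` at a fixed time, the averages of a function of Morrey class over cylinders
of radius `τ ≤ ρ` obey an `L_r` bound with the factor `τ^{d/r-d/p-2/q}`
(`MorreyBound.cylAvg_Lr_le`), by Minkowski's inequality in time and an `L_p`–`L_r` bound in space.
Multiplied by `τ^{1-γ}` this is integrable at zero exactly because
`κ = γ + d/p + 2/q - d/r < 2`, so the potential is finite almost everywhere at time zero, and `W(σ)`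
has a limit `g` there (`exists_trace`). At scales `τ > ρ` the averages are bounded pointwise by
`τ^{-β}`, and `τ^{1-γ-β}` is integrable at infinity because `β > 2 - γ`.

Writing `|g| ≤ |g - W(s)| + |W(s)|` and estimating the two terms by the potential of `F` and by the
averages of `|u|` gives, for every `ν` between `κ` and `2` and every `s ≤ 1`,
`‖g‖_{E_{r,β+γ-ν}} ≤ N (s^{2-ν} ‖∂_t u, D²u‖ + s^{-ν} ‖u‖)`
(`IsScaleKernel.exists_trace_estimate`). Both inequalities are cases of this one: `ν = μ` with
`s^{2-μ} = ε`, and `ν = 2` with `s = 1`.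

For another mollifier `ζ`, `D^γ u^{(ε)}` is the limit of `ζ_ε * W(σ)` as `σ ↓ 0`, so it differs from
`ζ_ε * W(δ)` by an average of the potential truncated at `δ`; this gives the convergence in `L_r` to
the same `g` (`MorreyBound.tendsto_Lr_trace`), and the limit in `L_r` is unique.
-/

open ParabolicMorrey

namespace ParabolicMorrey

section

/-! ### Integral inequalities -/

instance instIsAddHaarMeasureSpaceTime (d : ℕ) :
    (volume : Measure (SpaceTime d)).IsAddHaarMeasure :=
  Measure.prod.instIsAddHaarMeasure _ _

/-- Minkowski's integral inequality. -/
theorem lintegral_minkowski {α β : Type*} [MeasurableSpace α] [MeasurableSpace β]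
    {μ : Measure α} {ν : Measure β} [IsFiniteMeasure μ] [SFinite ν] {r : ℝ} (hr : 1 < r)
    {F : α → β → ℝ≥0∞} (hF : Measurable (Function.uncurry F)) :
    (∫⁻ x, (∫⁻ y, F x y ∂ν) ^ r ∂μ) ^ (1 / r) ≤ ∫⁻ y, (∫⁻ x, F x y ^ r ∂μ) ^ (1 / r) ∂ν := by
  have hr0 : 0 < r := by linarith
  set H : α → ℝ≥0∞ := fun x => ∫⁻ y, F x y ∂ν with hH
  have hHm : Measurable H := hF.lintegral_prod_right'
  set R := ∫⁻ y, (∫⁻ x, F x y ^ r ∂μ) ^ (1 / r) ∂ν with hR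
  have hpq : (Real.conjExponent r).HolderConjugate r :=
    (Real.HolderConjugate.conjExponent hr).symm
  -- the truncations `min H n` have finite norm, so one can divide by it
  have key : ∀ n : ℕ, ∫⁻ x, (min (H x) n) ^ r ∂μ ≤ R ^ r := by
    intro n
    set T : α → ℝ≥0∞ := fun x => min (H x) n with hT
    have hTm : Measurable T := hHm.min measurable_const
    set I := ∫⁻ x, T x ^ r ∂μ with hI
    have hItop : I ≠ ⊤ := by
      refine ne_of_lt (lt_of_le_of_lt (lintegral_mono (g := fun _ => (n : ℝ≥0∞) ^ r) ?_) ?_)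
      · intro x
        exact ENNReal.rpow_le_rpow (min_le_right _ _) hr0.le
      · rw [lintegral_const]
        exact ENNReal.mul_lt_top (ENNReal.rpow_lt_top_of_nonneg hr0.le (by simp))
          (measure_lt_top _ _)
    have h1 : I ≤ I ^ (1 - 1 / r) * R := by
      calc I ≤ ∫⁻ x, T x ^ (r - 1) * H x ∂μ := by
            refine lintegral_mono fun x => ?_
            have : T x ^ r = T x ^ (r - 1) * T x := by
              conv_rhs => rw [← ENNReal.rpow_one (T x), ← ENNReal.rpow_mul]
              rw [← ENNReal.rpow_add_of_nonneg _ _ (by linarith) (by norm_num)]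
              congr 1; ring
            rw [this]
            exact mul_le_mul_right (min_le_left _ _) _
        _ = ∫⁻ x, ∫⁻ y, T x ^ (r - 1) * F x y ∂ν ∂μ := by
            refine lintegral_congr fun x => ?_
            rw [lintegral_const_mul]
            exact hF.comp measurable_prodMk_left
        _ = ∫⁻ y, ∫⁻ x, T x ^ (r - 1) * F x y ∂μ ∂ν := by
            refine lintegral_lintegral_swap ?_
            exact (((hTm.comp measurable_fst).pow_const _).mul hF).aemeasurable
        _ ≤ ∫⁻ y, I ^ (1 - 1 / r) * (∫⁻ x, F x y ^ r ∂μ) ^ (1 / r) ∂ν := by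
            refine lintegral_mono fun y => ?_
            refine (ENNReal.lintegral_mul_le_Lp_mul_Lq μ hpq
              (hTm.pow_const (r - 1)).aemeasurable
              (hF.comp measurable_prodMk_right).aemeasurable).trans_eq ?_
            have e1 : (r - 1) * Real.conjExponent r = r := by
              rw [Real.conjExponent]; field_simp [show r - 1 ≠ 0 by linarith]
            have e2 : 1 / Real.conjExponent r = 1 - 1 / r := by
              rw [Real.conjExponent]; field_simp [show r - 1 ≠ 0 by linarith]
            simp only [← ENNReal.rpow_mul, e1, e2]
            rfl
        _ = I ^ (1 - 1 / r) * R := by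
            rw [lintegral_const_mul']
            exact ENNReal.rpow_ne_top_of_nonneg
              (by rw [sub_nonneg, div_le_one hr0]; exact hr.le) hItop
    rcases eq_or_ne I 0 with h0 | h0
    · rw [h0]; exact zero_le
    · have h2 : I ^ (1 / r) ≤ R := by
        have h3 : I = I ^ (1 - 1 / r) * I ^ (1 / r) := by
          rw [← ENNReal.rpow_add _ _ h0 hItop]; simp
        have h4 : I ^ (1 - 1 / r) * I ^ (1 / r) ≤ I ^ (1 - 1 / r) * R := h3 ▸ h1
        refine (ENNReal.mul_le_mul_iff_right ?_ ?_).1 h4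
        · exact (ENNReal.rpow_pos (pos_iff_ne_zero.2 h0) hItop).ne'
        · exact ENNReal.rpow_ne_top_of_nonneg
              (by rw [sub_nonneg, div_le_one hr0]; exact hr.le) hItop
      calc I = (I ^ (1 / r)) ^ r := by
            rw [← ENNReal.rpow_mul, one_div_mul_cancel hr0.ne', ENNReal.rpow_one]
        _ ≤ R ^ r := ENNReal.rpow_le_rpow h2 hr0.le
  have h5 : ∫⁻ x, H x ^ r ∂μ ≤ R ^ r := by
    have h6 : ∀ x, H x ^ r = ⨆ n : ℕ, (min (H x) n) ^ r := by
      intro x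
      have h7 : H x = ⨆ n : ℕ, min (H x) n := by
        rw [← inf_iSup_eq]
        simp [ENNReal.iSup_natCast]
      have := (ENNReal.orderIsoRpow r hr0).map_iSup (fun n : ℕ => min (H x) n)
      rw [← h7] at this
      simpa only [ENNReal.orderIsoRpow_apply] using this
    simp_rw [h6]
    rw [lintegral_iSup (fun n => (hHm.min measurable_const).pow_const r)]
    · exact iSup_le key
    · intro m n hmn x
      exact ENNReal.rpow_le_rpow (min_le_min le_rfl (by exact_mod_cast hmn)) hr0.le
  calc (∫⁻ x, H x ^ r ∂μ) ^ (1 / r) ≤ (R ^ r) ^ (1 / r) :=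
        ENNReal.rpow_le_rpow h5 (by positivity)
    _ = R := by rw [← ENNReal.rpow_mul, mul_one_div_cancel hr0.ne', ENNReal.rpow_one]

/-- Hölder's inequality against the constant one. -/
theorem lintegral_le_measure_rpow_mul {α : Type*} [MeasurableSpace α] {μ : Measure α} {p : ℝ}
    (hp : 1 < p) {f : α → ℝ≥0∞} (hf : AEMeasurable f μ) :
    ∫⁻ x, f x ∂μ ≤ μ univ ^ (1 - 1 / p) * (∫⁻ x, f x ^ p ∂μ) ^ (1 / p) := by
  have hpq : (Real.conjExponent p).HolderConjugate p :=
    (Real.HolderConjugate.conjExponent hp).symm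
  have h := ENNReal.lintegral_mul_le_Lp_mul_Lq μ hpq (f := fun _ => 1) aemeasurable_const hf
  have e2 : 1 / Real.conjExponent p = 1 - 1 / p := by
    rw [Real.conjExponent]; field_simp [show p - 1 ≠ 0 by linarith]
  simpa [e2] using h

variable {d : ℕ}

/-- `L_p`–`L_r` bound for the moving integral over balls of radius `τ`: a case of Young's
convolution inequality. By Hölder's inequality the power `r - p` of the moving integral is bounded
pointwise, and the remaining power `p` is integrated with Fubini's theorem. -/
theorem lintegral_ball_rpow_le {p r τ : ℝ} (hp : 1 < p) (hr : p ≤ r) (hτ : 0 < τ)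
    {h : Space d → ℝ≥0∞} (hh : Measurable h) :
    (∫⁻ x, (∫⁻ y in Metric.ball x τ, h y) ^ r) ^ (1 / r) ≤
      volume (Metric.ball (0 : Space d) τ) ^ (1 - 1 / p + 1 / r) * (∫⁻ y, h y ^ p) ^ (1 / p) := by
  have hp0 : 0 < p := by linarith
  have hr0 : 0 < r := by linarith
  have hp1 : 0 ≤ 1 - 1 / p := by rw [sub_nonneg, div_le_one hp0]; exact hp.le
  set V := volume (Metric.ball (0 : Space d) τ) with hV
  have hVx : ∀ x : Space d, volume (Metric.ball x τ) = V := fun x => by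
    rw [hV]; exact Measure.addHaar_ball_center _ _ _
  set G := ∫⁻ y, h y ^ p with hG
  have ha : ∀ x, ∫⁻ y in Metric.ball x τ, h y ≤
      V ^ (1 - 1 / p) * (∫⁻ y in Metric.ball x τ, h y ^ p) ^ (1 / p) := by
    intro x
    have := lintegral_le_measure_rpow_mul (μ := volume.restrict (Metric.ball x τ)) hp
      hh.aemeasurable
    simpa [hVx] using this
  have hsup : ∀ x, ∫⁻ y in Metric.ball x τ, h y ≤ V ^ (1 - 1 / p) * G ^ (1 / p) := fun x =>
    (ha x).trans (mul_le_mul_right (ENNReal.rpow_le_rpow (setLIntegral_le_lintegral _ _)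
      (by positivity)) _)
  have hfub : ∫⁻ x, ∫⁻ y in Metric.ball x τ, h y ^ p = V * G := by
    have hset : MeasurableSet {z : Space d × Space d | dist z.2 z.1 < τ} :=
      measurableSet_lt (measurable_snd.dist measurable_fst) measurable_const
    have hmeas : Measurable (fun z : Space d × Space d =>
        {z : Space d × Space d | dist z.2 z.1 < τ}.indicator (fun z => h z.2 ^ p) z) :=
      ((hh.comp measurable_snd).pow_const p).indicator hset
    calc ∫⁻ x, ∫⁻ y in Metric.ball x τ, h y ^ p
        = ∫⁻ x, ∫⁻ y, {z : Space d × Space d | dist z.2 z.1 < τ}.indicator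
            (fun z => h z.2 ^ p) (x, y) := by
          refine lintegral_congr fun x => ?_
          rw [← lintegral_indicator Metric.isOpen_ball.measurableSet]
          rfl
      _ = ∫⁻ y, ∫⁻ x, {z : Space d × Space d | dist z.2 z.1 < τ}.indicator
            (fun z => h z.2 ^ p) (x, y) := lintegral_lintegral_swap hmeas.aemeasurable
      _ = ∫⁻ y, V * h y ^ p := by
          refine lintegral_congr fun y => ?_
          have : (fun x => {z : Space d × Space d | dist z.2 z.1 < τ}.indicator
              (fun z => h z.2 ^ p) (x, y)) = (Metric.ball y τ).indicator fun _ => h y ^ p := by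
            ext x
            simp only [indicator, mem_ofPred_eq, Metric.mem_ball, dist_comm y x]
          rw [this, lintegral_indicator Metric.isOpen_ball.measurableSet, setLIntegral_const,
            hVx, mul_comm]
      _ = V * G := lintegral_const_mul _ (hh.pow_const p)
  have hVtop : V ≠ ⊤ := measure_ball_lt_top.ne
  have hV0 : V ≠ 0 := (Metric.measure_ball_pos _ _ hτ).ne'
  have hmain : ∫⁻ x, (∫⁻ y in Metric.ball x τ, h y) ^ r ≤
      (V ^ (1 - 1 / p) * G ^ (1 / p)) ^ (r - p) * (V ^ p * G) := by
    have hmeas : Measurable fun x => (∫⁻ y in Metric.ball x τ, h y ^ p) := by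
      have hset : MeasurableSet {z : Space d × Space d | dist z.2 z.1 < τ} :=
        measurableSet_lt (measurable_snd.dist measurable_fst) measurable_const
      have hm : Measurable (fun z : Space d × Space d =>
          {z : Space d × Space d | dist z.2 z.1 < τ}.indicator (fun z => h z.2 ^ p) z) :=
        ((hh.comp measurable_snd).pow_const p).indicator hset
      have := hm.lintegral_prod_right' (ν := volume)
      convert this using 2 with x
      rw [← lintegral_indicator Metric.isOpen_ball.measurableSet]
      rfl
    calc ∫⁻ x, (∫⁻ y in Metric.ball x τ, h y) ^ r
        ≤ ∫⁻ x, (V ^ (1 - 1 / p) * G ^ (1 / p)) ^ (r - p) *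
            (V ^ (p - 1) * ∫⁻ y in Metric.ball x τ, h y ^ p) := by
          refine lintegral_mono fun x => ?_
          have e : r = (r - p) + p := by ring
          conv_lhs => rw [e, ENNReal.rpow_add_of_nonneg _ _ (by linarith) hp0.le]
          refine mul_le_mul' (ENNReal.rpow_le_rpow (hsup x) (by linarith)) ?_
          refine (ENNReal.rpow_le_rpow (ha x) hp0.le).trans_eq ?_
          rw [ENNReal.mul_rpow_of_nonneg _ _ hp0.le, ← ENNReal.rpow_mul, ← ENNReal.rpow_mul,
            one_div_mul_cancel hp0.ne', ENNReal.rpow_one]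
          congr 2
          field_simp
      _ = (V ^ (1 - 1 / p) * G ^ (1 / p)) ^ (r - p) * (V ^ p * G) := by
          rw [lintegral_const_mul _ (hmeas.const_mul _), lintegral_const_mul _ hmeas, hfub,
            ← mul_assoc (V ^ (p - 1))]
          congr 3
          conv_lhs => rw [← ENNReal.rpow_one V, ← ENNReal.rpow_mul, one_mul]
          rw [← ENNReal.rpow_add _ _ hV0 hVtop]; congr 1; ring
  refine (ENNReal.rpow_le_rpow hmain (by positivity)).trans_eq ?_
  have hGp : G = (G ^ (1 / p)) ^ p := by
    rw [← ENNReal.rpow_mul, one_div_mul_cancel hp0.ne', ENNReal.rpow_one]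
  have hx : (V ^ (1 - 1 / p) * G ^ (1 / p)) ^ (r - p) * (V ^ p * G)
      = V ^ ((1 - 1 / p) * (r - p) + p) * (G ^ (1 / p)) ^ r := by
    rw [ENNReal.mul_rpow_of_nonneg _ _ (by linarith), ← ENNReal.rpow_mul V,
      ENNReal.rpow_add _ _ hV0 hVtop]
    have e : (G ^ (1 / p)) ^ r = (G ^ (1 / p)) ^ (r - p) * (G ^ (1 / p)) ^ p := by
      rw [← ENNReal.rpow_add_of_nonneg _ _ (by linarith) hp0.le]; congr 1; ring
    rw [e, ← hGp]
    ring
  rw [hx, ENNReal.mul_rpow_of_nonneg _ _ (by positivity), ← ENNReal.rpow_mul, ← ENNReal.rpow_mul,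
    mul_one_div_cancel hr0.ne', ENNReal.rpow_one]
  congr 2
  field_simp
  ring

end

section

variable {d : ℕ}

/-! ### Mixed norms and averages over centred cylinders -/

/-- The mixed norm `(∫ (∫ f^p dx)^{q/p} dt)^{1/q}` of a function with values in `[0, ∞]`. -/
noncomputable def mixedLp (p q : ℝ) (f : SpaceTime d → ℝ≥0∞) : ℝ≥0∞ :=
  (∫⁻ t : ℝ, (∫⁻ x : Space d, f (t, x) ^ p) ^ (q / p)) ^ (1 / q)

theorem isFiniteMeasure_restrict_ball (x : Space d) (ρ : ℝ) :
    IsFiniteMeasure (volume.restrict (Metric.ball x ρ)) :=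
  ⟨by rw [Measure.restrict_apply_univ]; exact measure_ball_lt_top⟩

theorem mixedLp_congr_ae {p q : ℝ} {f g : SpaceTime d → ℝ≥0∞} (h : f =ᵐ[volume] g) :
    mixedLp p q f = mixedLp p q g := by
  unfold mixedLp
  congr 1
  have h' : ∀ᵐ t : ℝ, ∀ᵐ x : Space d, f (t, x) = g (t, x) := Measure.ae_ae_of_ae_prod h
  refine lintegral_congr_ae (h'.mono fun t ht => ?_)
  simp only
  congr 1
  exact lintegral_congr_ae (ht.mono fun x hx => by simp only [hx])

theorem mixedLp_add_le {p q : ℝ} (hp : 1 ≤ p) (hq : 1 ≤ q) {f g : SpaceTime d → ℝ≥0∞}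
    (hf : Measurable f) (hg : Measurable g) :
    mixedLp p q (fun z => f z + g z) ≤ mixedLp p q f + mixedLp p q g := by
  have hp0 : 0 < p := by linarith
  have hq0 : 0 < q := by linarith
  have e : ∀ k : SpaceTime d → ℝ≥0∞,
      mixedLp p q k = (∫⁻ t, ((∫⁻ x, k (t, x) ^ p) ^ (1 / p)) ^ q) ^ (1 / q) := by
    intro k
    simp only [mixedLp, ← ENNReal.rpow_mul]
    congr! 4
    ring
  have hm : ∀ k : SpaceTime d → ℝ≥0∞, Measurable k →
      Measurable fun t => (∫⁻ x, k (t, x) ^ p) ^ (1 / p) := fun k hk =>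
    ((hk.pow_const p).lintegral_prod_right').pow_const _
  rw [e, e, e]
  refine le_trans (ENNReal.rpow_le_rpow (lintegral_mono fun t => ENNReal.rpow_le_rpow ?_ hq0.le)
    (by positivity)) (ENNReal.lintegral_Lp_add_le (hm f hf).aemeasurable
      (hm g hg).aemeasurable hq)
  exact ENNReal.lintegral_Lp_add_le (hf.comp measurable_prodMk_left).aemeasurable
    (hg.comp measurable_prodMk_left).aemeasurable hp

/-- Hölder's inequality in time. -/
theorem setLIntegral_Lp_le_mixedLp {p q : ℝ} (hq : 1 < q) {f : SpaceTime d → ℝ≥0∞}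
    (hf : Measurable f) (I : Set ℝ) :
    ∫⁻ t in I, (∫⁻ x, f (t, x) ^ p) ^ (1 / p) ≤ volume I ^ (1 - 1 / q) * mixedLp p q f := by
  have hq0 : 0 < q := by linarith
  have hm : Measurable fun t => (∫⁻ x, f (t, x) ^ p) ^ (1 / p) :=
    ((hf.pow_const p).lintegral_prod_right').pow_const _
  refine (lintegral_le_measure_rpow_mul (μ := volume.restrict I) hq hm.aemeasurable).trans ?_
  rw [Measure.restrict_apply_univ]
  refine mul_le_mul_right (ENNReal.rpow_le_rpow ?_ (by positivity)) _
  refine (setLIntegral_le_lintegral _ _).trans_eq (lintegral_congr fun t => ?_)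
  rw [← ENNReal.rpow_mul]
  congr 1
  ring

theorem measurableSet_parCylinder (ρ t : ℝ) (x : Space d) : MeasurableSet (parCylinder ρ t x) :=
  measurableSet_Ico.prod Metric.isOpen_ball.measurableSet

/-- Hölder's inequality on a product set. -/
theorem setLIntegral_prod_le_mixedLp {p q : ℝ} (hp : 1 < p) (hq : 1 < q)
    {f : SpaceTime d → ℝ≥0∞} (hf : Measurable f) {I : Set ℝ} (hI : MeasurableSet I)
    {B : Set (Space d)} (hB : MeasurableSet B) :
    ∫⁻ w in I ×ˢ B, f w ≤ volume I ^ (1 - 1 / q) * volume B ^ (1 - 1 / p) *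
      mixedLp p q ((I ×ˢ B).indicator f) := by
  have hfi : Measurable ((I ×ˢ B).indicator f) := hf.indicator (hI.prod hB)
  have hp1 : 0 ≤ 1 - 1 / p := by
    rw [sub_nonneg, div_le_one (by linarith)]; exact hp.le
  calc ∫⁻ w in I ×ˢ B, f w = ∫⁻ t in I, ∫⁻ x in B, f (t, x) := by
        rw [Measure.volume_eq_prod, ← Measure.prod_restrict, lintegral_prod _ hf.aemeasurable]
    _ ≤ ∫⁻ t in I, volume B ^ (1 - 1 / p) *
          (∫⁻ x, (I ×ˢ B).indicator f (t, x) ^ p) ^ (1 / p) := by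
        refine setLIntegral_mono' hI fun t ht => ?_
        refine (lintegral_le_measure_rpow_mul (μ := volume.restrict B) hp
          (hf.comp measurable_prodMk_left).aemeasurable).trans ?_
        rw [Measure.restrict_apply_univ]
        refine mul_le_mul_right (ENNReal.rpow_le_rpow ?_ (by positivity)) _
        rw [← lintegral_indicator hB]
        refine lintegral_mono fun x => ?_
        by_cases hx : x ∈ B
        · simp [hx, ht]
        · simp [hx]
    _ = volume B ^ (1 - 1 / p) *
          ∫⁻ t in I, (∫⁻ x, (I ×ˢ B).indicator f (t, x) ^ p) ^ (1 / p) := by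
        rw [lintegral_const_mul]
        exact ((hfi.pow_const p).lintegral_prod_right').pow_const _
    _ ≤ volume B ^ (1 - 1 / p) *
          (volume I ^ (1 - 1 / q) * mixedLp p q ((I ×ˢ B).indicator f)) :=
        mul_le_mul_right (setLIntegral_Lp_le_mixedLp hq hfi I) _
    _ = _ := by ring

/-- The average of `f` over the cylinder of radius `τ` centred at `z`, with the volume of the
cylinder replaced by `τ^{d+2}`. -/
noncomputable def cylAvg (f : SpaceTime d → ℝ≥0∞) (τ : ℝ) (z : SpaceTime d) : ℝ≥0∞ :=
  ENNReal.ofReal (τ ^ (-(d + 2 : ℝ))) * ∫⁻ w in parCylinder τ (z.1 - τ ^ 2 / 2) z.2, f w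

theorem measurable_cylAvg {f : SpaceTime d → ℝ≥0∞} (hf : Measurable f) :
    Measurable fun y : ℝ × SpaceTime d => cylAvg f y.1 y.2 := by
  unfold cylAvg
  refine Measurable.mul (by fun_prop) ?_
  have hset : MeasurableSet {y : (ℝ × SpaceTime d) × SpaceTime d |
      y.2 ∈ parCylinder y.1.1 (y.1.2.1 - y.1.1 ^ 2 / 2) y.1.2.2} := by
    have : {y : (ℝ × SpaceTime d) × SpaceTime d |
        y.2 ∈ parCylinder y.1.1 (y.1.2.1 - y.1.1 ^ 2 / 2) y.1.2.2} =
        {y | y.1.2.1 - y.1.1 ^ 2 / 2 ≤ y.2.1} ∩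
          ({y | y.2.1 < y.1.2.1 - y.1.1 ^ 2 / 2 + y.1.1 ^ 2} ∩
          {y | dist y.2.2 y.1.2.2 < y.1.1}) := by
      ext y
      simp [parCylinder, and_assoc]
    rw [this]
    refine (measurableSet_le (by fun_prop) (by fun_prop)).inter
      ((measurableSet_lt (by fun_prop) (by fun_prop)).inter
      (measurableSet_lt (Measurable.dist (by fun_prop) (by fun_prop)) (by fun_prop)))
  have hm := ((hf.comp measurable_snd).indicator hset).lintegral_prod_right'
    (ν := (volume : Measure (SpaceTime d)))
  convert hm using 2 with y
  rw [← lintegral_indicator (measurableSet_parCylinder _ _ _)]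
  rfl

/-- `L_p`–`L_r` smoothing of the cylinder averages, at a fixed time. Only the values of `f` on a
cylinder of radius `2ρ` matter. By Minkowski's inequality the `L_r` norm in `x` may be taken inside
the integral in time; Hölder's inequality in time then produces the mixed norm. -/
theorem cylAvg_Lr_le {p q r τ ρ t : ℝ} (hp : 1 < p) (hq : 1 < q) (hr : p ≤ r) (hτ : 0 < τ)
    (hτρ : τ ≤ ρ) {f : SpaceTime d → ℝ≥0∞} (hf : Measurable f) (x₀ : Space d) :
    (∫⁻ x in Metric.ball x₀ ρ, cylAvg f τ (t, x) ^ r) ^ (1 / r) ≤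
      ENNReal.ofReal (τ ^ (-(d + 2 : ℝ))) *
        (volume (Metric.ball (0 : Space d) τ) ^ (1 - 1 / p + 1 / r) *
        (ENNReal.ofReal (τ ^ 2) ^ (1 - 1 / q) *
          mixedLp p q ((parCylinder (2 * ρ) (t - τ ^ 2 / 2) x₀).indicator f))) := by
  have hr1 : 1 < r := by linarith
  have hr0 : 0 < r := by linarith
  set b := t - τ ^ 2 / 2 with hb
  set I := Ico b (b + τ ^ 2) with hI
  set h : SpaceTime d → ℝ≥0∞ := (parCylinder (2 * ρ) b x₀).indicator f with hh
  have hhm : Measurable h := hf.indicator (measurableSet_parCylinder _ _ _)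
  have hcyl : ∀ x ∈ Metric.ball x₀ ρ, ∫⁻ w in parCylinder τ b x, f w =
      ∫⁻ s in I, ∫⁻ y in Metric.ball x τ, h (s, y) := by
    intro x hx
    have h1 : ∫⁻ w in parCylinder τ b x, f w = ∫⁻ w in parCylinder τ b x, h w := by
      refine setLIntegral_congr_fun (measurableSet_parCylinder _ _ _) fun w hw => ?_
      have hw2 : w ∈ parCylinder (2 * ρ) b x₀ := by
        refine ⟨⟨hw.1.1, hw.1.2.trans_le ?_⟩, ?_⟩
        · nlinarith
        · have := Metric.mem_ball.1 hw.2
          have := Metric.mem_ball.1 hx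
          have := dist_triangle w.2 x x₀
          rw [Metric.mem_ball]; linarith
      simp [hh, hw2]
    rw [h1, parCylinder, Measure.volume_eq_prod, ← Measure.prod_restrict,
      lintegral_prod _ hhm.aemeasurable]
  have hFm : Measurable (Function.uncurry fun (x : Space d) (s : ℝ) =>
      ∫⁻ y in Metric.ball x τ, h (s, y)) := by
    have hset : MeasurableSet {z : (Space d × ℝ) × Space d | dist z.2 z.1.1 < τ} :=
      measurableSet_lt (Measurable.dist (by fun_prop) (by fun_prop)) measurable_const
    have hm := Measurable.lintegral_prod_right' (ν := (volume : Measure (Space d)))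
      ((hhm.comp ((measurable_snd.comp measurable_fst).prodMk measurable_snd)).indicator hset)
    convert hm using 2 with y
    rw [Function.uncurry, ← lintegral_indicator Metric.isOpen_ball.measurableSet]
    rfl
  have := isFiniteMeasure_restrict_ball x₀ ρ
  have hmink := lintegral_minkowski (μ := volume.restrict (Metric.ball x₀ ρ))
    (ν := volume.restrict I) hr1 hFm
  have e1 : ∫⁻ x in Metric.ball x₀ ρ, cylAvg f τ (t, x) ^ r =
      ENNReal.ofReal (τ ^ (-(d + 2 : ℝ))) ^ r *
        ∫⁻ x in Metric.ball x₀ ρ, (∫⁻ s in I, ∫⁻ y in Metric.ball x τ, h (s, y)) ^ r := by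
    rw [← lintegral_const_mul']
    · refine setLIntegral_congr_fun Metric.isOpen_ball.measurableSet fun x hx => ?_
      simp only [cylAvg]
      rw [ENNReal.mul_rpow_of_nonneg _ _ hr0.le, hcyl x hx]
    · exact ENNReal.rpow_ne_top_of_nonneg hr0.le ENNReal.ofReal_ne_top
  rw [e1, ENNReal.mul_rpow_of_nonneg _ _ (by positivity), ← ENNReal.rpow_mul,
    mul_one_div_cancel hr0.ne', ENNReal.rpow_one]
  refine mul_le_mul_right (hmink.trans ?_) _
  have hVtop : volume (Metric.ball (0 : Space d) τ) ≠ ⊤ := measure_ball_lt_top.ne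
  calc ∫⁻ s in I, (∫⁻ x in Metric.ball x₀ ρ, (∫⁻ y in Metric.ball x τ, h (s, y)) ^ r) ^ (1 / r)
      ≤ ∫⁻ s in I, volume (Metric.ball (0 : Space d) τ) ^ (1 - 1 / p + 1 / r) *
          (∫⁻ y, h (s, y) ^ p) ^ (1 / p) := by
        refine lintegral_mono fun s => ?_
        refine le_trans (ENNReal.rpow_le_rpow (setLIntegral_le_lintegral _ _) (by positivity)) ?_
        exact lintegral_ball_rpow_le hp hr hτ (hhm.comp measurable_prodMk_left)
    _ = volume (Metric.ball (0 : Space d) τ) ^ (1 - 1 / p + 1 / r) *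
          ∫⁻ s in I, (∫⁻ y, h (s, y) ^ p) ^ (1 / p) := by
        rw [lintegral_const_mul]
        exact ((hhm.pow_const p).lintegral_prod_right').pow_const _
    _ ≤ _ := by
        refine mul_le_mul_right ?_ _
        have := setLIntegral_Lp_le_mixedLp (p := p) hq hhm I
        rwa [hI, Real.volume_Ico, add_sub_cancel_left] at this

/-! ### Morrey bounds -/

/-- `M` bounds the Morrey norm of `f`, up to a factor which depends on `d` and `p` only: the
mixed norm of `f` over each cylinder of radius `ρ ≤ 1` is at most `ρ^{d/p+2/q-β} M`. -/
def MorreyBound (p q β : ℝ) (f : SpaceTime d → ℝ≥0∞) (M : ℝ≥0∞) : Prop :=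
  ∀ ρ ∈ Ioc (0 : ℝ) 1, ∀ (t : ℝ) (x : Space d),
    mixedLp p q ((parCylinder ρ t x).indicator f) ≤ ENNReal.ofReal (ρ ^ (d / p + 2 / q - β)) * M

/-- The volume of the unit ball of `ℝ^d`. -/
noncomputable def unitVol (d : ℕ) : ℝ≥0∞ := volume (Metric.ball (0 : Space d) 1)

theorem unitVol_ne_top : unitVol d ≠ ⊤ := measure_ball_lt_top.ne

theorem unitVol_ne_zero : unitVol d ≠ 0 := (Metric.measure_ball_pos _ _ one_pos).ne'

theorem volume_ball_eq {ρ : ℝ} (hρ : 0 < ρ) (x : Space d) :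
    volume (Metric.ball x ρ) = ENNReal.ofReal (ρ ^ (d : ℝ)) * unitVol d := by
  rw [Measure.addHaar_ball_of_pos _ _ hρ, unitVol]
  simp

theorem mixedNorm_one_parCylinder {p q ρ : ℝ} (hp : 0 < p) (hq : 0 < q) (hρ : 0 < ρ) (t : ℝ)
    (x : Space d) : mixedNorm p q (parCylinder ρ t x) (fun _ => (1 : ℝ)) =
      ENNReal.ofReal (ρ ^ (d / p + 2 / q)) * unitVol d ^ (1 / p) := by
  have h1 : ∀ s : ℝ, (∫⁻ y : Space d, ((parCylinder ρ t x).indicator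
      (fun _ => ‖(1 : ℝ)‖ₑ) (s, y)) ^ p) ^ (q / p) =
      (Ico t (t + ρ ^ 2)).indicator (fun _ => volume (Metric.ball x ρ) ^ (q / p)) s := by
    intro s
    by_cases hs : s ∈ Ico t (t + ρ ^ 2)
    · have : ∀ y, ((parCylinder ρ t x).indicator (fun _ => ‖(1 : ℝ)‖ₑ) (s, y)) ^ p =
          (Metric.ball x ρ).indicator 1 y := by
        intro y
        by_cases hy : y ∈ Metric.ball x ρ
        · rw [indicator_of_mem (show (s, y) ∈ parCylinder ρ t x from ⟨hs, hy⟩),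
            indicator_of_mem hy]; simp
        · rw [indicator_of_notMem (fun h : (s, y) ∈ parCylinder ρ t x => hy h.2),
            indicator_of_notMem hy]; simp [hp]
      rw [lintegral_congr this, lintegral_indicator_one Metric.isOpen_ball.measurableSet,
        indicator_of_mem hs]
    · have : ∀ y, ((parCylinder ρ t x).indicator (fun _ => ‖(1 : ℝ)‖ₑ) (s, y)) ^ p = 0 := by
        intro y
        rw [indicator_of_notMem (fun h : (s, y) ∈ parCylinder ρ t x => hs h.1)]; simp [hp]
      rw [lintegral_congr this, indicator_of_notMem hs]; simp [hp, hq]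
  unfold mixedNorm
  rw [lintegral_congr h1, lintegral_indicator measurableSet_Ico, setLIntegral_const,
    Real.volume_Ico, add_sub_cancel_left, ENNReal.mul_rpow_of_nonneg _ _ (by positivity),
    ← ENNReal.rpow_mul, volume_ball_eq hρ, ENNReal.mul_rpow_of_nonneg _ _ (by positivity),
    ENNReal.ofReal_rpow_of_pos (by positivity), ENNReal.ofReal_rpow_of_pos (by positivity),
    mul_right_comm, ← ENNReal.ofReal_mul (by positivity)]
  congr 2
  · rw [← Real.rpow_natCast ρ 2, ← Real.rpow_mul hρ.le, ← Real.rpow_mul hρ.le,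
      ← Real.rpow_add hρ]
    congr 1
    push_cast; field_simp
  · field_simp

theorem morreyBound_morreyNorm {F : Type*} [NormedAddCommGroup F] {p q β : ℝ} (hp : 0 < p)
    (hq : 0 < q) (g : SpaceTime d → F) :
    MorreyBound p q β (fun z => ‖g z‖ₑ) (unitVol d ^ (1 / p) * morreyNorm p q β g) := by
  intro ρ hρ t x
  have hρ0 := hρ.1
  set X := mixedLp p q ((parCylinder ρ t x).indicator fun z => ‖g z‖ₑ) with hX
  have h : ENNReal.ofReal (ρ ^ β) * ((ENNReal.ofReal (ρ ^ (d / p + 2 / q)) *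
      unitVol d ^ (1 / p))⁻¹ * X) ≤ morreyNorm p q β g := by
    rw [← mixedNorm_one_parCylinder hp hq hρ0 t x]
    exact le_iSup₂_of_le ρ hρ (le_iSup₂_of_le t x le_rfl)
  have ho : unitVol d ^ (1 / p) ≠ 0 := (ENNReal.rpow_pos
    (pos_iff_ne_zero.2 unitVol_ne_zero) unitVol_ne_top).ne'
  have ho' : unitVol d ^ (1 / p) ≠ ⊤ :=
    ENNReal.rpow_ne_top_of_nonneg (by positivity) unitVol_ne_top
  have hA : ENNReal.ofReal (ρ ^ (d / p + 2 / q)) ≠ 0 := by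
    simpa using Real.rpow_pos_of_pos hρ0 _
  have e : ENNReal.ofReal (ρ ^ (d / p + 2 / q - β)) * ENNReal.ofReal (ρ ^ β) =
      ENNReal.ofReal (ρ ^ (d / p + 2 / q)) := by
    rw [← ENNReal.ofReal_mul (by positivity), ← Real.rpow_add hρ0]; congr 2; ring
  calc X = (ENNReal.ofReal (ρ ^ (d / p + 2 / q)) * unitVol d ^ (1 / p)) *
        ((ENNReal.ofReal (ρ ^ (d / p + 2 / q)) * unitVol d ^ (1 / p))⁻¹ * X) := by
        rw [← mul_assoc, ENNReal.mul_inv_cancel (mul_ne_zero hA ho)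
          (ENNReal.mul_ne_top ENNReal.ofReal_ne_top ho'), one_mul]
    _ = ENNReal.ofReal (ρ ^ (d / p + 2 / q - β)) * (unitVol d ^ (1 / p) *
        (ENNReal.ofReal (ρ ^ β) * ((ENNReal.ofReal (ρ ^ (d / p + 2 / q)) *
          unitVol d ^ (1 / p))⁻¹ * X))) := by
        generalize (ENNReal.ofReal (ρ ^ (d / p + 2 / q)) * unitVol d ^ (1 / p))⁻¹ * X = Y
        rw [← e]; ring
    _ ≤ _ := by gcongr

theorem MorreyBound.congr_ae {p q β : ℝ} {f g : SpaceTime d → ℝ≥0∞} {M : ℝ≥0∞}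
    (h : MorreyBound p q β f M) (hfg : f =ᵐ[volume] g) : MorreyBound p q β g M := by
  intro ρ hρ t x
  rw [← mixedLp_congr_ae (hfg.indicator (s := parCylinder ρ t x))]
  exact h ρ hρ t x

theorem MorreyBound.add {p q β : ℝ} (hp : 1 ≤ p) (hq : 1 ≤ q) {f g : SpaceTime d → ℝ≥0∞}
    {M M' : ℝ≥0∞} (hf : Measurable f) (hg : Measurable g)
    (h : MorreyBound p q β f M) (h' : MorreyBound p q β g M') :
    MorreyBound p q β (fun z => f z + g z) (M + M') := by
  intro ρ hρ t x
  rw [show (fun z => f z + g z) = f + g from rfl, indicator_add', mul_add]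
  refine (mixedLp_add_le hp hq (hf.indicator (measurableSet_parCylinder _ _ _))
    (hg.indicator (measurableSet_parCylinder _ _ _))).trans ?_
  exact add_le_add (h ρ hρ t x) (h' ρ hρ t x)

theorem rpow_le_max_one {a : ℝ≥0∞} {θ : ℝ} (h0 : 0 ≤ θ) (h1 : θ ≤ 1) : a ^ θ ≤ max 1 a := by
  rcases le_total a 1 with h | h
  · exact (ENNReal.rpow_le_one h h0).trans (le_max_left _ _)
  · exact ((ENNReal.rpow_le_rpow_of_exponent_le h h1).trans_eq (ENNReal.rpow_one a)).trans
      (le_max_right _ _)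

/-- Pointwise bound of the cylinder averages of a function of Morrey class. -/
theorem MorreyBound.cylAvg_le {p q β τ : ℝ} (hp : 1 < p) (hq : 1 < q)
    {f : SpaceTime d → ℝ≥0∞} {M : ℝ≥0∞} (hf : Measurable f) (h : MorreyBound p q β f M)
    (hτ : τ ∈ Ioc (0 : ℝ) 1) (z : SpaceTime d) :
    cylAvg f τ z ≤ max 1 (unitVol d) * (ENNReal.ofReal (τ ^ (-β)) * M) := by
  have hτ0 := hτ.1
  have hp1 : 0 ≤ 1 - 1 / p := by
    rw [sub_nonneg, div_le_one (by linarith)]; exact hp.le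
  have hp2 : 1 - 1 / p ≤ 1 := by
    have : 0 ≤ 1 / p := by positivity
    linarith
  have h1 := setLIntegral_prod_le_mixedLp hp hq hf
    (measurableSet_Ico (a := z.1 - τ ^ 2 / 2) (b := z.1 - τ ^ 2 / 2 + τ ^ 2))
    (Metric.isOpen_ball (x := z.2) (ε := τ)).measurableSet
  rw [Real.volume_Ico, add_sub_cancel_left, volume_ball_eq hτ0] at h1
  have h2 := h τ hτ (z.1 - τ ^ 2 / 2) z.2
  calc cylAvg f τ z ≤ ENNReal.ofReal (τ ^ (-(d + 2 : ℝ))) *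
        (ENNReal.ofReal (τ ^ 2) ^ (1 - 1 / q) *
          (ENNReal.ofReal (τ ^ (d : ℝ)) * unitVol d) ^ (1 - 1 / p) *
          (ENNReal.ofReal (τ ^ (d / p + 2 / q - β)) * M)) := by
        refine mul_le_mul_right (h1.trans (mul_le_mul_right h2 _)) _
    _ = unitVol d ^ (1 - 1 / p) * (ENNReal.ofReal (τ ^ (-β)) * M) := by
        have e : τ ^ (-(d + 2 : ℝ)) * ((τ ^ 2) ^ (1 - 1 / q) * (τ ^ (d : ℝ)) ^ (1 - 1 / p) *
            τ ^ (d / p + 2 / q - β)) = τ ^ (-β) := by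
          rw [← Real.rpow_natCast τ 2, ← Real.rpow_mul hτ0.le, ← Real.rpow_mul hτ0.le,
            ← Real.rpow_add hτ0, ← Real.rpow_add hτ0, ← Real.rpow_add hτ0]
          congr 1; push_cast; ring
        rw [← e, ENNReal.mul_rpow_of_nonneg _ _ hp1, ENNReal.ofReal_rpow_of_pos (by positivity),
          ENNReal.ofReal_rpow_of_pos (by positivity), ENNReal.ofReal_mul (by positivity),
          ENNReal.ofReal_mul (by positivity), ENNReal.ofReal_mul (by positivity)]
        ring
    _ ≤ _ := mul_le_mul_left (rpow_le_max_one hp1 hp2) _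

/-- The constant of the `L_r` bounds for cylinder averages; it does not depend on `r`. -/
noncomputable def avgConst (d : ℕ) (p q : ℝ) : ℝ≥0∞ :=
  max 1 (unitVol d) * ENNReal.ofReal (2 ^ (d / p + 2 / q))

theorem avgConst_ne_top (p q : ℝ) : avgConst d p q ≠ ⊤ :=
  ENNReal.mul_ne_top (by simp [unitVol_ne_top]) ENNReal.ofReal_ne_top

/-- `L_r` bound on a ball of radius `ρ` for the averages over cylinders of radius `τ ≤ ρ`. -/
theorem MorreyBound.cylAvg_Lr_le {p q r β τ ρ t : ℝ} (hp : 1 < p) (hq : 1 < q) (hr : p ≤ r)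
    (hβ : 0 ≤ β) {f : SpaceTime d → ℝ≥0∞} {M : ℝ≥0∞} (hf : Measurable f)
    (h : MorreyBound p q β f M) (hτ : 0 < τ) (hτρ : τ ≤ ρ) (hρ : ρ ≤ 1 / 2) (x₀ : Space d) :
    (∫⁻ x in Metric.ball x₀ ρ, cylAvg f τ (t, x) ^ r) ^ (1 / r) ≤
      avgConst d p q *
        (ENNReal.ofReal (τ ^ (d / r - d / p - 2 / q) * ρ ^ (d / p + 2 / q - β)) * M) := by
  have hρ0 : 0 < ρ := hτ.trans_le hτρ
  have hp0 : 0 < p := by linarith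
  have hr0 : 0 < r := by linarith
  have hpr : 1 / r ≤ 1 / p := one_div_le_one_div_of_le hp0 hr
  have hp1 : 0 ≤ 1 - 1 / p := by
    rw [sub_nonneg, div_le_one (by linarith)]; exact hp.le
  have hθ : 0 ≤ 1 - 1 / p + 1 / r := by positivity
  refine (ParabolicMorrey.cylAvg_Lr_le (t := t) hp hq hr hτ hτρ hf x₀).trans ?_
  have h2 := h (2 * ρ) ⟨by linarith, by linarith⟩ (t - τ ^ 2 / 2) x₀
  rw [volume_ball_eq hτ]
  calc _ ≤ ENNReal.ofReal (τ ^ (-(d + 2 : ℝ))) *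
        ((ENNReal.ofReal (τ ^ (d : ℝ)) * unitVol d) ^ (1 - 1 / p + 1 / r) *
          (ENNReal.ofReal (τ ^ 2) ^ (1 - 1 / q) *
          (ENNReal.ofReal ((2 * ρ) ^ (d / p + 2 / q - β)) * M))) := by gcongr
    _ = unitVol d ^ (1 - 1 / p + 1 / r) * ENNReal.ofReal (2 ^ (d / p + 2 / q - β)) *
        (ENNReal.ofReal (τ ^ (d / r - d / p - 2 / q) * ρ ^ (d / p + 2 / q - β)) * M) := by
        have e : τ ^ (-(d + 2 : ℝ)) * ((τ ^ (d : ℝ)) ^ (1 - 1 / p + 1 / r) *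
            (τ ^ 2) ^ (1 - 1 / q)) = τ ^ (d / r - d / p - 2 / q) := by
          rw [← Real.rpow_natCast τ 2, ← Real.rpow_mul hτ.le, ← Real.rpow_mul hτ.le,
            ← Real.rpow_add hτ, ← Real.rpow_add hτ]
          congr 1; push_cast; ring
        rw [← e, ENNReal.mul_rpow_of_nonneg _ _ hθ, ENNReal.ofReal_rpow_of_pos (by positivity),
          ENNReal.ofReal_rpow_of_pos (by positivity), Real.mul_rpow (by norm_num) hρ0.le,
          ENNReal.ofReal_mul (by positivity), ENNReal.ofReal_mul (by positivity),
          ENNReal.ofReal_mul (by positivity), ENNReal.ofReal_mul (by positivity)]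
        ring
    _ ≤ _ := by
        unfold avgConst
        gcongr
        · exact rpow_le_max_one hθ (by linarith)
        · norm_num
        · linarith

/-! ### The potential -/

/-- The potential `∫_0^δ τ^{1-γ} A_τ f(z) dτ`, with `A_τ f` the cylinder averages of `f`. For
`δ = ∞` this is comparable to a parabolic Riesz potential of `f`. -/
noncomputable def potential (γ : ℝ) (f : SpaceTime d → ℝ≥0∞) (δ : ℝ) (z : SpaceTime d) : ℝ≥0∞ :=
  ∫⁻ τ in Ioo 0 δ, ENNReal.ofReal (τ ^ (1 - γ)) * cylAvg f τ z

theorem measurable_potential (γ : ℝ) {f : SpaceTime d → ℝ≥0∞} (hf : Measurable f) (δ : ℝ) :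
    Measurable (potential γ f δ) := by
  unfold potential
  have : Measurable (Function.uncurry fun (z : SpaceTime d) (τ : ℝ) =>
      ENNReal.ofReal (τ ^ (1 - γ)) * cylAvg f τ z) := by
    refine Measurable.mul (by fun_prop) ?_
    exact (measurable_cylAvg hf).comp measurable_swap
  exact this.lintegral_prod_right'

theorem lintegral_rpow_Ioo {a δ : ℝ} (ha : -1 < a) (hδ : 0 < δ) :
    ∫⁻ τ in Ioo 0 δ, ENNReal.ofReal (τ ^ a) = ENNReal.ofReal (δ ^ (a + 1) / (a + 1)) := by
  rw [← ofReal_integral_eq_lintegral_ofReal]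
  · rw [← integral_Ioc_eq_integral_Ioo, ← intervalIntegral.integral_of_le hδ.le,
      integral_rpow (Or.inl ha), Real.zero_rpow (by linarith), sub_zero]
  · have := (intervalIntegral.intervalIntegrable_rpow' (a := 0) (b := δ) ha).1
    exact this.mono_set Ioo_subset_Ioc_self
  · filter_upwards [ae_restrict_mem measurableSet_Ioo] with τ hτ
    exact Real.rpow_nonneg hτ.1.le _

theorem lintegral_rpow_Ioi {a c : ℝ} (ha : a < -1) (hc : 0 < c) :
    ∫⁻ τ in Ioi c, ENNReal.ofReal (τ ^ a) = ENNReal.ofReal (c ^ (a + 1) / (-(a + 1))) := by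
  rw [← ofReal_integral_eq_lintegral_ofReal (integrableOn_Ioi_rpow_of_lt ha hc),
    integral_Ioi_rpow_of_lt ha hc, neg_div, div_neg]
  filter_upwards [ae_restrict_mem measurableSet_Ioi] with τ hτ
  exact Real.rpow_nonneg (hc.le.trans (mem_Ioi.1 hτ).le) _

/-- `L_r` bound on a ball of radius `ρ` for the potential truncated at a scale `δ ≤ ρ`. The
exponent of `τ` in the bound for the averages is integrable at zero since
`γ + d/p + 2/q - d/r < 2`. -/
theorem MorreyBound.potential_Lr_le {p q r β γ δ ρ t : ℝ} (hp : 1 < p) (hq : 1 < q)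
    (hr : p ≤ r) (hβ : 0 ≤ β) {f : SpaceTime d → ℝ≥0∞} {M : ℝ≥0∞} (hf : Measurable f)
    (h : MorreyBound p q β f M) (hκ : γ + d / p + 2 / q - d / r < 2) (hδ : 0 < δ) (hδρ : δ ≤ ρ)
    (hρ : ρ ≤ 1 / 2) (x₀ : Space d) :
    (∫⁻ x in Metric.ball x₀ ρ, potential γ f δ (t, x) ^ r) ^ (1 / r) ≤
      avgConst d p q * (ENNReal.ofReal (δ ^ (2 - (γ + d / p + 2 / q - d / r)) /
        (2 - (γ + d / p + 2 / q - d / r)) * ρ ^ (d / p + 2 / q - β)) * M) := by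
  have hρ0 : 0 < ρ := hδ.trans_le hδρ
  have hr1 : 1 < r := by linarith
  have hr0 : 0 < r := by linarith
  set κ := γ + d / p + 2 / q - d / r with hκdef
  have hm : Measurable (Function.uncurry fun (x : Space d) (τ : ℝ) =>
      ENNReal.ofReal (τ ^ (1 - γ)) * cylAvg f τ (t, x)) := by
    refine Measurable.mul (by fun_prop) ?_
    exact (measurable_cylAvg hf).comp (measurable_snd.prodMk
      (measurable_const.prodMk measurable_fst))
  have := isFiniteMeasure_restrict_ball x₀ ρ
  refine (lintegral_minkowski (μ := volume.restrict (Metric.ball x₀ ρ))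
    (ν := volume.restrict (Ioo 0 δ)) hr1 hm).trans ?_
  calc ∫⁻ τ in Ioo 0 δ, (∫⁻ x in Metric.ball x₀ ρ,
        (ENNReal.ofReal (τ ^ (1 - γ)) * cylAvg f τ (t, x)) ^ r) ^ (1 / r)
      ≤ ∫⁻ τ in Ioo 0 δ, avgConst d p q * ENNReal.ofReal (ρ ^ (d / p + 2 / q - β)) * M *
          ENNReal.ofReal (τ ^ (1 - κ)) := by
        refine setLIntegral_mono' measurableSet_Ioo fun τ hτ => ?_
        have hτ0 := hτ.1
        simp_rw [ENNReal.mul_rpow_of_nonneg _ _ hr0.le]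
        rw [lintegral_const_mul' _ _ (ENNReal.rpow_ne_top_of_nonneg hr0.le ENNReal.ofReal_ne_top),
          ENNReal.mul_rpow_of_nonneg _ _ (by positivity), ← ENNReal.rpow_mul,
          mul_one_div_cancel hr0.ne', ENNReal.rpow_one]
        refine (mul_le_mul_right (h.cylAvg_Lr_le hp hq hr hβ hf hτ0 (hτ.2.le.trans hδρ) hρ x₀)
          _).trans_eq ?_
        have e : τ ^ (1 - κ) = τ ^ (1 - γ) * τ ^ (d / r - d / p - 2 / q) := by
          rw [← Real.rpow_add hτ0]; congr 1; rw [hκdef]; ring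
        rw [e, ENNReal.ofReal_mul (by positivity), ENNReal.ofReal_mul (by positivity)]
        ring
    _ = avgConst d p q * ENNReal.ofReal (ρ ^ (d / p + 2 / q - β)) * M *
          ENNReal.ofReal (δ ^ (2 - κ) / (2 - κ)) := by
        rw [lintegral_const_mul _ (by fun_prop), lintegral_rpow_Ioo (by linarith) hδ,
          show 1 - κ + 1 = 2 - κ by ring]
    _ = _ := by
        have : 0 ≤ δ ^ (2 - κ) / (2 - κ) := div_nonneg (by positivity) (by linarith)
        rw [ENNReal.ofReal_mul this]; ring

/-- Splitting the potential at the scale `ρ`: the scales above `ρ` are bounded pointwise, since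
`β > 2 - γ`. -/
theorem MorreyBound.potential_le_add {p q β γ s ρ : ℝ} (hp : 1 < p) (hq : 1 < q)
    {f : SpaceTime d → ℝ≥0∞} {M : ℝ≥0∞} (hf : Measurable f) (h : MorreyBound p q β f M)
    (hβ : 2 - γ < β) (hρ : 0 < ρ) (hs1 : s ≤ 1) (z : SpaceTime d) :
    potential γ f s z ≤ potential γ f (min s ρ) z + max 1 (unitVol d) *
      (ENNReal.ofReal (ρ ^ (2 - γ - β) / (β + γ - 2)) * M) := by
  have hsub : Ioo 0 s ⊆ Ioo 0 (min s ρ) ∪ (Ici ρ ∩ Ioo 0 s) := by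
    intro τ hτ
    rcases lt_or_ge τ ρ with h1 | h1
    · exact Or.inl ⟨hτ.1, lt_min hτ.2 h1⟩
    · exact Or.inr ⟨h1, hτ⟩
  refine (lintegral_mono_set hsub).trans ((lintegral_union_le _ _ _).trans ?_)
  refine add_le_add le_rfl ?_
  calc ∫⁻ τ in Ici ρ ∩ Ioo 0 s, ENNReal.ofReal (τ ^ (1 - γ)) * cylAvg f τ z
      ≤ ∫⁻ τ in Ici ρ ∩ Ioo 0 s, max 1 (unitVol d) * M * ENNReal.ofReal (τ ^ (1 - γ - β)) := by
        refine setLIntegral_mono' (measurableSet_Ici.inter measurableSet_Ioo) fun τ hτ => ?_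
        have hτ0 : 0 < τ := hτ.2.1
        refine (mul_le_mul_right (h.cylAvg_le hp hq hf ⟨hτ0, hτ.2.2.le.trans hs1⟩ z)
          _).trans_eq ?_
        rw [show 1 - γ - β = (1 - γ) + (-β) by ring, Real.rpow_add hτ0,
          ENNReal.ofReal_mul (by positivity)]
        ring
    _ ≤ ∫⁻ τ in Ici ρ, max 1 (unitVol d) * M * ENNReal.ofReal (τ ^ (1 - γ - β)) :=
        lintegral_mono_set inter_subset_left
    _ = max 1 (unitVol d) * M * ENNReal.ofReal (ρ ^ (2 - γ - β) / (β + γ - 2)) := by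
        rw [lintegral_const_mul _ (by fun_prop), setLIntegral_congr Ioi_ae_eq_Ici.symm,
          lintegral_rpow_Ioi (by linarith) hρ, show 1 - γ - β + 1 = 2 - γ - β by ring,
          show -(2 - γ - β) = β + γ - 2 by ring]
    _ = _ := by ring

end

section

variable {d : ℕ} {E : Type*} [NormedAddCommGroup E] [NormedSpace ℝ E]

/-! ### Parabolic rescaling of kernels -/

/-- The parabolic dilation `(t, x) ↦ (t / σ², x / σ)`. -/
noncomputable def dil (d : ℕ) (σ : ℝ) : SpaceTime d →L[ℝ] SpaceTime d :=
  ((σ ^ 2)⁻¹ • ContinuousLinearMap.fst ℝ ℝ (Space d)).prod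
    (σ⁻¹ • ContinuousLinearMap.snd ℝ ℝ (Space d))

theorem dil_apply (σ : ℝ) (z : SpaceTime d) : dil d σ z = ((σ ^ 2)⁻¹ * z.1, σ⁻¹ • z.2) := rfl

/-- The parabolic rescaling `σ^{-d-2} k(t / σ², x / σ)` of a vector-valued kernel. -/
noncomputable def scaled (k : SpaceTime d → E) (σ : ℝ) (z : SpaceTime d) : E :=
  (σ ^ (d + 2))⁻¹ • k (dil d σ z)

theorem rescale_eq_scaled (ζ : SpaceTime d → ℝ) (ε : ℝ) : rescale ζ ε = scaled ζ ε := by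
  ext z
  simp [rescale, scaled, dil_apply, div_eq_inv_mul]

/-- The convolution of a scalar function with a vector-valued kernel. -/
noncomputable abbrev conv (f : SpaceTime d → ℝ) (k : SpaceTime d → E) : SpaceTime d → E :=
  f ⋆[ContinuousLinearMap.lsmul ℝ ℝ, volume] k

theorem conv_apply (f : SpaceTime d → ℝ) (k : SpaceTime d → E) (z : SpaceTime d) :
    conv f k z = ∫ w, f w • k (z - w) := rfl

theorem mollify_eq_conv (ζ : SpaceTime d → ℝ) (ε : ℝ) (u : SpaceTime d → ℝ) :
    mollify ζ ε u = conv u (scaled ζ ε) := by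
  rw [← rescale_eq_scaled]; rfl

/-- Smooth kernels whose support lies in the closed ball of radius `1/3` for the sup norm of
`ℝ × ℝ^d`, and hence in the centred cylinder of radius `1`. -/
structure IsSmoothKernel (k : SpaceTime d → E) : Prop where
  smooth : ContDiff ℝ ∞ k
  tsupport_subset : tsupport k ⊆ Metric.closedBall 0 (1 / 3)

theorem IsSmoothKernel.hasCompactSupport {k : SpaceTime d → E} (hk : IsSmoothKernel k) :
    HasCompactSupport k :=
  (isCompact_closedBall _ _).of_isClosed_subset (isClosed_tsupport _) hk.tsupport_subset

theorem IsSmoothKernel.exists_bound {k : SpaceTime d → E} (hk : IsSmoothKernel k) :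
    ∃ C : ℝ, 0 ≤ C ∧ ∀ z, ‖k z‖ ≤ C := by
  obtain ⟨C, hC⟩ := hk.smooth.continuous.bounded_above_of_compact_support hk.hasCompactSupport
  exact ⟨C, (norm_nonneg _).trans (hC 0), hC⟩

theorem IsSmoothKernel.fderiv_apply {k : SpaceTime d → E} (hk : IsSmoothKernel k)
    (e : SpaceTime d) : IsSmoothKernel fun z => fderiv ℝ k z e where
  smooth := (hk.smooth.fderiv_right (m := ∞) (by simp)).clm_apply contDiff_const
  tsupport_subset := (tsupport_fderiv_apply_subset ℝ e).trans hk.tsupport_subset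

theorem contDiff_scaled {k : SpaceTime d → E} (hk : ContDiff ℝ ∞ k) (σ : ℝ) :
    ContDiff ℝ ∞ (scaled k σ) :=
  contDiff_const.smul (hk.comp (dil d σ).contDiff)

theorem IsSmoothKernel.bounds_of_scaled_ne_zero {k : SpaceTime d → E} (hk : IsSmoothKernel k)
    {σ : ℝ} (hσ : 0 < σ) {z : SpaceTime d} (hz : scaled k σ z ≠ 0) :
    |z.1| ≤ σ ^ 2 / 3 ∧ ‖z.2‖ ≤ σ / 3 := by
  have h1 : k (dil d σ z) ≠ 0 := fun h => hz (by simp [scaled, h])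
  have h2 := hk.tsupport_subset (subset_tsupport _ h1)
  rw [mem_closedBall_zero_iff, dil_apply, Prod.norm_mk, max_le_iff, norm_mul, norm_smul,
    Real.norm_of_nonneg (by positivity : (0 : ℝ) ≤ (σ ^ 2)⁻¹),
    Real.norm_of_nonneg (by positivity : (0 : ℝ) ≤ σ⁻¹), inv_mul_le_iff₀ (by positivity),
    inv_mul_le_iff₀ hσ, Real.norm_eq_abs] at h2
  constructor <;> linarith [h2.1, h2.2]

theorem hasCompactSupport_scaled {k : SpaceTime d → E} (hk : HasCompactSupport k) {σ : ℝ}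
    (hσ : 0 < σ) : HasCompactSupport (scaled k σ) := by
  obtain ⟨R, hR⟩ := hk.isCompact.isBounded.subset_closedBall 0
  refine HasCompactSupport.intro
    ((isCompact_closedBall (0 : ℝ) (σ ^ 2 * R)).prod (isCompact_closedBall (0 : Space d) (σ * R)))
    fun z hz => ?_
  by_contra h
  have h1 : k (dil d σ z) ≠ 0 := fun h' => h (by simp [scaled, h'])
  have h2 := hR (subset_tsupport _ h1)
  rw [mem_closedBall_zero_iff, dil_apply, Prod.norm_mk, max_le_iff, norm_mul, norm_smul,
    Real.norm_of_nonneg (by positivity : (0 : ℝ) ≤ (σ ^ 2)⁻¹),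
    Real.norm_of_nonneg (by positivity : (0 : ℝ) ≤ σ⁻¹), inv_mul_le_iff₀ (by positivity),
    inv_mul_le_iff₀ hσ] at h2
  exact hz ⟨by simpa using h2.1, by simpa using h2.2⟩

theorem fderiv_scaled {k : SpaceTime d → E} (hk : ContDiff ℝ ∞ k) (σ : ℝ) (z e : SpaceTime d) :
    fderiv ℝ (scaled k σ) z e = (σ ^ (d + 2))⁻¹ • fderiv ℝ k (dil d σ z) (dil d σ e) := by
  have h1 : HasFDerivAt k (fderiv ℝ k (dil d σ z)) (dil d σ z) :=
    (hk.differentiable (by simp) _).hasFDerivAt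
  have h2 := (h1.comp z (dil d σ).hasFDerivAt).const_smul ((σ ^ (d + 2))⁻¹)
  have h3 : fderiv ℝ (scaled k σ) z = _ := h2.fderiv
  rw [h3]; rfl

theorem fderiv_scaled_timeDir {k : SpaceTime d → E} (hk : ContDiff ℝ ∞ k) (σ : ℝ)
    (z : SpaceTime d) : fderiv ℝ (scaled k σ) z timeDir =
      (σ ^ 2)⁻¹ • scaled (fun w => fderiv ℝ k w timeDir) σ z := by
  have : dil d σ timeDir = (σ ^ 2)⁻¹ • (timeDir : SpaceTime d) := by
    simp [dil_apply, timeDir]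
  rw [fderiv_scaled hk, this, map_smul, scaled, smul_comm]

theorem fderiv_scaled_spaceDir {k : SpaceTime d → E} (hk : ContDiff ℝ ∞ k) (σ : ℝ) (i : Fin d)
    (z : SpaceTime d) : fderiv ℝ (scaled k σ) z (spaceDir i) =
      σ⁻¹ • scaled (fun w => fderiv ℝ k w (spaceDir i)) σ z := by
  have : dil d σ (spaceDir i) = σ⁻¹ • (spaceDir i : SpaceTime d) := by
    simp [dil_apply, spaceDir]
  rw [fderiv_scaled hk, this, map_smul, scaled, smul_comm]

/-- Convolution with a rescaled kernel is dominated by cylinder averages. -/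
theorem IsSmoothKernel.enorm_conv_le {k : SpaceTime d → E} (hk : IsSmoothKernel k) {C σ : ℝ}
    (hC : ∀ z, ‖k z‖ ≤ C) (hσ : 0 < σ) {f : SpaceTime d → ℝ} {F : SpaceTime d → ℝ≥0∞}
    {c : ℝ≥0∞} (hc : c ≠ ⊤) (hF : ∀ᵐ w, ‖f w‖ₑ ≤ c * F w) (z : SpaceTime d) :
    ‖conv f (scaled k σ) z‖ₑ ≤ ENNReal.ofReal C * c * cylAvg F σ z := by
  rw [conv_apply]
  refine (enorm_integral_le_lintegral_enorm _).trans ?_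
  have h1 : ∀ᵐ w, ‖f w • scaled k σ (z - w)‖ₑ ≤
      (parCylinder σ (z.1 - σ ^ 2 / 2) z.2).indicator
        (fun w => ENNReal.ofReal C * c * ENNReal.ofReal (σ ^ (-(d + 2 : ℝ))) * F w) w := by
    filter_upwards [hF] with w hw
    by_cases h0 : scaled k σ (z - w) = 0
    · simp [h0]
    · have hb := hk.bounds_of_scaled_ne_zero hσ h0
      have hmem : w ∈ parCylinder σ (z.1 - σ ^ 2 / 2) z.2 := by
        have h2 := abs_le.1 hb.1
        have h3 : 0 < σ ^ 2 := by positivity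
        simp only [Prod.fst_sub] at h2
        refine ⟨⟨by linarith [h2.2], by linarith [h2.1]⟩, ?_⟩
        rw [Metric.mem_ball, dist_comm, dist_eq_norm]
        have := hb.2
        rw [Prod.snd_sub] at this
        linarith
      rw [indicator_of_mem hmem, enorm_smul, mul_comm]
      have h4 : ‖scaled k σ (z - w)‖ₑ ≤
          ENNReal.ofReal C * ENNReal.ofReal (σ ^ (-(d + 2 : ℝ))) := by
        rw [scaled, enorm_smul, mul_comm]
        refine mul_le_mul' ?_ (le_of_eq ?_)
        · rw [← ofReal_norm]; exact ENNReal.ofReal_le_ofReal (hC _)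
        · rw [Real.enorm_of_nonneg (by positivity), Real.rpow_neg hσ.le]
          congr 2
          exact_mod_cast (Real.rpow_natCast σ (d + 2)).symm
      calc _ ≤ ENNReal.ofReal C * ENNReal.ofReal (σ ^ (-(d + 2 : ℝ))) * (c * F w) :=
            mul_le_mul' h4 hw
        _ = _ := by ring
  refine (lintegral_mono_ae h1).trans_eq ?_
  rw [lintegral_indicator (measurableSet_parCylinder _ _ _), lintegral_const_mul', cylAvg]
  · ring
  · exact ENNReal.mul_ne_top (ENNReal.mul_ne_top ENNReal.ofReal_ne_top hc) ENNReal.ofReal_ne_top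

/-- A weak derivative may be moved onto the kernel of a convolution. -/
theorem HasWeakDeriv.conv_fderiv {e : SpaceTime d} {u g : SpaceTime d → ℝ}
    (h : HasWeakDeriv e u g) {k : SpaceTime d → E} (hk : ContDiff ℝ ∞ k)
    (hc : HasCompactSupport k) (z : SpaceTime d) :
    conv u (fun w => fderiv ℝ k w e) z = conv g k z := by
  have hk' : Continuous fun w => fderiv ℝ k w e :=
    ((hk.fderiv_right (m := ∞) (by simp)).clm_apply contDiff_const).continuous
  have hc' : HasCompactSupport fun w => fderiv ℝ k w e := hc.fderiv_apply ℝ e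
  have i1 : Integrable (fun w => u w • fderiv ℝ k (z - w) e) :=
    (hc'.convolutionExists_right (ContinuousLinearMap.lsmul ℝ ℝ) h.1 hk') z
  have i2 : Integrable (fun w => g w • k (z - w)) :=
    (hc.convolutionExists_right (ContinuousLinearMap.lsmul ℝ ℝ) h.2.1 hk.continuous) z
  by_cases hE : CompleteSpace E
  swap
  · simp [conv_apply, integral, hE]
  refine (SeparatingDual.eq_iff_forall_dual_eq (R := ℝ)).2 fun l => ?_
  rw [conv_apply, conv_apply, ← l.integral_comp_comm i1, ← l.integral_comp_comm i2]
  have hφ : ContDiff ℝ ∞ fun w => l (k (z - w)) :=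
    l.contDiff.comp (hk.comp (contDiff_const.sub contDiff_id))
  have hφc : HasCompactSupport fun w => l (k (z - w)) :=
    (hc.comp_homeomorph (Homeomorph.subLeft z)).comp_left (g := l) (map_zero l)
  have hw := h.2.2 _ hφ hφc
  have hd : ∀ w, fderiv ℝ (fun w => l (k (z - w))) w e = - l (fderiv ℝ k (z - w) e) := by
    intro w
    have h1 : HasFDerivAt k (fderiv ℝ k (z - w)) (z - w) :=
      (hk.differentiable (by simp) _).hasFDerivAt
    have h2 : HasFDerivAt (fun w => z - w) (-ContinuousLinearMap.id ℝ (SpaceTime d)) w :=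
      (hasFDerivAt_id w).const_sub z
    have h3 := l.hasFDerivAt.comp w (h1.comp w h2)
    have h4 : fderiv ℝ (fun w => l (k (z - w))) w = _ := h3.fderiv
    rw [h4]; simp
  simp only [hd, mul_neg, integral_neg, neg_inj] at hw
  simpa [map_smul, smul_eq_mul] using hw

/-- The kernels `P`, `R₁`, `R₂` of order `γ` are such that the derivative in `σ` of
`σ^{-γ} (u * P_σ)` is a combination of convolutions of `∂_t u` and `Δu` with rescalings of `R₁`
and `R₂`. -/
structure IsScaleKernel (γ : ℕ) (P R₁ R₂ : SpaceTime d → E) : Prop where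
  kernel : IsSmoothKernel P
  kernel₁ : IsSmoothKernel R₁
  kernel₂ : IsSmoothKernel R₂
  identity : ∀ z, ((d : ℝ) + 2 + γ) • P z + fderiv ℝ P z (2 * z.1, z.2) =
    fderiv ℝ R₁ z timeDir +
      ∑ i, fderiv ℝ (fun w => fderiv ℝ R₂ w (spaceDir i)) z (spaceDir i)

/-- The kernel `σ^{-γ} P_σ` as a function of the scale and of the point. -/
noncomputable def scaleFamily (γ : ℕ) (P : SpaceTime d → E) (σ : ℝ) (z : SpaceTime d) : E :=
  (σ ^ (d + 2 + γ))⁻¹ • P (dil d σ z)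

theorem scaleFamily_eq (γ : ℕ) (P : SpaceTime d → E) (σ : ℝ) :
    scaleFamily γ P σ = (σ ^ γ)⁻¹ • scaled P σ := by
  ext z
  simp only [scaleFamily, Pi.smul_apply, scaled, smul_smul]
  congr 1
  rw [pow_add _ (d + 2), mul_inv, mul_comm]

theorem contDiffOn_scaleFamily (γ : ℕ) {P : SpaceTime d → E} (hP : ContDiff ℝ ∞ P) :
    ContDiffOn ℝ ∞ (↿(scaleFamily γ P)) (Ioo (0 : ℝ) 2 ×ˢ (univ : Set (SpaceTime d))) := by
  have h1 : ContDiffOn ℝ ∞ (fun q : ℝ × SpaceTime d => (q.1 ^ (d + 2 + γ))⁻¹)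
      (Ioo (0 : ℝ) 2 ×ˢ univ) :=
    (contDiff_fst.pow _).contDiffOn.inv fun q hq => (pow_pos hq.1.1 _).ne'
  have h2 : ContDiffOn ℝ ∞ (fun q : ℝ × SpaceTime d => dil d q.1 q.2)
      (Ioo (0 : ℝ) 2 ×ˢ univ) := by
    simp only [dil_apply]
    refine ContDiffOn.prodMk ?_ ?_
    · exact ((contDiff_fst.pow _).contDiffOn.inv fun q hq => (pow_pos hq.1.1 _).ne').mul
        (contDiff_fst.comp contDiff_snd).contDiffOn
    · exact (contDiff_fst.contDiffOn.inv fun q hq => hq.1.1.ne').smul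
        (contDiff_snd.comp contDiff_snd).contDiffOn
  exact h1.smul (hP.comp_contDiffOn h2)

theorem IsSmoothKernel.scaleFamily_eq_zero (γ : ℕ) {P : SpaceTime d → E} (hP : IsSmoothKernel P) :
    ∀ σ z, σ ∈ Ioo (0 : ℝ) 2 → z ∉ Metric.closedBall (0 : SpaceTime d) 2 →
      scaleFamily γ P σ z = 0 := by
  intro σ z hσ hz
  by_contra h
  have h1 : scaled P σ z ≠ 0 := fun h' => h (by rw [scaleFamily_eq, Pi.smul_apply, h', smul_zero])
  have h2 := hP.bounds_of_scaled_ne_zero hσ.1 h1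
  refine hz ?_
  rw [mem_closedBall_zero_iff, Prod.norm_def, max_le_iff, Real.norm_eq_abs]
  have := hσ.1
  have := hσ.2
  constructor
  · nlinarith [h2.1]
  · linarith [h2.2]

/-- The derivative in the scale of the kernel is `-σ^{1-γ}` times a time derivative plus a
Laplacian of rescaled kernels. -/
theorem IsScaleKernel.hasDerivAt_scaleFamily {γ : ℕ} {P R₁ R₂ : SpaceTime d → E}
    (h : IsScaleKernel γ P R₁ R₂) {σ : ℝ} (hσ : 0 < σ) (z : SpaceTime d) :
    HasDerivAt (fun s => scaleFamily γ P s z)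
      (-(σ ^ γ)⁻¹ • σ • (fderiv ℝ (scaled R₁ σ) z timeDir +
        ∑ i, fderiv ℝ (fun w => fderiv ℝ (scaled R₂ σ) w (spaceDir i)) z (spaceDir i))) σ := by
  have hd1 : HasDerivAt (fun s : ℝ => (s ^ (d + 2 + γ))⁻¹)
      (-((d : ℝ) + 2 + γ) * (σ ^ (d + 3 + γ))⁻¹) σ := by
    have := (hasDerivAt_pow (d + 2 + γ) σ).inv (pow_pos hσ _).ne'
    refine this.congr_deriv ?_
    have e : d + 2 + γ - 1 = d + 1 + γ := by omega
    rw [e]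
    push_cast
    field_simp
    ring
  have hd2 : HasDerivAt (fun s : ℝ => dil d s z)
      (-σ⁻¹ • (2 * (dil d σ z).1, (dil d σ z).2) : SpaceTime d) σ := by
    have a1 : HasDerivAt (fun s : ℝ => (s ^ 2)⁻¹ * z.1) (-σ⁻¹ * (2 * ((σ ^ 2)⁻¹ * z.1))) σ := by
      have := ((hasDerivAt_pow 2 σ).inv (pow_pos hσ _).ne').mul_const z.1
      refine this.congr_deriv ?_
      field_simp
      ring
    have a2 : HasDerivAt (fun s : ℝ => s⁻¹ • z.2) (-σ⁻¹ • σ⁻¹ • z.2) σ := by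
      have := (hasDerivAt_inv hσ.ne').smul_const z.2
      refine this.congr_deriv ?_
      rw [smul_smul]; congr 1; field_simp
    exact a1.prodMk a2
  have hP : HasFDerivAt P (fderiv ℝ P (dil d σ z)) (dil d σ z) :=
    (h.kernel.smooth.differentiable (by simp) _).hasFDerivAt
  have hd3 := hd1.smul (hP.comp_hasDerivAt σ hd2)
  refine hd3.congr_deriv ?_
  have hR : ∀ i, fderiv ℝ (fun w => fderiv ℝ (scaled R₂ σ) w (spaceDir i)) z (spaceDir i) =
      (σ ^ 2)⁻¹ • scaled (fun w => fderiv ℝ (fun w' => fderiv ℝ R₂ w' (spaceDir i)) w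
        (spaceDir i)) σ z := by
    intro i
    have e1 : (fun w => fderiv ℝ (scaled R₂ σ) w (spaceDir i)) =
        σ⁻¹ • scaled (fun w => fderiv ℝ R₂ w (spaceDir i)) σ := by
      ext w; rw [fderiv_scaled_spaceDir h.kernel₂.smooth]; rfl
    have hs := (h.kernel₂.fderiv_apply (spaceDir i)).smooth
    rw [e1, fderiv_const_smul ((contDiff_scaled hs σ).differentiable (by simp) z)]
    simp only [smul_apply]
    rw [fderiv_scaled_spaceDir hs, smul_smul]
    congr 1
    rw [sq, mul_inv]
  have hid := h.identity (dil d σ z)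
  simp only [hR, fderiv_scaled_timeDir h.kernel₁.smooth]
  rw [← Finset.smul_sum, ← smul_add]
  simp only [scaled]
  rw [← Finset.smul_sum, ← smul_add, ← hid, map_smul]
  simp only [smul_add, smul_smul, Function.comp_apply]
  rw [add_comm]
  congr 1
  · congr 1
    field_simp
    ring
  · congr 1
    field_simp
    ring

end

section

variable {d : ℕ} {E : Type*} [NormedAddCommGroup E] [NormedSpace ℝ E]

/-! ### The derivative in the scale -/

theorem integrable_conv {f : SpaceTime d → ℝ} (hf : LocallyIntegrable f volume)
    {k : SpaceTime d → E} (hk : Continuous k) (hc : HasCompactSupport k) (z : SpaceTime d) :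
    Integrable fun w => f w • k (z - w) :=
  (hc.convolutionExists_right (ContinuousLinearMap.lsmul ℝ ℝ) hf hk) z

theorem conv_add_right {f : SpaceTime d → ℝ} (hf : LocallyIntegrable f volume)
    {k k' : SpaceTime d → E} (hk : Continuous k) (hc : HasCompactSupport k)
    (hk' : Continuous k') (hc' : HasCompactSupport k') (z : SpaceTime d) :
    conv f (fun w => k w + k' w) z = conv f k z + conv f k' z := by
  simp only [conv_apply, smul_add]
  exact integral_add (integrable_conv hf hk hc z) (integrable_conv hf hk' hc' z)

theorem conv_sum_right {ι : Type*} (s : Finset ι) {f : SpaceTime d → ℝ}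
    (hf : LocallyIntegrable f volume) {k : ι → SpaceTime d → E} (hk : ∀ i, Continuous (k i))
    (hc : ∀ i, HasCompactSupport (k i)) (z : SpaceTime d) :
    conv f (fun w => ∑ i ∈ s, k i w) z = ∑ i ∈ s, conv f (k i) z := by
  simp only [conv_apply, Finset.smul_sum]
  exact integral_finsetSum _ fun i _ => integrable_conv hf (hk i) (hc i) z

theorem conv_sum_left {ι : Type*} (s : Finset ι) {f : ι → SpaceTime d → ℝ}
    (hf : ∀ i, LocallyIntegrable (f i) volume) {k : SpaceTime d → E} (hk : Continuous k)
    (hc : HasCompactSupport k) (z : SpaceTime d) :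
    conv (fun w => ∑ i ∈ s, f i w) k z = ∑ i ∈ s, conv (f i) k z := by
  simp only [conv_apply, Finset.sum_smul]
  exact integral_finsetSum _ fun i _ => integrable_conv (hf i) hk hc z

theorem conv_smul_right (f : SpaceTime d → ℝ) (c : ℝ) (k : SpaceTime d → E) (z : SpaceTime d) :
    conv f (fun w => c • k w) z = c • conv f k z := by
  simp only [conv_apply, smul_comm _ c, integral_smul]

theorem conv_spatial_laplacian {u : SpaceTime d → ℝ} {Du : SpaceTime d → EuclideanSpace ℝ (Fin d)}
    {D2u : SpaceTime d → EuclideanSpace ℝ (Fin d × Fin d)}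
    (h1 : ∀ i, HasWeakDeriv (spaceDir i) u (fun z => Du z i))
    (h2 : ∀ i j, HasWeakDeriv (spaceDir j) (fun z => Du z i) (fun z => D2u z (i, j)))
    (hu : LocallyIntegrable u volume) {k : SpaceTime d → E} (hk : ContDiff ℝ ∞ k)
    (hc : HasCompactSupport k) (z : SpaceTime d) :
    conv u (fun z => ∑ i, fderiv ℝ (fun w => fderiv ℝ k w (spaceDir i)) z (spaceDir i)) z =
      conv (fun w => ∑ i, D2u w (i, i)) k z := by
  have hs : ∀ i, ContDiff ℝ ∞ fun w => fderiv ℝ k w (spaceDir i) := fun i =>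
    (hk.fderiv_right (m := ∞) (by simp)).clm_apply contDiff_const
  have hsc : ∀ i, HasCompactSupport fun w => fderiv ℝ k w (spaceDir i) := fun i =>
    hc.fderiv_apply ℝ _
  have hs' : ∀ i, ContDiff ℝ ∞ fun z => fderiv ℝ (fun w => fderiv ℝ k w (spaceDir i)) z
      (spaceDir i) := fun i =>
    ((hs i).fderiv_right (m := ∞) (by simp)).clm_apply contDiff_const
  rw [conv_sum_right _ hu (fun i => (hs' i).continuous) (fun i => (hsc i).fderiv_apply ℝ _),
    conv_sum_left _ (fun i => (h2 i i).2.1) hk.continuous hc]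
  refine Finset.sum_congr rfl fun i _ => ?_
  rw [(h1 i).conv_fderiv (hs i) (hsc i), (h2 i i).conv_fderiv hk hc]

variable {u ut : SpaceTime d → ℝ} {Du : SpaceTime d → EuclideanSpace ℝ (Fin d)}
  {D2u : SpaceTime d → EuclideanSpace ℝ (Fin d × Fin d)} {γ : ℕ} {P R₁ R₂ : SpaceTime d → E}

theorem contDiffOn_conv_scaleFamily (hP : IsSmoothKernel P) (γ : ℕ)
    (hu : LocallyIntegrable u volume) (z : SpaceTime d) :
    ContDiffOn ℝ ∞ (fun s => conv u (scaleFamily γ P s) z) (Ioo (0 : ℝ) 2) := by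
  have h := contDiffOn_convolution_right_with_param (n := ⊤) (μ := volume)
    (ContinuousLinearMap.lsmul ℝ ℝ)
    isOpen_Ioo (isCompact_closedBall (0 : SpaceTime d) 2) (hP.scaleFamily_eq_zero γ) hu
    (contDiffOn_scaleFamily γ hP.smooth)
  have hc : ContDiffOn ℝ ∞ (fun s : ℝ => (s, z)) (Ioo (0 : ℝ) 2) :=
    (contDiff_id.prodMk contDiff_const).contDiffOn
  exact h.comp hc fun s hs => ⟨hs, mem_univ _⟩

theorem continuous_conv_scaleFamily (hP : IsSmoothKernel P) (γ : ℕ)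
    (hu : LocallyIntegrable u volume) {σ : ℝ} (hσ : 0 < σ) :
    Continuous (conv u (scaleFamily γ P σ)) := by
  rw [scaleFamily_eq]
  refine HasCompactSupport.continuous_convolution_right _ ?_ hu ?_
  · exact (hasCompactSupport_scaled hP.hasCompactSupport hσ).smul_left (f := fun _ => (σ ^ γ)⁻¹)
  · exact ((contDiff_scaled hP.smooth σ).continuous).const_smul _

/-- The derivative of `σ^{-γ} (u * P_σ)` in the scale, with the derivatives of the kernels moved
onto `u`. -/
theorem IsScaleKernel.hasDerivAt_conv (h : IsScaleKernel γ P R₁ R₂)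
    (ht : HasWeakDeriv timeDir u ut)
    (h1 : ∀ i, HasWeakDeriv (spaceDir i) u (fun z => Du z i))
    (h2 : ∀ i j, HasWeakDeriv (spaceDir j) (fun z => Du z i) (fun z => D2u z (i, j)))
    {σ : ℝ} (hσ : σ ∈ Ioo (0 : ℝ) 2) (z : SpaceTime d) :
    HasDerivAt (fun s => conv u (scaleFamily γ P s) z)
      (-(σ ^ γ)⁻¹ • σ • (conv ut (scaled R₁ σ) z +
        conv (fun w => ∑ i, D2u w (i, i)) (scaled R₂ σ) z)) σ := by
  have hg := contDiffOn_scaleFamily (d := d) γ h.kernel.smooth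
  have hz := h.kernel.scaleFamily_eq_zero γ
  have hopen : IsOpen (Ioo (0 : ℝ) 2 ×ˢ (univ : Set (SpaceTime d))) := isOpen_Ioo.prod isOpen_univ
  have hF := hasFDerivAt_convolution_right_with_param (μ := volume)
    (ContinuousLinearMap.lsmul ℝ ℝ) isOpen_Ioo (isCompact_closedBall (0 : SpaceTime d) 2) hz ht.1
    (hg.of_le (by simp)) (σ, z) hσ
  have hcurve : HasDerivAt (fun s : ℝ => (s, z)) ((1 : ℝ), (0 : SpaceTime d)) σ :=
    (hasDerivAt_id σ).prodMk (hasDerivAt_const σ z)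
  refine (hF.comp_hasDerivAt σ hcurve).congr_deriv ?_
  -- the derivative of the kernel in the direction of the scale
  have hdir : ∀ a, fderiv ℝ (↿(scaleFamily γ P)) (σ, a) ((1 : ℝ), (0 : SpaceTime d)) =
      -(σ ^ γ)⁻¹ • σ • (fderiv ℝ (scaled R₁ σ) a timeDir +
        ∑ i, fderiv ℝ (fun w => fderiv ℝ (scaled R₂ σ) w (spaceDir i)) a (spaceDir i)) := by
    intro a
    have hm : (σ, a) ∈ Ioo (0 : ℝ) 2 ×ˢ (univ : Set (SpaceTime d)) := ⟨hσ, mem_univ _⟩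
    have d1 : HasFDerivAt (↿(scaleFamily γ P)) (fderiv ℝ (↿(scaleFamily γ P)) (σ, a)) (σ, a) :=
      ((hg.contDiffAt (hopen.mem_nhds hm)).differentiableAt (by simp)).hasFDerivAt
    have hcurve' : HasDerivAt (fun s : ℝ => (s, a)) ((1 : ℝ), (0 : SpaceTime d)) σ :=
      (hasDerivAt_id σ).prodMk (hasDerivAt_const σ a)
    have d2 := HasFDerivAt.comp_hasDerivAt (l := ↿(scaleFamily γ P)) σ d1 hcurve'
    exact HasDerivAt.unique (f := fun s => scaleFamily γ P s a) d2
      (h.hasDerivAt_scaleFamily hσ.1 a)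
  have hcont : Continuous fun a : SpaceTime d => fderiv ℝ (↿(scaleFamily γ P)) (σ, a) := by
    have := hg.continuousOn_fderiv_of_isOpen hopen (by simp)
    exact this.comp_continuous (by fun_prop) fun a => ⟨hσ, mem_univ _⟩
  have hcs : HasCompactSupport fun a : SpaceTime d => fderiv ℝ (↿(scaleFamily γ P)) (σ, a) := by
    refine HasCompactSupport.intro (isCompact_closedBall (0 : SpaceTime d) 2) fun a ha => ?_
    have hev : (↿(scaleFamily γ P)) =ᶠ[𝓝 (σ, a)] fun _ => (0 : E) := by
      have hn : Ioo (0 : ℝ) 2 ×ˢ (Metric.closedBall (0 : SpaceTime d) 2)ᶜ ∈ 𝓝 (σ, a) :=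
        (isOpen_Ioo.prod Metric.isClosed_closedBall.isOpen_compl).mem_nhds ⟨hσ, ha⟩
      filter_upwards [hn] with q hq using hz q.1 q.2 hq.1 hq.2
    rw [hev.fderiv_eq]
    simp
  rw [convolution_precompR_apply _ ht.1 hcs hcont]
  have e : (fun a : SpaceTime d => fderiv ℝ (↿(scaleFamily γ P)) (σ, a) ((1 : ℝ), 0)) = _ :=
    funext hdir
  rw [e]
  have hs1 := contDiff_scaled h.kernel₁.smooth σ
  have hc1 := hasCompactSupport_scaled h.kernel₁.hasCompactSupport hσ.1
  have hs2 := contDiff_scaled h.kernel₂.smooth σ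
  have hc2 := hasCompactSupport_scaled h.kernel₂.hasCompactSupport hσ.1
  have hs : ∀ i, ContDiff ℝ ∞ fun w => fderiv ℝ (scaled R₂ σ) w (spaceDir i) := fun i =>
    (hs2.fderiv_right (m := ∞) (by simp)).clm_apply contDiff_const
  have hs' : ∀ i, ContDiff ℝ ∞ fun z => fderiv ℝ (fun w => fderiv ℝ (scaled R₂ σ) w (spaceDir i)) z
      (spaceDir i) := fun i =>
    ((hs i).fderiv_right (m := ∞) (by simp)).clm_apply contDiff_const
  have hsc : ∀ i, HasCompactSupport fun z => fderiv ℝ (fun w => fderiv ℝ (scaled R₂ σ) w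
      (spaceDir i)) z (spaceDir i) := fun i => (hc2.fderiv_apply ℝ _).fderiv_apply ℝ _
  change conv u (fun a => -(σ ^ γ)⁻¹ • σ • (fderiv ℝ (scaled R₁ σ) a timeDir +
        ∑ i, fderiv ℝ (fun w => fderiv ℝ (scaled R₂ σ) w (spaceDir i)) a (spaceDir i))) z = _
  rw [conv_smul_right, conv_smul_right, conv_add_right ht.1
    ((hs1.fderiv_right (m := ∞) (by simp)).clm_apply contDiff_const).continuous
    (hc1.fderiv_apply ℝ _) (continuous_finsetSum _ fun i _ => (hs' i).continuous) ?_,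
    ht.conv_fderiv hs1 hc1, conv_spatial_laplacian h1 h2 ht.1 hs2 hc2]
  refine hc2.mono' (fun w hw => ?_)
  by_contra hn
  refine hw (Finset.sum_eq_zero fun i _ => ?_)
  have hn' : w ∉ tsupport fun z => fderiv ℝ (fun w => fderiv ℝ (scaled R₂ σ) w
      (spaceDir i)) z (spaceDir i) := fun h' =>
    hn (tsupport_fderiv_apply_subset ℝ _ (tsupport_fderiv_apply_subset ℝ _ h'))
  exact image_eq_zero_of_notMem_tsupport (f := fun z => fderiv ℝ (fun w =>
    fderiv ℝ (scaled R₂ σ) w (spaceDir i)) z (spaceDir i)) hn'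

/-- The increments in the scale are dominated by the potential of `|∂_t u| + |D²u|`. -/
theorem IsScaleKernel.enorm_conv_sub_le [CompleteSpace E] (h : IsScaleKernel γ P R₁ R₂)
    (ht : HasWeakDeriv timeDir u ut)
    (h1 : ∀ i, HasWeakDeriv (spaceDir i) u (fun z => Du z i))
    (h2 : ∀ i j, HasWeakDeriv (spaceDir j) (fun z => Du z i) (fun z => D2u z (i, j)))
    {C₁ C₂ : ℝ} (hC₁ : ∀ z, ‖R₁ z‖ ≤ C₁) (hC₂ : ∀ z, ‖R₂ z‖ ≤ C₂) {F : SpaceTime d → ℝ≥0∞}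
    (hF₁ : ∀ᵐ w, ‖ut w‖ₑ ≤ F w) (hF₂ : ∀ᵐ w, ‖D2u w‖ₑ ≤ F w) {a b : ℝ} (ha : 0 < a)
    (hab : a ≤ b) (hb : b ≤ 1) (z : SpaceTime d) :
    ‖conv u (scaleFamily γ P b) z - conv u (scaleFamily γ P a) z‖ₑ ≤
      (ENNReal.ofReal C₁ + ENNReal.ofReal C₂ * d) * potential γ F b z := by
  set S : ℝ → E := fun σ => -(σ ^ γ)⁻¹ • σ • (conv ut (scaled R₁ σ) z +
        conv (fun w => ∑ i, D2u w (i, i)) (scaled R₂ σ) z) with hS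
  have hmem : ∀ σ ∈ Icc a b, σ ∈ Ioo (0 : ℝ) 2 := fun σ hσ =>
    ⟨ha.trans_le hσ.1, by linarith [hσ.2]⟩
  have hder : ∀ σ ∈ Icc a b, HasDerivAt (fun s => conv u (scaleFamily γ P s) z) (S σ) σ :=
    fun σ hσ => h.hasDerivAt_conv ht h1 h2 (hmem σ hσ) z
  have hcont : ContinuousOn S (Icc a b) := by
    have h3 := (contDiffOn_conv_scaleFamily h.kernel γ ht.1 z).continuousOn_deriv_of_isOpen
      isOpen_Ioo (by simp)
    exact (h3.mono hmem).congr fun σ hσ => (hder σ hσ).deriv.symm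
  have hint : ∫ σ in a..b, S σ = conv u (scaleFamily γ P b) z - conv u (scaleFamily γ P a) z := by
    refine intervalIntegral.integral_eq_sub_of_hasDerivAt (fun σ hσ => hder σ ?_) ?_
    · rwa [uIcc_of_le hab] at hσ
    · refine ContinuousOn.intervalIntegrable ?_
      rwa [uIcc_of_le hab]
  rw [← hint, intervalIntegral.integral_of_le hab, integral_Ioc_eq_integral_Ioo]
  refine (enorm_integral_le_lintegral_enorm _).trans ?_
  have hF₂' : ∀ᵐ w, ‖∑ i, D2u w (i, i)‖ₑ ≤ (d : ℝ≥0∞) * F w := by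
    filter_upwards [hF₂] with w hw
    refine (enorm_sum_le _ _).trans ?_
    calc ∑ i : Fin d, ‖D2u w (i, i)‖ₑ ≤ ∑ _i : Fin d, F w := by
          refine Finset.sum_le_sum fun i _ => le_trans ?_ hw
          rw [← ofReal_norm, ← ofReal_norm]
          exact ENNReal.ofReal_le_ofReal (PiLp.norm_apply_le _ _)
      _ = _ := by simp
  have hF₁' : ∀ᵐ w, ‖ut w‖ₑ ≤ 1 * F w := by simpa using hF₁
  calc ∫⁻ σ in Ioo a b, ‖S σ‖ₑ
      ≤ ∫⁻ σ in Ioo a b, (ENNReal.ofReal C₁ + ENNReal.ofReal C₂ * d) *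
          (ENNReal.ofReal (σ ^ (1 - (γ : ℝ))) * cylAvg F σ z) := by
        refine setLIntegral_mono' measurableSet_Ioo fun σ hσ => ?_
        have hσ0 : 0 < σ := ha.trans hσ.1
        have e1 : ‖S σ‖ₑ = ENNReal.ofReal (σ ^ (1 - (γ : ℝ))) * ‖conv ut (scaled R₁ σ) z +
            conv (fun w => ∑ i, D2u w (i, i)) (scaled R₂ σ) z‖ₑ := by
          rw [hS]
          simp only [smul_smul, enorm_smul]
          congr 1
          rw [← ofReal_norm, norm_mul, norm_neg, Real.norm_of_nonneg (by positivity),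
            Real.norm_of_nonneg hσ0.le, Real.rpow_sub hσ0, Real.rpow_one, Real.rpow_natCast,
            div_eq_inv_mul]
        rw [e1]
        calc _ ≤ ENNReal.ofReal (σ ^ (1 - (γ : ℝ))) *
              (ENNReal.ofReal C₁ * 1 * cylAvg F σ z + ENNReal.ofReal C₂ * d * cylAvg F σ z) := by
              refine mul_le_mul_right ((enorm_add_le _ _).trans (add_le_add ?_ ?_)) _
              · exact h.kernel₁.enorm_conv_le hC₁ hσ0 (by simp) hF₁' z
              · exact h.kernel₂.enorm_conv_le hC₂ hσ0 (by simp) hF₂' z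
          _ = _ := by ring
    _ ≤ ∫⁻ σ in Ioo 0 b, (ENNReal.ofReal C₁ + ENNReal.ofReal C₂ * d) *
          (ENNReal.ofReal (σ ^ (1 - (γ : ℝ))) * cylAvg F σ z) :=
        lintegral_mono_set (Ioo_subset_Ioo_left ha.le)
    _ = _ := by
        rw [lintegral_const_mul', potential]
        simp [ENNReal.mul_eq_top]

theorem IsSmoothKernel.enorm_conv_scaleFamily_le (hP : IsSmoothKernel P) (γ : ℕ) {C σ : ℝ}
    (hC : ∀ z, ‖P z‖ ≤ C) (hσ : 0 < σ) {U : SpaceTime d → ℝ≥0∞} (hU : ∀ᵐ w, ‖u w‖ₑ ≤ U w)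
    (z : SpaceTime d) :
    ‖conv u (scaleFamily γ P σ) z‖ₑ ≤
      ENNReal.ofReal C * (ENNReal.ofReal (σ ^ (-(γ : ℝ))) * cylAvg U σ z) := by
  have e : conv u (scaleFamily γ P σ) z = (σ ^ γ)⁻¹ • conv u (scaled P σ) z := by
    rw [scaleFamily_eq]; exact conv_smul_right _ _ _ _
  rw [e, enorm_smul, Real.enorm_of_nonneg (by positivity), Real.rpow_neg hσ.le, Real.rpow_natCast,
    mul_left_comm]
  refine mul_le_mul_right ?_ _
  have := hP.enorm_conv_le hC hσ (c := 1) (by simp) (F := U) (by simpa using hU) z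
  simpa using this

/-! ### Existence of the trace -/

theorem tendsto_potential_zero {γ : ℝ} {F : SpaceTime d → ℝ≥0∞} {δ₀ : ℝ} (hδ₀ : 0 < δ₀)
    {z : SpaceTime d} (h : potential γ F δ₀ z ≠ ⊤) :
    Tendsto (fun δ => potential γ F δ z) (𝓝[>] 0) (𝓝 0) := by
  have h1 : Tendsto (fun δ : ℝ => (volume.restrict (Ioo 0 δ₀)) (Ioo 0 δ)) (𝓝[>] 0) (𝓝 0) := by
    have h2 : Tendsto (fun δ : ℝ => ENNReal.ofReal δ) (𝓝[>] 0) (𝓝 0) := by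
      have := (ENNReal.continuous_ofReal.tendsto 0).mono_left (nhdsWithin_le_nhds (s := Ioi 0))
      simpa using this
    refine tendsto_of_tendsto_of_tendsto_of_le_of_le tendsto_const_nhds h2 (fun _ => zero_le)
      fun δ => ?_
    refine (Measure.restrict_apply_le _ _).trans ?_
    simp
  have h3 := tendsto_setLIntegral_zero h h1
  refine h3.congr' ?_
  have h4 : ∀ᶠ δ : ℝ in 𝓝[>] 0, δ ∈ Ioo 0 δ₀ := Ioo_mem_nhdsGT hδ₀
  filter_upwards [h4] with δ hδ
  rw [Measure.restrict_restrict measurableSet_Ioo,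
    inter_eq_left.2 (Ioo_subset_Ioo_right hδ.2.le), potential]

/-- A family indexed by the scale whose increments are dominated by a potential, finite almost
everywhere, has a limit at time zero as the scale tends to zero. -/
theorem exists_trace {V : Type*} [NormedAddCommGroup V] [CompleteSpace V]
    {W : ℝ → SpaceTime d → V} {γ : ℝ} {F : SpaceTime d → ℝ≥0∞} {A : ℝ≥0∞} (hA : A ≠ ⊤)
    (hW : ∀ σ, 0 < σ → Continuous (W σ))
    (hinc : ∀ a b : ℝ, 0 < a → a ≤ b → b ≤ 1 → ∀ z, ‖W b z - W a z‖ₑ ≤ A * potential γ F b z)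
    {δ₀ : ℝ} (hδ₀ : 0 < δ₀) (hfin : ∀ᵐ x : Space d, potential γ F δ₀ (0, x) ≠ ⊤) :
    ∃ g : Space d → V, AEStronglyMeasurable g volume ∧
      ∀ᵐ x, ∀ δ ∈ Ioc (0 : ℝ) 1, ‖W δ (0, x) - g x‖ₑ ≤ A * potential γ F δ (0, x) := by
  set s : ℕ → ℝ := fun n => 1 / ((n : ℝ) + 1) with hs
  have hs0 : ∀ n, 0 < s n := fun n => by positivity
  have hs1 : ∀ n, s n ≤ 1 := fun n => by
    rw [hs]; simp only; rw [div_le_one (by positivity)]; linarith [n.cast_nonneg (α := ℝ)]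
  have hsanti : Antitone s := fun m n hmn => by
    have : (m : ℝ) ≤ n := by exact_mod_cast hmn
    exact one_div_le_one_div_of_le (by positivity) (by linarith)
  have hslim : Tendsto s atTop (𝓝[>] 0) :=
    tendsto_nhdsWithin_iff.2 ⟨tendsto_one_div_add_atTop_nhds_zero_nat,
      Eventually.of_forall hs0⟩
  have hlim : ∀ᵐ x : Space d, ∃ l, Tendsto (fun n => W (s n) (0, x)) atTop (𝓝 l) := by
    filter_upwards [hfin] with x hx
    have ht : Tendsto (fun n => A * potential γ F (s n) (0, x)) atTop (𝓝 0) := by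
      have := ENNReal.Tendsto.const_mul (a := A)
        ((tendsto_potential_zero hδ₀ hx).comp hslim) (Or.inr hA)
      simpa using this
    refine cauchySeq_tendsto_of_complete (EMetric.cauchySeq_iff'.2 fun ε hε => ?_)
    obtain ⟨N, hN⟩ := (ht.eventually (gt_mem_nhds hε)).exists
    refine ⟨N, fun n hn => lt_of_le_of_lt ?_ hN⟩
    rw [edist_comm, edist_eq_enorm_sub]
    exact hinc _ _ (hs0 n) (hsanti hn) (hs1 N) _
  refine ⟨fun x => limUnder atTop fun n => W (s n) (0, x), ?_, ?_⟩
  · refine aestronglyMeasurable_of_tendsto_ae atTop (f := fun n x => W (s n) (0, x))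
      (fun n => ?_) ?_
    · exact ((hW _ (hs0 n)).comp (by fun_prop)).aestronglyMeasurable
    · filter_upwards [hlim] with x hx using tendsto_nhds_limUnder hx
  · filter_upwards [hlim] with x hx δ hδ
    have h1 := (tendsto_nhds_limUnder hx).const_sub (W δ (0, x))
    refine le_of_tendsto h1.enorm ?_
    have h2 : ∀ᶠ n in atTop, s n ≤ δ := by
      have := hslim.eventually (Ioo_mem_nhdsGT hδ.1)
      exact this.mono fun n hn => hn.2.le
    filter_upwards [h2] with n hn using hinc _ _ (hs0 n) hn hδ.2 _

end

section

variable {d : ℕ}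

/-! ### Averaged `L_r` norms and the Morrey estimate of the trace -/

/-- The normalized norm `(|B|⁻¹ ∫_B h^r)^{1/r}`. -/
noncomputable def avgLr (r : ℝ) (B : Set (Space d)) (h : Space d → ℝ≥0∞) : ℝ≥0∞ :=
  ((volume B)⁻¹ * ∫⁻ y in B, h y ^ r) ^ (1 / r)

theorem avgLr_eq {r : ℝ} (hr : 0 < r) (B : Set (Space d)) (h : Space d → ℝ≥0∞) :
    avgLr r B h = ((volume B)⁻¹) ^ (1 / r) * (∫⁻ y in B, h y ^ r) ^ (1 / r) :=
  ENNReal.mul_rpow_of_nonneg _ _ (by positivity)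

theorem avgLr_mono_ae {r : ℝ} (hr : 0 < r) {B : Set (Space d)} {h h' : Space d → ℝ≥0∞}
    (hh : ∀ᵐ x, h x ≤ h' x) : avgLr r B h ≤ avgLr r B h' := by
  refine ENNReal.rpow_le_rpow (mul_le_mul_right (lintegral_mono_ae ?_) _) (by positivity)
  exact ae_restrict_of_ae (hh.mono fun x hx => ENNReal.rpow_le_rpow hx hr.le)

theorem avgLr_add_le {r : ℝ} (hr : 1 ≤ r) (B : Set (Space d)) {h h' : Space d → ℝ≥0∞}
    (hh : Measurable h) (hh' : Measurable h') :
    avgLr r B (fun x => h x + h' x) ≤ avgLr r B h + avgLr r B h' := by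
  have hr0 : 0 < r := by linarith
  rw [avgLr_eq hr0, avgLr_eq hr0, avgLr_eq hr0, ← mul_add]
  exact mul_le_mul_right (ENNReal.lintegral_Lp_add_le hh.aemeasurable hh'.aemeasurable hr) _

theorem avgLr_const_mul {r : ℝ} (hr : 0 < r) (B : Set (Space d)) {c : ℝ≥0∞} (hc : c ≠ ⊤)
    (h : Space d → ℝ≥0∞) : avgLr r B (fun x => c * h x) = c * avgLr r B h := by
  unfold avgLr
  simp_rw [ENNReal.mul_rpow_of_nonneg _ _ hr.le]
  rw [lintegral_const_mul' _ _ (ENNReal.rpow_ne_top_of_nonneg hr.le hc), mul_left_comm,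
    ENNReal.mul_rpow_of_nonneg _ _ (by positivity), ← ENNReal.rpow_mul,
    mul_one_div_cancel hr.ne', ENNReal.rpow_one]

theorem avgLr_le_of_le {r ρ : ℝ} (hr : 0 < r) (hρ : 0 < ρ) (x : Space d) {h : Space d → ℝ≥0∞}
    {c : ℝ≥0∞} (hc : ∀ x, h x ≤ c) : avgLr r (Metric.ball x ρ) h ≤ c := by
  have h0 : volume (Metric.ball x ρ) ≠ 0 := (Metric.measure_ball_pos _ _ hρ).ne'
  have ht : volume (Metric.ball x ρ) ≠ ⊤ := measure_ball_lt_top.ne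
  calc avgLr r (Metric.ball x ρ) h
      ≤ ((volume (Metric.ball x ρ))⁻¹ * ∫⁻ _ in Metric.ball x ρ, c ^ r) ^ (1 / r) := by
        unfold avgLr
        gcongr
        exact hc _
    _ = c := by
        rw [setLIntegral_const, mul_comm (c ^ r), ← mul_assoc, ENNReal.inv_mul_cancel h0 ht,
          one_mul, ← ENNReal.rpow_mul, mul_one_div_cancel hr.ne', ENNReal.rpow_one]

/-- The constant which bounds the powers `|B_1|^{-1/r}`. -/
noncomputable def invVolConst (d : ℕ) : ℝ≥0∞ := max 1 (unitVol d)⁻¹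

theorem invVolConst_ne_top : invVolConst d ≠ ⊤ := by
  simp [invVolConst, unitVol_ne_zero]

theorem avgLr_ball_le {r ρ : ℝ} (hr : 1 ≤ r) (hρ : 0 < ρ) (x : Space d) (h : Space d → ℝ≥0∞) :
    avgLr r (Metric.ball x ρ) h ≤ invVolConst d * (ENNReal.ofReal (ρ ^ (-(d / r))) *
      (∫⁻ y in Metric.ball x ρ, h y ^ r) ^ (1 / r)) := by
  have hr0 : 0 < r := by linarith
  rw [avgLr_eq hr0, volume_ball_eq hρ, ENNReal.mul_inv (by simp [unitVol_ne_top])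
    (by simp), ENNReal.mul_rpow_of_nonneg _ _ (by positivity),
    ← ENNReal.ofReal_inv_of_pos (by positivity), ENNReal.ofReal_rpow_of_pos (by positivity)]
  have e : ((ρ ^ (d : ℝ))⁻¹) ^ (1 / r) = ρ ^ (-(d / r)) := by
    rw [← Real.rpow_neg hρ.le, ← Real.rpow_mul hρ.le]; congr 1; ring
  rw [e, mul_comm (ENNReal.ofReal _), mul_assoc]
  refine mul_le_mul_left (rpow_le_max_one (by positivity) ?_) _
  rw [div_le_one hr0]; exact hr

/-- The constant of the Morrey estimate for the potential. -/
noncomputable def potConst (d : ℕ) (p q β γ μ : ℝ) : ℝ≥0∞ :=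
  invVolConst d * avgConst d p q * ENNReal.ofReal (1 / (2 - μ)) +
    max 1 (unitVol d) * ENNReal.ofReal (1 / (β + γ - 2))

theorem potConst_ne_top (p q β γ μ : ℝ) : potConst d p q β γ μ ≠ ⊤ := by
  simp [potConst, ENNReal.mul_eq_top, invVolConst_ne_top, avgConst_ne_top, unitVol_ne_top]

/-- Morrey estimate of the potential truncated at the scale `s`. The scales below `min s ρ` are
estimated in `L_r`, where the factor `m^{2-κ} ρ^{κ-ν}`, with `m = min s ρ`, is at most `m^{2-ν}`
because `κ ≤ ν`; the scales above `ρ` are estimated pointwise. The bound `κ ≤ μ < 2` serves only to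
make the constant independent of `r`. -/
theorem MorreyBound.ofReal_mul_avgLr_potential_le {p q r β γ μ ν s ρ : ℝ} (hp : 1 < p)
    (hq : 1 < q) (hr : p ≤ r) {f : SpaceTime d → ℝ≥0∞} {M : ℝ≥0∞} (hf : Measurable f)
    (h : MorreyBound p q β f M) (hβ0 : 0 ≤ β) (hβ : 2 - γ < β)
    (hκ : γ + d / p + 2 / q - d / r ≤ μ) (hμ : μ < 2) (hκν : γ + d / p + 2 / q - d / r ≤ ν)
    (hν : ν ≤ 2) (hs : 0 < s) (hs1 : s ≤ 1) (hρ : 0 < ρ) (hρ1 : ρ ≤ 1 / 2) (x₀ : Space d) :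
    ENNReal.ofReal (ρ ^ (β + γ - ν)) *
      avgLr r (Metric.ball x₀ ρ) (fun x => potential γ f s (0, x)) ≤
      potConst d p q β γ μ * (ENNReal.ofReal (s ^ (2 - ν)) * M) := by
  have hr1 : 1 ≤ r := by linarith
  have hr0 : 0 < r := by linarith
  set κ := γ + d / p + 2 / q - d / r with hκdef
  set m := min s ρ with hm
  have hm0 : 0 < m := lt_min hs hρ
  have hmρ : m ≤ ρ := min_le_right _ _
  have hms : m ≤ s := min_le_left _ _
  have hpot := measurable_potential γ hf
  -- the scales below `min s ρ`
  have small : ENNReal.ofReal (ρ ^ (β + γ - ν)) *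
      avgLr r (Metric.ball x₀ ρ) (fun x => potential γ f m (0, x)) ≤
      invVolConst d * avgConst d p q * ENNReal.ofReal (1 / (2 - μ)) *
        (ENNReal.ofReal (s ^ (2 - ν)) * M) := by
    have h1 := h.potential_Lr_le (r := r) (γ := γ) (t := 0) hp hq hr hβ0 hf
      (by linarith) hm0 hmρ hρ1 x₀
    have e : ρ ^ (β + γ - ν) * ρ ^ (-(d / r)) *
        (m ^ (2 - κ) / (2 - κ) * ρ ^ (d / p + 2 / q - β)) ≤ 1 / (2 - μ) * s ^ (2 - ν) := by
      have e1 : ρ ^ (β + γ - ν) * ρ ^ (-(d / r)) *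
        (m ^ (2 - κ) / (2 - κ) * ρ ^ (d / p + 2 / q - β)) =
          1 / (2 - κ) * (m ^ (2 - κ) * ρ ^ (κ - ν)) := by
        have : ρ ^ (κ - ν) = ρ ^ (β + γ - ν) * ρ ^ (-(d / r)) * ρ ^ (d / p + 2 / q - β) := by
          rw [← Real.rpow_add hρ, ← Real.rpow_add hρ]; congr 1; rw [hκdef]; ring
        rw [this]; ring
      rw [e1]
      have hμ2 : 0 < 2 - μ := by linarith
      have hμκ : 2 - μ ≤ 2 - κ := by linarith
      gcongr
      calc m ^ (2 - κ) * ρ ^ (κ - ν) ≤ m ^ (2 - κ) * m ^ (κ - ν) := by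
            refine mul_le_mul_of_nonneg_left ?_ (by positivity)
            exact Real.rpow_le_rpow_of_nonpos hm0 hmρ (by linarith)
        _ = m ^ (2 - ν) := by rw [← Real.rpow_add hm0]; congr 1; ring
        _ ≤ s ^ (2 - ν) := Real.rpow_le_rpow hm0.le hms (by linarith)
    calc _ ≤ ENNReal.ofReal (ρ ^ (β + γ - ν)) * (invVolConst d * (ENNReal.ofReal (ρ ^ (-(d / r))) *
          (avgConst d p q * (ENNReal.ofReal (m ^ (2 - κ) / (2 - κ) *
            ρ ^ (d / p + 2 / q - β)) * M)))) := by
          refine mul_le_mul_right ((avgLr_ball_le hr1 hρ _ _).trans ?_) _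
          exact mul_le_mul_right (mul_le_mul_right h1 _) _
      _ = invVolConst d * avgConst d p q * (ENNReal.ofReal (ρ ^ (β + γ - ν) * ρ ^ (-(d / r)) *
            (m ^ (2 - κ) / (2 - κ) * ρ ^ (d / p + 2 / q - β))) * M) := by
          rw [ENNReal.ofReal_mul (p := ρ ^ (β + γ - ν) * ρ ^ (-(d / r))) (by positivity),
            ENNReal.ofReal_mul (p := ρ ^ (β + γ - ν)) (by positivity)]
          ring
      _ ≤ invVolConst d * avgConst d p q *
            (ENNReal.ofReal (1 / (2 - μ) * s ^ (2 - ν)) * M) := by gcongr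
      _ = _ := by
          have : 0 < 2 - μ := by linarith
          rw [ENNReal.ofReal_mul (by positivity)]; ring
  rcases le_or_gt s ρ with hsρ | hsρ
  · rw [show m = s from min_eq_left hsρ] at small
    refine small.trans ?_
    rw [potConst, add_mul]
    exact le_self_add
  · set c := max 1 (unitVol d) * (ENNReal.ofReal (ρ ^ (2 - γ - β) / (β + γ - 2)) * M) with hc
    have h2 : ∀ x : Space d, potential γ f s (0, x) ≤ potential γ f m (0, x) + c := fun x =>
      h.potential_le_add hp hq hf hβ hρ hs1 (0, x)
    have h3 : avgLr r (Metric.ball x₀ ρ) (fun x => potential γ f s (0, x)) ≤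
        avgLr r (Metric.ball x₀ ρ) (fun x => potential γ f m (0, x)) + c := by
      refine (avgLr_mono_ae hr0 (Eventually.of_forall h2)).trans
        ((avgLr_add_le hr1 _ ((hpot m).comp measurable_prodMk_left) measurable_const).trans ?_)
      exact add_le_add le_rfl (avgLr_le_of_le hr0 hρ _ fun _ => le_rfl)
    have h4 : ENNReal.ofReal (ρ ^ (β + γ - ν)) * c ≤
        max 1 (unitVol d) * ENNReal.ofReal (1 / (β + γ - 2)) *
          (ENNReal.ofReal (s ^ (2 - ν)) * M) := by
      have hb : 0 < β + γ - 2 := by linarith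
      have e : ρ ^ (β + γ - ν) * (ρ ^ (2 - γ - β) / (β + γ - 2)) ≤
          1 / (β + γ - 2) * s ^ (2 - ν) := by
        have e1 : ρ ^ (β + γ - ν) * (ρ ^ (2 - γ - β) / (β + γ - 2)) =
            1 / (β + γ - 2) * ρ ^ (2 - ν) := by
          have : ρ ^ (2 - ν) = ρ ^ (β + γ - ν) * ρ ^ (2 - γ - β) := by
            rw [← Real.rpow_add hρ]; congr 1; ring
          rw [this]; ring
        rw [e1]
        gcongr
      calc _ = max 1 (unitVol d) * (ENNReal.ofReal (ρ ^ (β + γ - ν) *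
            (ρ ^ (2 - γ - β) / (β + γ - 2))) * M) := by
            rw [ENNReal.ofReal_mul (by positivity)]; ring
        _ ≤ max 1 (unitVol d) * (ENNReal.ofReal (1 / (β + γ - 2) * s ^ (2 - ν)) * M) := by gcongr
        _ = _ := by rw [ENNReal.ofReal_mul (by positivity)]; ring
    calc _ ≤ ENNReal.ofReal (ρ ^ (β + γ - ν)) *
          (avgLr r (Metric.ball x₀ ρ) (fun x => potential γ f m (0, x)) + c) := by gcongr
      _ ≤ _ := by
          rw [mul_add, potConst, add_mul]
          exact add_le_add small h4

/-- Morrey estimate of the cylinder averages at the scale `s`, in `L_r` if `s ≤ ρ` and pointwise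
if `ρ < s`. -/
theorem MorreyBound.ofReal_mul_avgLr_cylAvg_le {p q r β γ ν s ρ : ℝ} (hp : 1 < p)
    (hq : 1 < q) (hr : p ≤ r) {f : SpaceTime d → ℝ≥0∞} {M : ℝ≥0∞} (hf : Measurable f)
    (h : MorreyBound p q β f M) (hβ0 : 0 ≤ β) (hβ : 2 - γ < β)
    (hκν : γ + d / p + 2 / q - d / r ≤ ν)
    (hν : ν ≤ 2) (hs : 0 < s) (hs1 : s ≤ 1) (hρ : 0 < ρ) (hρ1 : ρ ≤ 1 / 2) (x₀ : Space d) :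
    ENNReal.ofReal (ρ ^ (β + γ - ν)) * (ENNReal.ofReal (s ^ (-γ)) *
      avgLr r (Metric.ball x₀ ρ) (fun x => cylAvg f s (0, x))) ≤
      (invVolConst d * avgConst d p q + max 1 (unitVol d)) *
        (ENNReal.ofReal (s ^ (-ν)) * M) := by
  have hr1 : 1 ≤ r := by linarith
  have hr0 : 0 < r := by linarith
  rw [add_mul]
  rcases le_or_gt s ρ with hsρ | hsρ
  · refine le_trans ?_ le_self_add
    have h1 := h.cylAvg_Lr_le (t := 0) hp hq hr hβ0 hf hs hsρ hρ1 x₀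
    set κ := γ + d / p + 2 / q - d / r with hκdef
    have e : ρ ^ (β + γ - ν) * s ^ (-γ) * ρ ^ (-(d / r)) *
        (s ^ (d / r - d / p - 2 / q) * ρ ^ (d / p + 2 / q - β)) ≤ s ^ (-ν) := by
      calc _ = s ^ (-κ) * ρ ^ (κ - ν) := by
            have e1 : ρ ^ (κ - ν) = ρ ^ (β + γ - ν) * ρ ^ (-(d / r)) * ρ ^ (d / p + 2 / q - β) := by
              rw [← Real.rpow_add hρ, ← Real.rpow_add hρ]; congr 1; rw [hκdef]; ring
            have e2 : s ^ (-κ) = s ^ (-γ) * s ^ (d / r - d / p - 2 / q) := by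
              rw [← Real.rpow_add hs]; congr 1; rw [hκdef]; ring
            rw [e1, e2]; ring
        _ ≤ s ^ (-κ) * s ^ (κ - ν) := by
            refine mul_le_mul_of_nonneg_left ?_ (by positivity)
            exact Real.rpow_le_rpow_of_nonpos hs hsρ (by linarith)
        _ = s ^ (-ν) := by rw [← Real.rpow_add hs]; congr 1; ring
    calc _ ≤ ENNReal.ofReal (ρ ^ (β + γ - ν)) * (ENNReal.ofReal (s ^ (-γ)) *
          (invVolConst d * (ENNReal.ofReal (ρ ^ (-(d / r))) * (avgConst d p q *
          (ENNReal.ofReal (s ^ (d / r - d / p - 2 / q) * ρ ^ (d / p + 2 / q - β)) * M))))) := by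
          refine mul_le_mul_right (mul_le_mul_right ((avgLr_ball_le hr1 hρ _ _).trans ?_) _) _
          exact mul_le_mul_right (mul_le_mul_right h1 _) _
      _ = invVolConst d * avgConst d p q * (ENNReal.ofReal (ρ ^ (β + γ - ν) * s ^ (-γ) *
            ρ ^ (-(d / r)) * (s ^ (d / r - d / p - 2 / q) * ρ ^ (d / p + 2 / q - β))) * M) := by
          rw [ENNReal.ofReal_mul (p := ρ ^ (β + γ - ν) * s ^ (-γ) * ρ ^ (-(d / r)))
            (by positivity), ENNReal.ofReal_mul (p := ρ ^ (β + γ - ν) * s ^ (-γ)) (by positivity),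
            ENNReal.ofReal_mul (p := ρ ^ (β + γ - ν)) (by positivity)]
          ring
      _ ≤ _ := by gcongr
  · refine le_trans ?_ le_add_self
    have h1 : avgLr r (Metric.ball x₀ ρ) (fun x => cylAvg f s (0, x)) ≤
        max 1 (unitVol d) * (ENNReal.ofReal (s ^ (-β)) * M) :=
      avgLr_le_of_le hr0 hρ _ fun x => h.cylAvg_le hp hq hf ⟨hs, hs1⟩ (0, x)
    have e : ρ ^ (β + γ - ν) * s ^ (-γ) * s ^ (-β) ≤ s ^ (-ν) := by
      calc ρ ^ (β + γ - ν) * s ^ (-γ) * s ^ (-β) ≤ s ^ (β + γ - ν) * s ^ (-γ) * s ^ (-β) := by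
            gcongr
            linarith
        _ = s ^ (-ν) := by rw [← Real.rpow_add hs, ← Real.rpow_add hs]; congr 1; ring
    calc _ ≤ ENNReal.ofReal (ρ ^ (β + γ - ν)) * (ENNReal.ofReal (s ^ (-γ)) *
          (max 1 (unitVol d) * (ENNReal.ofReal (s ^ (-β)) * M))) := by gcongr
      _ = max 1 (unitVol d) *
          (ENNReal.ofReal (ρ ^ (β + γ - ν) * s ^ (-γ) * s ^ (-β)) * M) := by
          rw [ENNReal.ofReal_mul (by positivity), ENNReal.ofReal_mul (by positivity)]
          ring
      _ ≤ _ := by gcongr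

theorem MorreyBound.ae_potential_ne_top {p q r β γ : ℝ} (hp : 1 < p) (hq : 1 < q) (hr : p ≤ r)
    (hβ : 0 ≤ β) {f : SpaceTime d → ℝ≥0∞} {M : ℝ≥0∞} (hf : Measurable f)
    (h : MorreyBound p q β f M) (hM : M ≠ ⊤) (hκ : γ + d / p + 2 / q - d / r < 2) (t : ℝ) :
    ∀ᵐ x : Space d, potential γ f (1 / 2) (t, x) ≠ ⊤ := by
  have hr0 : 0 < r := by linarith
  rw [ae_iff]
  refine measure_null_of_locally_null _ fun x₀ _ => ?_
  refine ⟨_, inter_mem_nhdsWithin _ (Metric.ball_mem_nhds x₀ (show (0 : ℝ) < 1 / 2 by norm_num)),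
    ?_⟩
  have h1 := h.potential_Lr_le (r := r) (γ := γ) (t := t) hp hq hr hβ hf hκ
    (show (0 : ℝ) < 1 / 2 by norm_num) le_rfl le_rfl x₀
  have h2 : ∫⁻ x in Metric.ball x₀ (1 / 2), potential γ f (1 / 2) (t, x) ^ r ≠ ⊤ := by
    intro htop
    rw [htop, ENNReal.top_rpow_of_pos (by positivity)] at h1
    refine (lt_of_le_of_lt h1 ?_).ne rfl
    exact ENNReal.mul_lt_top (avgConst_ne_top p q).lt_top
      (ENNReal.mul_lt_top ENNReal.ofReal_lt_top hM.lt_top)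
  have hm : Measurable fun x : Space d => potential γ f (1 / 2) (t, x) ^ r :=
    ((measurable_potential γ hf _).comp measurable_prodMk_left).pow_const r
  have h3 := ae_lt_top hm h2
  rw [ae_restrict_iff' Metric.isOpen_ball.measurableSet, ae_iff] at h3
  refine measure_mono_null (fun x hx => ?_) h3
  intro hc
  have h4 := hc hx.2
  have h5 : ¬ potential γ f (1 / 2) (t, x) ≠ ⊤ := hx.1
  rw [not_not] at h5
  rw [h5, ENNReal.top_rpow_of_pos hr0] at h4
  exact h4.ne rfl

theorem setLIntegral_biUnion_finset_le {α ι : Type*} [MeasurableSpace α] {m : Measure α}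
    (T : Finset ι) (s : ι → Set α) (f : α → ℝ≥0∞) :
    ∫⁻ x in ⋃ i ∈ T, s i, f x ∂m ≤ ∑ i ∈ T, ∫⁻ x in s i, f x ∂m := by
  classical
  induction T using Finset.induction_on with
  | empty => simp
  | insert i T hi ih =>
    rw [Finset.set_biUnion_insert, Finset.sum_insert hi]
    exact (lintegral_union_le _ _ _).trans (add_le_add le_rfl ih)

/-- The number of balls of half the radius which cover a ball depends on the dimension only. -/
theorem exists_finite_cover_ball (d : ℕ) : ∃ T : Finset (Space d), ∀ (ρ : ℝ) (_ : 0 < ρ)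
    (x : Space d), Metric.ball x ρ ⊆ ⋃ c ∈ T, Metric.ball (x + ρ • c) (ρ / 2) := by
  obtain ⟨T, hT⟩ := (isCompact_closedBall (0 : Space d) 1).elim_finite_subcover
    (fun c : Space d => Metric.ball c (1 / 2)) (fun _ => Metric.isOpen_ball)
    (fun c _ => mem_iUnion.2 ⟨c, Metric.mem_ball_self (by norm_num)⟩)
  refine ⟨T, fun ρ hρ x y hy => ?_⟩
  have h1 : ρ⁻¹ • (y - x) ∈ Metric.closedBall (0 : Space d) 1 := by
    rw [mem_closedBall_zero_iff, norm_smul, Real.norm_of_nonneg (by positivity),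
      inv_mul_le_iff₀ hρ, ← dist_eq_norm]
    simpa using (Metric.mem_ball.1 hy).le
  obtain ⟨c, hc, hyc⟩ := mem_iUnion₂.1 (hT h1)
  refine mem_iUnion₂.2 ⟨c, hc, ?_⟩
  rw [Metric.mem_ball, dist_eq_norm] at hyc ⊢
  have e : y - (x + ρ • c) = ρ • (ρ⁻¹ • (y - x) - c) := by
    rw [smul_sub, smul_smul, mul_inv_cancel₀ hρ.ne', one_smul]; abel
  rw [e, norm_smul, Real.norm_of_nonneg hρ.le]
  nlinarith

/-- It suffices to bound the Morrey norm on the balls of radius at most `1/2`. -/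
theorem exists_spaceMorreyNorm_le (d : ℕ) : ∃ n : ℕ, ∀ {F : Type} [NormedAddCommGroup F]
    {r b : ℝ} (_ : 1 ≤ r) (g : Space d → F) (X : ℝ≥0∞),
    (∀ ρ ∈ Ioc (0 : ℝ) (1 / 2), ∀ x, ENNReal.ofReal (ρ ^ b) *
      avgLr r (Metric.ball x ρ) (fun y => ‖g y‖ₑ) ≤ X) →
    spaceMorreyNorm r b g ≤ n * ENNReal.ofReal (2 ^ b) * X := by
  obtain ⟨T, hT⟩ := exists_finite_cover_ball d
  refine ⟨max 1 T.card, fun {F _ r b} hr g X hX => ?_⟩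
  have hr0 : 0 < r := by linarith
  refine iSup₂_le fun ρ hρ => iSup_le fun x => ?_
  have hρ0 := hρ.1
  have hρ2 : 0 < ρ / 2 := by positivity
  set Y := ENNReal.ofReal ((ρ / 2) ^ (-b)) * X with hY
  set V := volume (Metric.ball x ρ) with hV
  have hV0 : V ≠ 0 := (Metric.measure_ball_pos _ _ hρ0).ne'
  have hVt : V ≠ ⊤ := measure_ball_lt_top.ne
  have h1 : ∀ c : Space d, ∫⁻ y in Metric.ball (x + ρ • c) (ρ / 2), ‖g y‖ₑ ^ r ≤ V * Y ^ r := by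
    intro c
    have h2 := hX (ρ / 2) ⟨hρ2, by linarith [hρ.2]⟩ (x + ρ • c)
    set V' := volume (Metric.ball (x + ρ • c) (ρ / 2)) with hV'
    have hV0' : V' ≠ 0 := (Metric.measure_ball_pos _ _ hρ2).ne'
    have hVt' : V' ≠ ⊤ := measure_ball_lt_top.ne
    have hVV : V' ≤ V := by
      rw [hV', hV, volume_ball_eq hρ2, volume_ball_eq hρ0]
      gcongr
      linarith
    have h3 : avgLr r (Metric.ball (x + ρ • c) (ρ / 2)) (fun y => ‖g y‖ₑ) ≤ Y := by
      calc _ = ENNReal.ofReal ((ρ / 2) ^ (-b)) * (ENNReal.ofReal ((ρ / 2) ^ b) *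
            avgLr r (Metric.ball (x + ρ • c) (ρ / 2)) (fun y => ‖g y‖ₑ)) := by
            rw [← mul_assoc, ← ENNReal.ofReal_mul (by positivity), ← Real.rpow_add hρ2]
            simp
        _ ≤ Y := mul_le_mul_right h2 _
    have h4 := ENNReal.rpow_le_rpow h3 hr0.le
    rw [avgLr, ← ENNReal.rpow_mul, one_div_mul_cancel hr0.ne', ENNReal.rpow_one] at h4
    calc _ = V' * (V'⁻¹ * ∫⁻ y in Metric.ball (x + ρ • c) (ρ / 2), ‖g y‖ₑ ^ r) := by
          rw [← mul_assoc, ENNReal.mul_inv_cancel hV0' hVt', one_mul]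
      _ ≤ V * Y ^ r := mul_le_mul' hVV h4
  have h5 : ∫⁻ y in Metric.ball x ρ, ‖g y‖ₑ ^ r ≤ T.card * (V * Y ^ r) := by
    calc _ ≤ ∫⁻ y in ⋃ c ∈ T, Metric.ball (x + ρ • c) (ρ / 2), ‖g y‖ₑ ^ r :=
          lintegral_mono_set (hT ρ hρ0 x)
      _ ≤ ∑ c ∈ T, ∫⁻ y in Metric.ball (x + ρ • c) (ρ / 2), ‖g y‖ₑ ^ r :=
          setLIntegral_biUnion_finset_le _ _ _
      _ ≤ ∑ _c ∈ T, V * Y ^ r := Finset.sum_le_sum fun c _ => h1 c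
      _ = _ := by simp
  have h6 : (V⁻¹ * ∫⁻ y in Metric.ball x ρ, ‖g y‖ₑ ^ r) ^ (1 / r) ≤
      (max 1 T.card : ℕ) * Y := by
    calc _ ≤ (V⁻¹ * (T.card * (V * Y ^ r))) ^ (1 / r) := by gcongr
      _ = (T.card : ℝ≥0∞) ^ (1 / r) * Y := by
          have : V⁻¹ * (T.card * (V * Y ^ r)) = T.card * Y ^ r := by
            rw [mul_left_comm, ← mul_assoc V⁻¹, ENNReal.inv_mul_cancel hV0 hVt, one_mul]
          rw [this, ENNReal.mul_rpow_of_nonneg _ _ (by positivity), ← ENNReal.rpow_mul,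
            mul_one_div_cancel hr0.ne', ENNReal.rpow_one]
      _ ≤ _ := by
          refine mul_le_mul_left ((rpow_le_max_one (by positivity) ?_).trans ?_) _
          · rw [div_le_one hr0]; exact hr
          · exact max_le (by exact_mod_cast le_max_left 1 T.card)
              (by exact_mod_cast le_max_right 1 T.card)
  calc _ ≤ ENNReal.ofReal (ρ ^ b) * ((max 1 T.card : ℕ) * Y) := by gcongr
    _ = (max 1 T.card : ℕ) * (ENNReal.ofReal (ρ ^ b * (ρ / 2) ^ (-b)) * X) := by
        rw [ENNReal.ofReal_mul (by positivity), hY]; ring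
    _ = _ := by
        have : ρ ^ b * (ρ / 2) ^ (-b) = 2 ^ b := by
          rw [Real.rpow_neg hρ2.le, Real.div_rpow hρ0.le (by norm_num)]
          have := (Real.rpow_pos_of_pos hρ0 b).ne'
          field_simp
        rw [this]; ring

end

section

variable {d : ℕ} {E : Type*} [NormedAddCommGroup E] [NormedSpace ℝ E]

/-! ### Mollification -/

theorem integral_scaled {ζ : SpaceTime d → ℝ} (hζ : Continuous ζ) (hc : HasCompactSupport ζ)
    {σ : ℝ} (hσ : 0 < σ) : ∫ z, scaled ζ σ z = ∫ z, ζ z := by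
  have hcont : Continuous (scaled ζ σ) :=
    Continuous.const_smul (hζ.comp (dil d σ).continuous) ((σ ^ (d + 2))⁻¹)
  have i1 : Integrable (scaled ζ σ) (volume.prod volume) :=
    hcont.integrable_of_hasCompactSupport (hasCompactSupport_scaled hc hσ)
  have i2 : Integrable ζ (volume.prod volume) := hζ.integrable_of_hasCompactSupport hc
  rw [Measure.volume_eq_prod, integral_prod _ i1, integral_prod _ i2]
  have e1 : ∀ t : ℝ, ∫ x : Space d, scaled ζ σ (t, x) =
      (σ ^ 2)⁻¹ * ∫ x : Space d, ζ ((σ ^ 2)⁻¹ * t, x) := by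
    intro t
    have := Measure.integral_comp_smul (volume : Measure (Space d))
      (fun x => ζ ((σ ^ 2)⁻¹ * t, x)) σ⁻¹
    simp only [scaled, dil_apply, smul_eq_mul]
    rw [integral_const_mul, this, finrank_euclideanSpace, Fintype.card_fin, smul_eq_mul,
      abs_of_nonneg (by positivity), ← mul_assoc]
    congr 1
    rw [inv_pow, inv_inv, pow_add, mul_inv]
    field_simp
  simp_rw [e1]
  rw [integral_const_mul, Measure.integral_comp_mul_left
    (fun t : ℝ => ∫ x : Space d, ζ (t, x)), abs_of_nonneg (by positivity), smul_eq_mul,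
    ← mul_assoc]
  rw [inv_inv, inv_mul_cancel₀ (by positivity), one_mul]

theorem IsMollifier.scaled_nonneg {ζ : SpaceTime d → ℝ} (hζ : IsMollifier ζ) {ε : ℝ} (hε : 0 < ε)
    (z : SpaceTime d) : 0 ≤ scaled ζ ε z :=
  mul_nonneg (by positivity) (hζ.nonneg _)

theorem IsMollifier.integral_scaled {ζ : SpaceTime d → ℝ} (hζ : IsMollifier ζ) {ε : ℝ}
    (hε : 0 < ε) : ∫ z, scaled ζ ε z = 1 := by
  rw [ParabolicMorrey.integral_scaled hζ.smooth.continuous hζ.compact hε, hζ.integral_eq_one]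

theorem IsMollifier.lintegral_scaled {ζ : SpaceTime d → ℝ} (hζ : IsMollifier ζ) {ε : ℝ}
    (hε : 0 < ε) : ∫⁻ z, ENNReal.ofReal (scaled ζ ε z) = 1 := by
  rw [← ofReal_integral_eq_lintegral_ofReal, hζ.integral_scaled hε, ENNReal.ofReal_one]
  · exact (contDiff_scaled hζ.smooth ε).continuous.integrable_of_hasCompactSupport
      (hasCompactSupport_scaled hζ.compact hε)
  · exact Eventually.of_forall fun z => hζ.scaled_nonneg hε z

theorem exists_support_scaled_subset {ζ : SpaceTime d → ℝ} (hc : HasCompactSupport ζ) :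
    ∃ R : ℝ, 0 < R ∧ ∀ ε ∈ Ioc (0 : ℝ) 1,
      Function.support (scaled ζ ε) ⊆ Metric.ball 0 (R * ε) := by
  obtain ⟨R, hR⟩ := hc.isCompact.isBounded.subset_closedBall 0
  refine ⟨max R 0 + 1, by positivity, fun ε hε z hz => ?_⟩
  have hε0 := hε.1
  have h1 : ζ (dil d ε z) ≠ 0 := fun h' => hz (by simp [scaled, h'])
  have h2 := hR (subset_tsupport _ h1)
  rw [mem_closedBall_zero_iff, dil_apply, Prod.norm_mk, max_le_iff, norm_mul, norm_smul,
    Real.norm_of_nonneg (by positivity : (0 : ℝ) ≤ (ε ^ 2)⁻¹),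
    Real.norm_of_nonneg (by positivity : (0 : ℝ) ≤ ε⁻¹), inv_mul_le_iff₀ (by positivity),
    inv_mul_le_iff₀ hε0] at h2
  have hM : R ≤ max R 0 := le_max_left _ _
  have hM0 : 0 ≤ max R 0 := le_max_right _ _
  have hε2 : ε ^ 2 ≤ ε := by nlinarith [hε.2]
  rw [mem_ball_zero_iff, Prod.norm_def, max_lt_iff]
  constructor
  · calc ‖z.1‖ ≤ ε ^ 2 * R := h2.1
      _ ≤ ε ^ 2 * max R 0 := by gcongr
      _ ≤ ε * max R 0 := by gcongr
      _ < _ := by nlinarith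
  · calc ‖z.2‖ ≤ ε * R := h2.2
      _ ≤ ε * max R 0 := by gcongr
      _ < _ := by nlinarith

/-- Mollifications of a continuous function converge uniformly on compact sets. -/
theorem IsMollifier.eventually_dist_conv_le [CompleteSpace E] {ζ : SpaceTime d → ℝ}
    (hζ : IsMollifier ζ)
    {W : SpaceTime d → E} (hW : Continuous W) {K : Set (SpaceTime d)} (hK : IsCompact K) {η : ℝ}
    (hη : 0 < η) : ∀ᶠ ε in 𝓝[>] (0 : ℝ), ∀ z ∈ K, dist (conv (scaled ζ ε) W z) (W z) ≤ η := by
  obtain ⟨R, hR, hsupp⟩ := exists_support_scaled_subset hζ.compact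
  have hK' : IsCompact (Metric.cthickening 1 K) := hK.cthickening
  obtain ⟨δ, hδ, hun⟩ := Metric.uniformContinuousOn_iff.1
    (hK'.uniformContinuousOn_of_continuous hW.continuousOn) η hη
  have hev : ∀ᶠ ε : ℝ in 𝓝[>] 0, ε ∈ Ioo 0 (min 1 (min δ 1 / R)) :=
    Ioo_mem_nhdsGT (by positivity)
  filter_upwards [hev] with ε hε z hz
  have h1 : ε ≤ 1 := hε.2.le.trans (min_le_left _ _)
  have h2 : R * ε < min δ 1 := by
    have := hε.2.trans_le (min_le_right _ _)
    rwa [lt_div_iff₀ hR, mul_comm] at this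
  refine dist_convolution_le hη.le (hsupp ε ⟨hε.1, h1⟩) (fun x => hζ.scaled_nonneg hε.1 x)
    (hζ.integral_scaled hε.1) hW.aestronglyMeasurable fun x hx => ?_
  have hx' : dist x z < min δ 1 := (Metric.mem_ball.1 hx).trans h2
  refine (hun x ?_ z (Metric.self_subset_cthickening K hz)
    (hx'.trans_le (min_le_left _ _))).le
  exact Metric.mem_cthickening_of_dist_le x z 1 K hz (hx'.le.trans (min_le_right _ _))

theorem IsMollifier.tendsto_conv [CompleteSpace E] {ζ : SpaceTime d → ℝ} (hζ : IsMollifier ζ)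
    {W : SpaceTime d → E} (hW : Continuous W) (z : SpaceTime d) :
    Tendsto (fun ε => conv (scaled ζ ε) W z) (𝓝[>] 0) (𝓝 (W z)) := by
  rw [Metric.tendsto_nhds]
  intro η hη
  filter_upwards [hζ.eventually_dist_conv_le hW (isCompact_singleton (x := z)) (half_pos hη)]
    with ε hε
  linarith [hε z rfl]

/-! ### Convergence to the trace -/

/-- Averaging over translations does not increase an `L_r` bound which is uniform over
translations. -/
theorem Lr_average_le {r ρ : ℝ} (hr : 1 < r) {k : SpaceTime d → ℝ≥0∞} (hk : Measurable k)
    (hk1 : ∫⁻ y, k y = 1) {h : SpaceTime d → ℝ≥0∞} (hh : Measurable h) {D : ℝ≥0∞}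
    (hD : ∀ t x₀, (∫⁻ x in Metric.ball x₀ ρ, h (t, x) ^ r) ^ (1 / r) ≤ D) (t : ℝ)
    (x₀ : Space d) :
    (∫⁻ x in Metric.ball x₀ ρ, (∫⁻ y, k y * h ((t, x) - y)) ^ r) ^ (1 / r) ≤ D := by
  have hr0 : 0 < r := by linarith
  have := isFiniteMeasure_restrict_ball x₀ ρ
  have hm : Measurable (Function.uncurry fun (x : Space d) (y : SpaceTime d) =>
      k y * h ((t, x) - y)) :=
    (hk.comp measurable_snd).mul (hh.comp (by fun_prop))
  refine (lintegral_minkowski (μ := volume.restrict (Metric.ball x₀ ρ)) (ν := volume) hr hm).trans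
    ?_
  calc ∫⁻ y, (∫⁻ x in Metric.ball x₀ ρ, (k y * h ((t, x) - y)) ^ r) ^ (1 / r)
      ≤ ∫⁻ y, k y * D := by
        refine lintegral_mono fun y => ?_
        simp_rw [ENNReal.mul_rpow_of_nonneg _ _ hr0.le]
        have hhy : Measurable fun x : Space d => h ((t, x) - y) := hh.comp (by fun_prop)
        rw [lintegral_const_mul _ (hhy.pow_const r),
          ENNReal.mul_rpow_of_nonneg _ _ (by positivity), ← ENNReal.rpow_mul,
          mul_one_div_cancel hr0.ne', ENNReal.rpow_one]
        refine mul_le_mul_right ?_ _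
        have hpre : (fun x : Space d => x - y.2) ⁻¹' Metric.ball (x₀ - y.2) ρ =
            Metric.ball x₀ ρ := by
          ext x; simp [Metric.mem_ball, dist_eq_norm]
        have e := (measurePreserving_sub_right (volume : Measure (Space d))
          y.2).setLIntegral_comp_preimage (s := Metric.ball (x₀ - y.2) ρ)
          Metric.isOpen_ball.measurableSet (f := fun x => h (t - y.1, x) ^ r)
          ((hh.comp measurable_prodMk_left).pow_const r)
        rw [hpre] at e
        have e' : ∫⁻ x in Metric.ball x₀ ρ, h ((t, x) - y) ^ r =
            ∫⁻ x in Metric.ball (x₀ - y.2) ρ, h (t - y.1, x) ^ r := e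
        rw [e']
        exact hD _ _
    _ = D := by rw [lintegral_mul_const _ hk, hk1, one_mul]

theorem enorm_conv_sub_conv_le {ζ : SpaceTime d → ℝ} (hζ : Continuous ζ)
    (hc : HasCompactSupport ζ) (hζ0 : ∀ z, 0 ≤ ζ z) {W W' : SpaceTime d → E} (hW : Continuous W)
    (hW' : Continuous W') {H : SpaceTime d → ℝ≥0∞} (hH : ∀ z, ‖W z - W' z‖ₑ ≤ H z)
    (z : SpaceTime d) :
    ‖conv ζ W z - conv ζ W' z‖ₑ ≤ ∫⁻ y, ENNReal.ofReal (ζ y) * H (z - y) := by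
  have hi : ∀ {W : SpaceTime d → E}, Continuous W → Integrable fun y => ζ y • W (z - y) :=
    fun hW => (hζ.smul (hW.comp (by fun_prop))).integrable_of_hasCompactSupport
      (hc.smul_right (f' := fun y => _))
  rw [conv_apply, conv_apply, ← integral_sub (hi hW) (hi hW')]
  refine (enorm_integral_le_lintegral_enorm _).trans (lintegral_mono fun y => ?_)
  rw [← smul_sub, enorm_smul, Real.enorm_of_nonneg (hζ0 y)]
  exact mul_le_mul_right (hH _) _

/-- If the mollifications of `W σ` with `ζ_ε` converge to `V ε` at time zero as `σ ↓ 0`, then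
`V ε` converges in `L_r` on small balls to the trace `g` of the family `W`. For a small fixed scale
`δ`, the differences of `V ε` from `ζ_ε * W δ`, and of `W δ` from `g`, are at most (averages of) the
potential truncated at `δ`, which is small in `L_r` uniformly in the ball; the difference of
`ζ_ε * W δ` from `W δ` tends to zero uniformly because `W δ` is continuous. -/
theorem MorreyBound.tendsto_Lr_trace [CompleteSpace E] {p q r β γ : ℝ} (hp : 1 < p) (hq : 1 < q)
    (hr : p ≤ r) (hβ : 0 ≤ β) {F : SpaceTime d → ℝ≥0∞} {M : ℝ≥0∞} (hF : Measurable F)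
    (h : MorreyBound p q β F M) (hM : M ≠ ⊤) (hκ : γ + d / p + 2 / q - d / r < 2)
    {W : ℝ → SpaceTime d → E} {A : ℝ≥0∞} (hA : A ≠ ⊤) (hW : ∀ σ, 0 < σ → Continuous (W σ))
    (hinc : ∀ a b : ℝ, 0 < a → a ≤ b → b ≤ 1 → ∀ z, ‖W b z - W a z‖ₑ ≤ A * potential γ F b z)
    {g : Space d → E}
    (hg : ∀ᵐ x, ∀ δ ∈ Ioc (0 : ℝ) 1, ‖W δ (0, x) - g x‖ₑ ≤ A * potential γ F δ (0, x))
    {ζ : SpaceTime d → ℝ} (hζ : IsMollifier ζ) {V : ℝ → Space d → E}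
    (hV : ∀ ε, 0 < ε → ∀ x,
      Tendsto (fun σ => conv (scaled ζ ε) (W σ) (0, x)) (𝓝[>] 0) (𝓝 (V ε x)))
    {ρ : ℝ} (hρ : 0 < ρ) (hρ1 : ρ ≤ 1 / 2) (x₀ : Space d) :
    Tendsto (fun ε => (∫⁻ x in Metric.ball x₀ ρ, ‖V ε x - g x‖ₑ ^ r) ^ (1 / r)) (𝓝[>] 0)
      (𝓝 0) := by
  have hr1 : 1 < r := by linarith
  have hr0 : 0 < r := by linarith
  set κ := γ + d / p + 2 / q - d / r with hκdef
  set D : ℝ → ℝ≥0∞ := fun δ => avgConst d p q * (ENNReal.ofReal (δ ^ (2 - κ) / (2 - κ) *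
    ρ ^ (d / p + 2 / q - β)) * M) with hD
  have hDlim : Tendsto (fun δ => A * D δ) (𝓝[>] 0) (𝓝 0) := by
    have h1 : Tendsto (fun δ : ℝ => δ ^ (2 - κ) / (2 - κ) * ρ ^ (d / p + 2 / q - β)) (𝓝[>] 0)
        (𝓝 0) := by
      have h2 : Tendsto (fun δ : ℝ => δ ^ (2 - κ)) (𝓝[>] 0) (𝓝 0) := by
        have := (Real.continuousAt_rpow_const 0 (2 - κ) (Or.inr (by linarith))).tendsto
        rw [Real.zero_rpow (by linarith)] at this
        exact this.mono_left nhdsWithin_le_nhds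
      simpa using (h2.div_const (2 - κ)).mul_const (ρ ^ (d / p + 2 / q - β))
    have h3 := (ENNReal.continuous_ofReal.tendsto 0).comp h1
    rw [ENNReal.ofReal_zero] at h3
    have h4 := ENNReal.Tendsto.mul_const (b := M) h3 (Or.inr hM)
    rw [zero_mul] at h4
    have h5 := ENNReal.Tendsto.const_mul (a := avgConst d p q) h4 (Or.inr (avgConst_ne_top p q))
    rw [mul_zero] at h5
    have h6 := ENNReal.Tendsto.const_mul (a := A) h5 (Or.inr hA)
    rwa [mul_zero] at h6
  set v := volume (Metric.ball x₀ ρ) ^ (1 / r) with hv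
  have hvt : v ≠ ⊤ := ENNReal.rpow_ne_top_of_nonneg (by positivity) measure_ball_lt_top.ne
  have hηlim : Tendsto (fun η : ℝ => ENNReal.ofReal η * v) (𝓝[>] 0) (𝓝 0) := by
    have h1 := (ENNReal.continuous_ofReal.tendsto 0).mono_left (nhdsWithin_le_nhds (s := Ioi 0))
    rw [ENNReal.ofReal_zero] at h1
    have := ENNReal.Tendsto.mul_const (b := v) h1 (Or.inr hvt)
    rwa [zero_mul] at this
  rw [ENNReal.tendsto_nhds_zero]
  intro e he
  have he3 : 0 < e / 3 := ENNReal.div_pos he.ne' (by simp)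
  -- the scale `δ` and the uniform error `η` are fixed before `ε`
  obtain ⟨δ, hδe, hδ⟩ := ((ENNReal.tendsto_nhds_zero.1 hDlim _ he3).and
    (Ioo_mem_nhdsGT (show (0 : ℝ) < ρ from hρ))).exists
  obtain ⟨η, hηe, hη⟩ := ((ENNReal.tendsto_nhds_zero.1 hηlim _ he3).and
    (self_mem_nhdsWithin (s := Ioi (0 : ℝ)))).exists
  have hδ0 : 0 < δ := hδ.1
  have hδρ : δ ≤ ρ := hδ.2.le
  have hpotD : ∀ t x₁, (∫⁻ x in Metric.ball x₁ ρ, (A * potential γ F δ (t, x)) ^ r) ^ (1 / r) ≤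
      A * D δ := by
    intro t x₁
    simp_rw [ENNReal.mul_rpow_of_nonneg _ _ hr0.le]
    rw [lintegral_const_mul' _ _ (ENNReal.rpow_ne_top_of_nonneg hr0.le hA),
      ENNReal.mul_rpow_of_nonneg _ _ (by positivity), ← ENNReal.rpow_mul,
      mul_one_div_cancel hr0.ne', ENNReal.rpow_one]
    exact mul_le_mul_right (h.potential_Lr_le hp hq hr hβ hF hκ hδ0 hδρ hρ1 x₁) _
  have hpm : Measurable fun z => A * potential γ F δ z := (measurable_potential γ hF δ).const_mul _
  have hK : IsCompact (({0} : Set ℝ) ×ˢ Metric.closedBall x₀ ρ) :=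
    isCompact_singleton.prod (isCompact_closedBall _ _)
  filter_upwards [hζ.eventually_dist_conv_le (hW δ hδ0) hK hη, self_mem_nhdsWithin]
    with ε hε hε0
  have hε0 : 0 < ε := hε0
  set k : SpaceTime d → ℝ≥0∞ := fun y => ENNReal.ofReal (scaled ζ ε y) with hk
  have hsc := (contDiff_scaled hζ.smooth ε).continuous
  have hkm : Measurable k := hsc.measurable.ennreal_ofReal
  set H : Space d → ℝ≥0∞ := fun x => ∫⁻ y, k y * (A * potential γ F δ ((0, x) - y)) with hH
  have hHm : Measurable H := by
    have : Measurable (Function.uncurry fun (x : Space d) (y : SpaceTime d) =>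
        k y * (A * potential γ F δ ((0, x) - y))) :=
      (hkm.comp measurable_snd).mul (hpm.comp (by fun_prop))
    exact this.lintegral_prod_right'
  have hfirst : ∀ x, ‖V ε x - conv (scaled ζ ε) (W δ) (0, x)‖ₑ ≤ H x := by
    intro x
    have hl := ((hV ε hε0 x).sub_const (conv (scaled ζ ε) (W δ) (0, x))).enorm
    refine le_of_tendsto hl ?_
    filter_upwards [Ioo_mem_nhdsGT hδ0] with σ hσ
    refine enorm_conv_sub_conv_le (H := fun z => A * potential γ F δ z) hsc
      (hasCompactSupport_scaled hζ.compact hε0) (fun y => hζ.scaled_nonneg hε0 y)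
      (hW σ hσ.1) (hW δ hδ0) (fun z => ?_) (0, x)
    rw [← edist_eq_enorm_sub, edist_comm, edist_eq_enorm_sub]
    exact hinc σ δ hσ.1 hσ.2.le (by linarith) z
  have hsplit : ∀ᵐ x, x ∈ Metric.ball x₀ ρ →
      ‖V ε x - g x‖ₑ ≤ H x + (ENNReal.ofReal η + A * potential γ F δ (0, x)) := by
    filter_upwards [hg] with x hx hxB
    have e1 : V ε x - g x = (V ε x - conv (scaled ζ ε) (W δ) (0, x)) +
        ((conv (scaled ζ ε) (W δ) (0, x) - W δ (0, x)) + (W δ (0, x) - g x)) := by abel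
    rw [e1]
    refine (enorm_add_le _ _).trans (add_le_add (hfirst x) ((enorm_add_le _ _).trans
      (add_le_add ?_ (hx δ ⟨hδ0, by linarith⟩))))
    rw [← ofReal_norm, ← dist_eq_norm]
    exact ENNReal.ofReal_le_ofReal (hε _ ⟨rfl, Metric.ball_subset_closedBall hxB⟩)
  have hpm0 : Measurable fun x : Space d => A * potential γ F δ (0, x) :=
    hpm.comp measurable_prodMk_left
  calc (∫⁻ x in Metric.ball x₀ ρ, ‖V ε x - g x‖ₑ ^ r) ^ (1 / r)
      ≤ (∫⁻ x in Metric.ball x₀ ρ,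
          (H x + (ENNReal.ofReal η + A * potential γ F δ (0, x))) ^ r) ^ (1 / r) := by
        refine ENNReal.rpow_le_rpow (lintegral_mono_ae ?_) (by positivity)
        rw [ae_restrict_iff' Metric.isOpen_ball.measurableSet]
        exact hsplit.mono fun x hx hxB => ENNReal.rpow_le_rpow (hx hxB) hr0.le
    _ ≤ (∫⁻ x in Metric.ball x₀ ρ, H x ^ r) ^ (1 / r) +
          ((∫⁻ _x in Metric.ball x₀ ρ, ENNReal.ofReal η ^ r) ^ (1 / r) +
          (∫⁻ x in Metric.ball x₀ ρ, (A * potential γ F δ (0, x)) ^ r) ^ (1 / r)) := by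
        refine (ENNReal.lintegral_Lp_add_le hHm.aemeasurable
          (measurable_const.add hpm0).aemeasurable hr1.le).trans (add_le_add le_rfl ?_)
        exact ENNReal.lintegral_Lp_add_le aemeasurable_const hpm0.aemeasurable hr1.le
    _ ≤ e / 3 + (e / 3 + e / 3) := by
        refine add_le_add ?_ (add_le_add ?_ ?_)
        · exact (Lr_average_le hr1 hkm (hζ.lintegral_scaled hε0) hpm hpotD 0 x₀).trans hδe
        · rw [setLIntegral_const, ENNReal.mul_rpow_of_nonneg _ _ (by positivity),
            ← ENNReal.rpow_mul, mul_one_div_cancel hr0.ne', ENNReal.rpow_one]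
          exact hηe
        · exact (hpotD 0 x₀).trans hδe
    _ = e := by rw [← add_assoc]; exact ENNReal.add_thirds e

/-- Convergence in `L_r` on small balls implies convergence on all balls. -/
theorem tendsto_lintegral_ball_of_small {ι : Type*} {l : Filter ι} {r : ℝ} (hr : 0 < r)
    {G : ι → Space d → ℝ≥0∞}
    (h : ∀ x₀, Tendsto (fun i => (∫⁻ x in Metric.ball x₀ (1 / 2), G i x ^ r) ^ (1 / r)) l (𝓝 0))
    (x₀ : Space d) (R : ℝ) :
    Tendsto (fun i => (∫⁻ x in Metric.ball x₀ R, G i x ^ r) ^ (1 / r)) l (𝓝 0) := by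
  have h' : ∀ x₁, Tendsto (fun i => ∫⁻ x in Metric.ball x₁ (1 / 2), G i x ^ r) l (𝓝 0) := by
    intro x₁
    have := (ENNReal.continuous_rpow_const (y := r)).tendsto 0 |>.comp (h x₁)
    rw [ENNReal.zero_rpow_of_pos hr] at this
    refine this.congr fun i => ?_
    simp only [Function.comp_apply]
    rw [← ENNReal.rpow_mul, one_div_mul_cancel hr.ne', ENNReal.rpow_one]
  obtain ⟨T, hT⟩ := (isCompact_closedBall x₀ R).elim_finite_subcover
    (fun c : Space d => Metric.ball c (1 / 2)) (fun _ => Metric.isOpen_ball)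
    (fun c _ => mem_iUnion.2 ⟨c, Metric.mem_ball_self (by norm_num)⟩)
  have hsum : Tendsto (fun i => ∑ c ∈ T, ∫⁻ x in Metric.ball c (1 / 2), G i x ^ r) l (𝓝 0) := by
    have := tendsto_finsetSum T fun c _ => h' c
    simpa using this
  have hle : Tendsto (fun i => ∫⁻ x in Metric.ball x₀ R, G i x ^ r) l (𝓝 0) :=
    tendsto_of_tendsto_of_tendsto_of_le_of_le tendsto_const_nhds hsum (fun _ => zero_le)
      fun i => (lintegral_mono_set (Metric.ball_subset_closedBall.trans hT)).trans
        (setLIntegral_biUnion_finset_le _ _ _)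
  have := (ENNReal.continuous_rpow_const (y := 1 / r)).tendsto 0 |>.comp hle
  rwa [ENNReal.zero_rpow_of_pos (by positivity)] at this

end

section

variable {d : ℕ}

/-! ### A radial kernel -/

/-- A smooth decreasing profile, equal to one near zero and to zero on `[1/9, ∞)`. -/
noncomputable def profile (s : ℝ) : ℝ := Real.smoothTransition (2 - 18 * s)

theorem contDiff_profile : ContDiff ℝ ∞ profile :=
  Real.smoothTransition.contDiff.comp (contDiff_const.sub (contDiff_const.mul contDiff_id))

theorem antitone_profile : Antitone profile := fun a b hab =>
  Real.smoothTransition.monotone (by linarith)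

theorem profile_eq_zero {s : ℝ} (hs : 1 / 9 ≤ s) : profile s = 0 :=
  Real.smoothTransition.zero_of_nonpos (by linarith)

theorem deriv_profile_eq_zero {s : ℝ} (hs : 1 / 9 < s) : deriv profile s = 0 := by
  have : profile =ᶠ[𝓝 s] fun _ => 0 := by
    filter_upwards [Ioi_mem_nhds hs] with x hx using profile_eq_zero (le_of_lt hx)
  rw [this.deriv_eq]
  simp

theorem contDiff_deriv_profile : ContDiff ℝ ∞ (deriv profile) :=
  (contDiff_infty_iff_deriv.1 contDiff_profile).2

theorem exists_deriv_profile_ne_zero : ∃ s, 0 < s ∧ deriv profile s ≠ 0 := by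
  obtain ⟨s, hs, he⟩ := exists_deriv_eq_slope profile (a := 0) (b := 1 / 9) (by norm_num)
    contDiff_profile.continuous.continuousOn
    (contDiff_profile.differentiable (by simp)).differentiableOn
  refine ⟨s, hs.1, ?_⟩
  rw [he, profile_eq_zero le_rfl, profile, Real.smoothTransition.one_of_one_le (by norm_num)]
  norm_num

/-- The function `t² + |x|²`. -/
noncomputable def sqNorm (z : SpaceTime d) : ℝ := z.1 ^ 2 + ‖z.2‖ ^ 2

theorem contDiff_sqNorm : ContDiff ℝ ∞ (sqNorm (d := d)) :=
  (contDiff_fst.pow 2).add (contDiff_snd.norm_sq ℝ)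

theorem hasFDerivAt_sqNorm (z : SpaceTime d) :
    HasFDerivAt (sqNorm (d := d)) ((2 * z.1) • ContinuousLinearMap.fst ℝ ℝ (Space d) +
      (2 • innerSL ℝ z.2).comp (ContinuousLinearMap.snd ℝ ℝ (Space d))) z := by
  have h1 := (hasFDerivAt_fst (𝕜 := ℝ) (p := z)).pow 2
  have h2 := (hasFDerivAt_snd (𝕜 := ℝ) (p := z)).norm_sq
  refine (h1.add h2).congr_fderiv ?_
  ext v <;> simp

theorem mem_closedBall_of_sqNorm_le {z : SpaceTime d} (h : sqNorm z ≤ 1 / 9) :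
    z ∈ Metric.closedBall (0 : SpaceTime d) (1 / 3) := by
  unfold sqNorm at h
  rw [mem_closedBall_zero_iff, Prod.norm_def, max_le_iff, Real.norm_eq_abs]
  constructor
  · refine abs_le_of_sq_le_sq ?_ (by norm_num)
    nlinarith [sq_nonneg ‖z.2‖]
  · refine le_of_sq_le_sq ?_ (by norm_num)
    nlinarith [sq_nonneg z.1]

theorem isSmoothKernel_comp_sqNorm {f : ℝ → ℝ} (hf : ContDiff ℝ ∞ f)
    (h0 : ∀ s, 1 / 9 < s → f s = 0) : IsSmoothKernel fun z : SpaceTime d => f (sqNorm z) where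
  smooth := hf.comp contDiff_sqNorm
  tsupport_subset := closure_minimal (fun _ hz => mem_closedBall_of_sqNorm_le
    (not_lt.1 fun h => hz (h0 _ h))) Metric.isClosed_closedBall

theorem IsSmoothKernel.smooth_mul {k : SpaceTime d → ℝ} (hk : IsSmoothKernel k)
    {f : SpaceTime d → ℝ} (hf : ContDiff ℝ ∞ f) : IsSmoothKernel fun z => f z * k z where
  smooth := hf.mul hk.smooth
  tsupport_subset := (tsupport_mul_subset_right (f := f) (g := k)).trans hk.tsupport_subset

/-- There is a smooth mollification kernel whose rescalings have a derivative in the scale which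
is a combination of a time derivative and a Laplacian. Such a derivative is minus the divergence
form `∂_t (2tφ) + div (xφ)`, up to a power of the scale; if `φ` is a function `f` of `t² + |x|²`,
then `xφ` is a gradient in `x`, namely that of a primitive of `f` evaluated at `t² + |x|²`, up to
the factor `1/2`. Here `f` is a negative multiple of the derivative of a decreasing profile, so `φ`
is nonnegative. -/
theorem exists_scaleKernel (d : ℕ) : ∃ φ R₁ R₂ : SpaceTime d → ℝ,
    IsMollifier φ ∧ IsScaleKernel 0 φ R₁ R₂ := by
  set φ₀ : SpaceTime d → ℝ := fun z => -deriv profile (sqNorm z) with hφ₀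
  have hk₀ : IsSmoothKernel φ₀ := isSmoothKernel_comp_sqNorm (f := fun s => -deriv profile s)
    contDiff_deriv_profile.neg fun s hs => by rw [deriv_profile_eq_zero hs, neg_zero]
  have hnn : ∀ z, 0 ≤ φ₀ z := fun z => neg_nonneg.2 antitone_profile.deriv_nonpos
  set c := ∫ z, φ₀ z with hc
  have hc0 : 0 < c := by
    obtain ⟨s, hs, hs'⟩ := exists_deriv_profile_ne_zero
    refine hk₀.smooth.continuous.integral_pos_of_hasCompactSupport_nonneg_nonzero
      hk₀.hasCompactSupport hnn (x := (Real.sqrt s, 0)) ?_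
    simpa [hφ₀, sqNorm, Real.sq_sqrt hs.le] using hs'
  set φ : SpaceTime d → ℝ := fun z => c⁻¹ * φ₀ z with hφ
  set R₁ : SpaceTime d → ℝ := fun z => (2 * z.1) * φ z with hR₁
  set R₂ : SpaceTime d → ℝ := fun z => -(2 * c)⁻¹ * profile (sqNorm z) with hR₂
  have hkφ : IsSmoothKernel φ := hk₀.smooth_mul contDiff_const
  refine ⟨φ, R₁, R₂, ⟨hkφ.smooth, hkφ.hasCompactSupport,
    fun z => mul_nonneg (by positivity) (hnn z), ?_⟩, ⟨hkφ, ?_, ?_, fun z => ?_⟩⟩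
  · rw [hφ, integral_const_mul, ← hc, inv_mul_cancel₀ hc0.ne']
  · exact hkφ.smooth_mul (contDiff_const.mul contDiff_fst)
  · exact (isSmoothKernel_comp_sqNorm contDiff_profile fun s hs =>
      profile_eq_zero hs.le).smooth_mul contDiff_const
  · have hφd : ∀ z, HasFDerivAt φ (fderiv ℝ φ z) z := fun z =>
      (hkφ.smooth.differentiable (by simp) z).hasFDerivAt
    -- the gradient of `R₂` in `x` is `x φ`, since the kernels are radial
    have hgrad : ∀ w i, fderiv ℝ R₂ w (spaceDir i) = w.2 i * φ w := by
      intro w i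
      have h1 : HasDerivAt profile (deriv profile (sqNorm w)) (sqNorm w) :=
        (contDiff_profile.differentiable (by simp) _).hasDerivAt
      have h2 := (h1.comp_hasFDerivAt w (hasFDerivAt_sqNorm w)).const_mul (-(2 * c)⁻¹)
      have h3 : fderiv ℝ R₂ w = _ := h2.fderiv
      rw [h3]
      simp [spaceDir, hφ, hφ₀, EuclideanSpace.inner_single_right]
      field_simp
    have hspace : ∀ i, fderiv ℝ (fun w => fderiv ℝ R₂ w (spaceDir i)) z (spaceDir i) =
        φ z + z.2 i * fderiv ℝ φ z (spaceDir i) := by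
      intro i
      have e : (fun w => fderiv ℝ R₂ w (spaceDir i)) = fun w => w.2 i * φ w :=
        funext fun w => hgrad w i
      have h1 : HasFDerivAt (fun w : SpaceTime d => w.2 i)
          ((EuclideanSpace.proj i).comp (ContinuousLinearMap.snd ℝ ℝ (Space d))) z :=
        ((EuclideanSpace.proj (𝕜 := ℝ) i).comp
          (ContinuousLinearMap.snd ℝ ℝ (Space d))).hasFDerivAt
      have h2 : fderiv ℝ (fun w : SpaceTime d => w.2 i * φ w) z = _ := (h1.mul (hφd z)).fderiv
      rw [e, h2]
      simp [spaceDir]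
      ring
    have htime : fderiv ℝ R₁ z timeDir = 2 * φ z + 2 * z.1 * fderiv ℝ φ z timeDir := by
      have h1 : HasFDerivAt (fun w : SpaceTime d => 2 * w.1)
          ((2 : ℝ) • ContinuousLinearMap.fst ℝ ℝ (Space d)) z :=
        (hasFDerivAt_fst (𝕜 := ℝ) (p := z)).const_mul 2
      have h2 : fderiv ℝ R₁ z = _ := (h1.mul (hφd z)).fderiv
      rw [h2]
      simp [timeDir]
      ring
    have hvec : ((2 * z.1, z.2) : SpaceTime d) =
        (2 * z.1) • timeDir + ∑ i, z.2 i • spaceDir i := by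
      have h1 : ∑ i, z.2 i • (spaceDir i : SpaceTime d) = (0, z.2) := by
        refine Prod.ext ?_ ?_
        · simp [Prod.fst_sum, spaceDir]
        · rw [Prod.snd_sum]
          ext j
          simp [spaceDir, Finset.sum_apply, Pi.single_apply]
      rw [h1]
      simp [timeDir]
    rw [htime, Finset.sum_congr rfl fun i _ => hspace i, hvec, map_add, map_smul, map_sum,
      Finset.sum_add_distrib]
    simp only [map_smul, smul_eq_mul, Finset.sum_const, Finset.card_univ, Fintype.card_fin,
      nsmul_eq_mul]
    push_cast
    ring

/-! ### Spatial gradients -/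

/-- The gradient in the spatial variable, as a linear form. -/
noncomputable def spatialDeriv (F : SpaceTime d → ℝ) (z : SpaceTime d) : Space d →L[ℝ] ℝ :=
  (fderiv ℝ F z).comp (ContinuousLinearMap.inr ℝ ℝ (Space d))

theorem spatialDeriv_apply (F : SpaceTime d → ℝ) (z : SpaceTime d) (e : Space d) :
    spatialDeriv F z e = fderiv ℝ F z (0, e) := rfl

theorem contDiff_spatialDeriv {F : SpaceTime d → ℝ} (hF : ContDiff ℝ ∞ F) :
    ContDiff ℝ ∞ (spatialDeriv F) :=
  (hF.fderiv_right (m := ∞) (by simp)).clm_comp contDiff_const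

theorem tsupport_spatialDeriv_subset (F : SpaceTime d → ℝ) :
    tsupport (spatialDeriv F) ⊆ tsupport F := by
  refine closure_minimal (fun z hz => ?_) (isClosed_tsupport _)
  refine support_fderiv_subset ℝ (fun h => hz ?_)
  rw [spatialDeriv, h, ContinuousLinearMap.zero_comp]

theorem IsSmoothKernel.spatialDeriv {k : SpaceTime d → ℝ} (hk : IsSmoothKernel k) :
    IsSmoothKernel (spatialDeriv k) where
  smooth := contDiff_spatialDeriv hk.smooth
  tsupport_subset := (tsupport_spatialDeriv_subset k).trans hk.tsupport_subset

theorem minSmoothness_le_infty : minSmoothness ℝ 2 ≤ ((⊤ : ℕ∞) : WithTop ℕ∞) := by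
  rw [minSmoothness_of_isRCLikeNormedField]
  exact WithTop.coe_le_coe.2 (le_top : (2 : ℕ∞) ≤ ⊤)

theorem fderiv_fderiv_comm {F : SpaceTime d → ℝ} (hF : ContDiff ℝ ∞ F) (a b z : SpaceTime d) :
    fderiv ℝ (fun w => fderiv ℝ F w a) z b = fderiv ℝ (fun w => fderiv ℝ F w b) z a := by
  have hd : DifferentiableAt ℝ (fderiv ℝ F) z :=
    (hF.fderiv_right (m := ∞) (by simp)).differentiable (by simp) z
  have h : ∀ a, fderiv ℝ (fun w => fderiv ℝ F w a) z = (fderiv ℝ (fderiv ℝ F) z).flip a := by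
    intro a
    rw [fderiv_clm_apply hd (differentiableAt_const a)]
    simp
  rw [h, h]
  exact (hF.contDiffAt.isSymmSndFDerivAt minSmoothness_le_infty) b a

theorem fderiv_spatialDeriv_apply {F : SpaceTime d → ℝ} (hF : ContDiff ℝ ∞ F)
    (z v : SpaceTime d) (e : Space d) :
    fderiv ℝ (spatialDeriv F) z v e = fderiv ℝ (fun w => fderiv ℝ F w (0, e)) z v := by
  have hd : DifferentiableAt ℝ (spatialDeriv F) z :=
    (contDiff_spatialDeriv hF).differentiable (by simp) z
  have h1 : fderiv ℝ (fun w => spatialDeriv F w e) z v = fderiv ℝ (spatialDeriv F) z v e := by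
    rw [fderiv_clm_apply hd (differentiableAt_const e)]
    simp
  exact h1.symm

/-- Differentiating the kernels in `x` raises the order from zero to one. -/
theorem IsScaleKernel.spatialDeriv {P R₁ R₂ : SpaceTime d → ℝ} (h : IsScaleKernel 0 P R₁ R₂) :
    IsScaleKernel 1 (spatialDeriv P) (ParabolicMorrey.spatialDeriv R₁)
      (ParabolicMorrey.spatialDeriv R₂) where
  kernel := h.kernel.spatialDeriv
  kernel₁ := h.kernel₁.spatialDeriv
  kernel₂ := h.kernel₂.spatialDeriv
  identity := by
    intro z
    ext e
    have hs : ∀ {F : SpaceTime d → ℝ} (_ : ContDiff ℝ ∞ F) (a : SpaceTime d),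
        ContDiff ℝ ∞ fun w => fderiv ℝ F w a := fun hF a =>
      (hF.fderiv_right (m := ∞) (by simp)).clm_apply contDiff_const
    set L : SpaceTime d →L[ℝ] SpaceTime d :=
      ((2 : ℝ) • ContinuousLinearMap.fst ℝ ℝ (Space d)).prod
        (ContinuousLinearMap.snd ℝ ℝ (Space d)) with hL
    have hid : (fun z => ((d : ℝ) + 2) * P z + fderiv ℝ P z (L z)) = fun z =>
        fderiv ℝ R₁ z timeDir +
          ∑ i, fderiv ℝ (fun w => fderiv ℝ R₂ w (spaceDir i)) z (spaceDir i) := by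
      ext z
      have := h.identity z
      simpa [hL] using this
    have hid' := congrArg (fun G => fderiv ℝ G z (0, e)) hid
    have hP := h.kernel.smooth
    have hPd : HasFDerivAt P (fderiv ℝ P z) z := (hP.differentiable (by simp) z).hasFDerivAt
    have hP2 : HasFDerivAt (fderiv ℝ P) (fderiv ℝ (fderiv ℝ P) z) z :=
      ((hP.fderiv_right (m := ∞) (by simp)).differentiable (by simp) z).hasFDerivAt
    have hl : fderiv ℝ (fun z => ((d : ℝ) + 2) * P z + fderiv ℝ P z (L z)) z (0, e) =
        ((d : ℝ) + 2 + 1) * fderiv ℝ P z (0, e) +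
          fderiv ℝ (fun w => fderiv ℝ P w (0, e)) z (L z) := by
      have h0 : fderiv ℝ (fun z => ((d : ℝ) + 2) * P z + fderiv ℝ P z (L z)) z = _ :=
        ((hPd.const_mul ((d : ℝ) + 2)).add (hP2.clm_apply L.hasFDerivAt)).fderiv
      rw [h0]
      have h1 : fderiv ℝ (fun w => fderiv ℝ P w (0, e)) z (L z) =
          fderiv ℝ (fderiv ℝ P) z (0, e) (L z) := by
        rw [fderiv_clm_apply hP2.differentiableAt (differentiableAt_const _)]
        simpa using (hP.contDiffAt.isSymmSndFDerivAt minSmoothness_le_infty) (L z) (0, e)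
      have h2 : L (0, e) = (0, e) := by simp [hL]
      rw [h1]
      simp [h2]
      ring
    have hr : fderiv ℝ (fun z => fderiv ℝ R₁ z timeDir +
        ∑ i, fderiv ℝ (fun w => fderiv ℝ R₂ w (spaceDir i)) z (spaceDir i)) z (0, e) =
        fderiv ℝ (fun w => fderiv ℝ R₁ w (0, e)) z timeDir +
          ∑ i, fderiv ℝ (fun w => fderiv ℝ (fun w' => fderiv ℝ R₂ w' (0, e)) w (spaceDir i)) z
            (spaceDir i) := by
      have hR₁ := hs h.kernel₁.smooth timeDir
      have hR₂ : ∀ i, ContDiff ℝ ∞ fun w => fderiv ℝ (fun w => fderiv ℝ R₂ w (spaceDir i)) w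
          (spaceDir i) := fun i => hs (hs h.kernel₂.smooth (spaceDir i)) (spaceDir i)
      rw [fderiv_fun_add (hR₁.differentiable (by simp) z) (DifferentiableAt.fun_sum fun i _ =>
        (hR₂ i).differentiable (by simp) z), fderiv_fun_sum fun i _ =>
        (hR₂ i).differentiable (by simp) z]
      simp only [add_apply, sum_apply]
      rw [fderiv_fderiv_comm h.kernel₁.smooth]
      congr 1
      refine Finset.sum_congr rfl fun i _ => ?_
      rw [fderiv_fderiv_comm (hs h.kernel₂.smooth (spaceDir i))]
      congr 2
      funext w
      exact fderiv_fderiv_comm h.kernel₂.smooth _ _ _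
    have h2e : ∀ i, (fun w => fderiv ℝ (ParabolicMorrey.spatialDeriv R₂) w (spaceDir i)) =
        ParabolicMorrey.spatialDeriv (fun w => fderiv ℝ R₂ w (spaceDir i)) := by
      intro i
      funext w
      ext e'
      rw [fderiv_spatialDeriv_apply h.kernel₂.smooth, spatialDeriv_apply,
        fderiv_fderiv_comm h.kernel₂.smooth]
    simp only [h2e]
    simp only [add_apply, smul_apply, sum_apply]
    rw [fderiv_spatialDeriv_apply hP, fderiv_spatialDeriv_apply h.kernel₁.smooth,
      spatialDeriv_apply]
    have h3 : ∀ i, fderiv ℝ (ParabolicMorrey.spatialDeriv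
        (fun w => fderiv ℝ R₂ w (spaceDir i))) z (spaceDir i) e =
        fderiv ℝ (fun w => fderiv ℝ (fun w' => fderiv ℝ R₂ w' (0, e)) w (spaceDir i)) z
          (spaceDir i) := by
      intro i
      rw [fderiv_spatialDeriv_apply (hs h.kernel₂.smooth (spaceDir i))]
      congr 2
      funext w
      exact fderiv_fderiv_comm h.kernel₂.smooth _ _ _
    simp only [h3]
    rw [← hr, ← hid', hl]
    simp [hL]

end

section

variable {d : ℕ} {E : Type*} [NormedAddCommGroup E] [NormedSpace ℝ E]

/-! ### Mollifications of mollifications -/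

theorem conv_comm (f g : SpaceTime d → ℝ) : conv f g = conv g f := by
  have h : (ContinuousLinearMap.lsmul ℝ ℝ : ℝ →L[ℝ] ℝ →L[ℝ] ℝ).flip =
      ContinuousLinearMap.lsmul ℝ ℝ := by
    ext; simp
  have := convolution_flip (f := g) (g := f) (μ := (volume : Measure (SpaceTime d)))
    (ContinuousLinearMap.lsmul ℝ ℝ : ℝ →L[ℝ] ℝ →L[ℝ] ℝ)
  rwa [h] at this

theorem conv_assoc [CompleteSpace E] {η u : SpaceTime d → ℝ} {k : SpaceTime d → E}
    (hη : Continuous η) (hηc : HasCompactSupport η) (hu : LocallyIntegrable u volume)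
    (hk : Continuous k) (hkc : HasCompactSupport k) (z : SpaceTime d) :
    conv η (conv u k) z = conv (conv u η) k z := by
  rw [conv_comm u η]
  have hun : LocallyIntegrable (fun x => ‖u x‖) volume :=
    fun x => let ⟨s, hs, hi⟩ := hu x; ⟨s, hs, hi.norm⟩
  refine (convolution_assoc (ContinuousLinearMap.lsmul ℝ ℝ) (ContinuousLinearMap.lsmul ℝ ℝ)
    (ContinuousLinearMap.lsmul ℝ ℝ) (ContinuousLinearMap.lsmul ℝ ℝ) (fun x y w => mul_smul x y w)
    hη.aestronglyMeasurable hu.aestronglyMeasurable hk.aestronglyMeasurable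
    (Eventually.of_forall fun y => hηc.convolutionExists_left _ hη hu y)
    (Eventually.of_forall fun y => hkc.norm.convolutionExists_right _ hun hk.norm y) ?_).symm
  exact hηc.norm.convolutionExists_left _ hη.norm
    (hkc.norm.continuous_convolution_right _ hun hk.norm).locallyIntegrable z

theorem contDiff_conv {u η : SpaceTime d → ℝ} (hu : LocallyIntegrable u volume)
    (hη : ContDiff ℝ ∞ η) (hηc : HasCompactSupport η) : ContDiff ℝ ∞ (conv u η) :=
  hηc.contDiff_convolution_right (n := ⊤) _ hu hη

theorem hasWeakDeriv_fderiv {v : SpaceTime d → ℝ} (hv : ContDiff ℝ ∞ v) (e : SpaceTime d) :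
    HasWeakDeriv e v fun z => fderiv ℝ v z e := by
  have hv' : Continuous fun z => fderiv ℝ v z e :=
    ((hv.fderiv_right (m := ∞) (by simp)).clm_apply contDiff_const).continuous
  refine ⟨hv.continuous.locallyIntegrable, hv'.locallyIntegrable, fun φ hφ hc => ?_⟩
  have hφ' : Continuous fun z => fderiv ℝ φ z e :=
    ((hφ.fderiv_right (m := ∞) (by simp)).clm_apply contDiff_const).continuous
  exact integral_mul_fderiv_eq_neg_fderiv_mul_of_integrable
    ((hv'.mul hφ.continuous).integrable_of_hasCompactSupport hc.mul_left)
    ((hv.continuous.mul hφ').integrable_of_hasCompactSupport (hc.fderiv_apply ℝ e).mul_left)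
    ((hv.continuous.mul hφ.continuous).integrable_of_hasCompactSupport hc.mul_left)
    (fun x _ => hv.differentiable (by simp) x) (fun x _ => hφ.differentiable (by simp) x)

theorem conv_spatialDeriv {v K : SpaceTime d → ℝ} (hv : ContDiff ℝ ∞ v) (hK : ContDiff ℝ ∞ K)
    (hc : HasCompactSupport K) (z : SpaceTime d) :
    conv v (spatialDeriv K) z = conv K (spatialDeriv v) z := by
  have hKs : HasCompactSupport (spatialDeriv K) :=
    hc.isCompact.of_isClosed_subset (isClosed_tsupport _) (tsupport_spatialDeriv_subset K)
  have i1 := integrable_conv hv.continuous.locallyIntegrable (contDiff_spatialDeriv hK).continuous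
    hKs z
  have i2 : Integrable fun w => K w • spatialDeriv v (z - w) :=
    (hK.continuous.smul ((contDiff_spatialDeriv hv).continuous.comp
      (by fun_prop))).integrable_of_hasCompactSupport (hc.smul_right (f' := fun w => _))
  ext e
  have h1 : conv v (spatialDeriv K) z e = conv v (fun w => fderiv ℝ K w (0, e)) z := by
    rw [conv_apply, ContinuousLinearMap.integral_apply i1]; rfl
  have h2 : conv K (spatialDeriv v) z e = conv K (fun w => fderiv ℝ v w (0, e)) z := by
    rw [conv_apply, ContinuousLinearMap.integral_apply i2]; rfl
  rw [h1, h2, (hasWeakDeriv_fderiv hv (0, e)).conv_fderiv hK hc, conv_comm]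

theorem scaleFamily_spatialDeriv {P : SpaceTime d → ℝ} (hP : ContDiff ℝ ∞ P) (σ : ℝ) :
    scaleFamily 1 (spatialDeriv P) σ = spatialDeriv (scaled P σ) := by
  ext z e
  have h : dil d σ (0, e) = σ⁻¹ • ((0, e) : SpaceTime d) := by simp [dil_apply]
  rw [spatialDeriv_apply, fderiv_scaled hP, h, map_smul, scaleFamily_eq, pow_one]
  simp only [Pi.smul_apply, scaled, smul_apply, spatialDeriv_apply]
  rw [smul_comm]

theorem spatialDeriv_eq_fderiv_slice {v : SpaceTime d → ℝ} (hv : ContDiff ℝ ∞ v) (t : ℝ)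
    (x : Space d) : spatialDeriv v (t, x) = fderiv ℝ (fun y => v (t, y)) x := by
  have h1 : HasFDerivAt v (fderiv ℝ v (t, x)) (t, x) :=
    (hv.differentiable (by simp) _).hasFDerivAt
  have h2 : HasFDerivAt (fun y => v (t, y)) _ x := h1.comp x (hasFDerivAt_prodMk_right t x)
  rw [h2.fderiv]; rfl

theorem IsMollifier.contDiff_mollify {ζ u : SpaceTime d → ℝ} (hζ : IsMollifier ζ)
    (hu : LocallyIntegrable u volume) {ε : ℝ} (hε : 0 < ε) : ContDiff ℝ ∞ (mollify ζ ε u) := by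
  rw [mollify_eq_conv]
  exact contDiff_conv hu (contDiff_scaled hζ.smooth ε) (hasCompactSupport_scaled hζ.compact hε)

theorem IsMollifier.tendsto_conv_scaleFamily_zero {ζ φ u : SpaceTime d → ℝ} (hζ : IsMollifier ζ)
    (hφ : IsMollifier φ) (hu : LocallyIntegrable u volume) {ε : ℝ} (hε : 0 < ε)
    (z : SpaceTime d) :
    Tendsto (fun σ => conv (scaled ζ ε) (conv u (scaleFamily 0 φ σ)) z) (𝓝[>] 0)
      (𝓝 (mollify ζ ε u z)) := by
  refine (hφ.tendsto_conv (hζ.contDiff_mollify hu hε).continuous z).congr' ?_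
  filter_upwards [self_mem_nhdsWithin] with σ hσ
  have e : scaleFamily 0 φ σ = scaled φ σ := by rw [scaleFamily_eq]; simp
  rw [e, conv_assoc (contDiff_scaled hζ.smooth ε).continuous
    (hasCompactSupport_scaled hζ.compact hε) hu (contDiff_scaled hφ.smooth σ).continuous
    (hasCompactSupport_scaled hφ.compact hσ), ← mollify_eq_conv ζ, conv_comm]

theorem IsMollifier.tendsto_conv_scaleFamily_one {ζ φ u : SpaceTime d → ℝ} (hζ : IsMollifier ζ)
    (hφ : IsMollifier φ) (hu : LocallyIntegrable u volume) {ε : ℝ} (hε : 0 < ε)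
    (z : SpaceTime d) :
    Tendsto (fun σ => conv (scaled ζ ε) (conv u (scaleFamily 1 (spatialDeriv φ) σ)) z) (𝓝[>] 0)
      (𝓝 (spatialDeriv (mollify ζ ε u) z)) := by
  have hv := hζ.contDiff_mollify hu hε
  refine (hφ.tendsto_conv (contDiff_spatialDeriv hv).continuous z).congr' ?_
  filter_upwards [self_mem_nhdsWithin] with σ hσ
  have hc := hasCompactSupport_scaled hφ.compact hσ
  have hs := contDiff_scaled hφ.smooth σ
  rw [scaleFamily_spatialDeriv hφ.smooth, conv_assoc (contDiff_scaled hζ.smooth ε).continuous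
    (hasCompactSupport_scaled hζ.compact hε) hu (contDiff_spatialDeriv hs).continuous
    (hc.isCompact.of_isClosed_subset (isClosed_tsupport _) (tsupport_spatialDeriv_subset _)),
    ← mollify_eq_conv ζ, conv_spatialDeriv hv hs hc]

end

section

variable {d : ℕ}

/-! ### The trace estimate -/

/-- The trace of order `γ` of the family `σ^{-γ} (u * P_σ)`, with its interpolation inequality at
the scale `s`. -/
theorem IsScaleKernel.exists_trace_estimate {V : Type} [NormedAddCommGroup V] [NormedSpace ℝ V]
    [CompleteSpace V] {γ : ℕ} {P R₁ R₂ : SpaceTime d → V} (hker : IsScaleKernel γ P R₁ R₂)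
    {p q : ℝ} (β μ : ℝ) (hp : 1 < p) (hq : 1 < q) :
    ∃ N : ℝ≥0, ∀ r : ℝ, p ≤ r → 0 ≤ β → 2 - (γ : ℝ) < β →
      (γ : ℝ) + d / p + 2 / q - d / r ≤ μ → μ < 2 →
      ∀ (u ut : SpaceTime d → ℝ) (Du : SpaceTime d → EuclideanSpace ℝ (Fin d))
        (D2u : SpaceTime d → EuclideanSpace ℝ (Fin d × Fin d)),
        MemMorreySobolev p q β u ut Du D2u →
        ∃ g : Space d → V, AEStronglyMeasurable g volume ∧
          (∀ ζ : SpaceTime d → ℝ, IsMollifier ζ → ∀ G : ℝ → Space d → V,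
            (∀ ε, 0 < ε → ∀ x, Tendsto (fun σ => conv (scaled ζ ε)
              (conv u (scaleFamily γ P σ)) (0, x)) (𝓝[>] 0) (𝓝 (G ε x))) →
            ∀ (x₀ : Space d) (R : ℝ), Tendsto
              (fun ε => (∫⁻ x in Metric.ball x₀ R, ‖G ε x - g x‖ₑ ^ r) ^ (1 / r)) (𝓝[>] 0)
              (𝓝 0)) ∧
          ∀ ν s : ℝ, (γ : ℝ) + d / p + 2 / q - d / r ≤ ν → 0 ≤ ν → ν ≤ 2 → 0 < s → s ≤ 1 →
            spaceMorreyNorm r (β + γ - ν) g ≤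
              N * (ENNReal.ofReal (s ^ (2 - ν)) * (morreyNorm p q β ut + morreyNorm p q β D2u) +
                ENNReal.ofReal (s ^ (-ν)) * morreyNorm p q β u) := by
  obtain ⟨C, -, hC⟩ := hker.kernel.exists_bound
  obtain ⟨C₁, -, hC₁⟩ := hker.kernel₁.exists_bound
  obtain ⟨C₂, -, hC₂⟩ := hker.kernel₂.exists_bound
  obtain ⟨n, hn⟩ := exists_spaceMorreyNorm_le d
  have hp0 : 0 < p := by linarith
  have hq0 : 0 < q := by linarith
  set A : ℝ≥0∞ := ENNReal.ofReal C₁ + ENNReal.ofReal C₂ * d with hAdef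
  have hA : A ≠ ⊤ := by simp [hAdef, ENNReal.mul_eq_top]
  set c : ℝ≥0∞ := invVolConst d * avgConst d p q + max 1 (unitVol d) with hcdef
  set v : ℝ≥0∞ := unitVol d ^ (1 / p) with hvdef
  set L : ℝ≥0∞ := A * potConst d p q β γ μ + ENNReal.ofReal C * c with hLdef
  have hc : c ≠ ⊤ := by
    simp [hcdef, ENNReal.mul_eq_top, invVolConst_ne_top, avgConst_ne_top, unitVol_ne_top]
  have hv : v ≠ ⊤ := ENNReal.rpow_ne_top_of_nonneg (by positivity) unitVol_ne_top
  have hL : L ≠ ⊤ := ENNReal.add_ne_top.2 ⟨ENNReal.mul_ne_top hA (potConst_ne_top _ _ _ _ _),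
    ENNReal.mul_ne_top ENNReal.ofReal_ne_top hc⟩
  set K : ℝ≥0∞ := n * ENNReal.ofReal (2 ^ (β + γ)) * (v * L) with hKdef
  have hK : K ≠ ⊤ := ENNReal.mul_ne_top (ENNReal.mul_ne_top (by simp) ENNReal.ofReal_ne_top)
    (ENNReal.mul_ne_top hv hL)
  refine ⟨K.toNNReal, fun r hr hβ0 hβ hκ hμ u ut Du D2u hu => ?_⟩
  rw [ENNReal.coe_toNNReal hK]
  have hr0 : 0 < r := by linarith
  have hr1 : 1 ≤ r := by linarith
  have hloc : LocallyIntegrable u volume := hu.weak_time.1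
  obtain ⟨U, hUm, hU⟩ := hu.mem.1.enorm
  obtain ⟨T, hTm, hT⟩ := hu.mem_time.1.enorm
  obtain ⟨S, hSm, hS⟩ := hu.mem_space₂.1.enorm
  set F : SpaceTime d → ℝ≥0∞ := fun z => T z + S z with hFdef
  have hFm : Measurable F := hTm.add hSm
  have hUM : MorreyBound p q β U (v * morreyNorm p q β u) :=
    (morreyBound_morreyNorm hp0 hq0 u).congr_ae hU
  have hFM : MorreyBound p q β F (v * (morreyNorm p q β ut + morreyNorm p q β D2u)) := by
    rw [mul_add]
    exact ((morreyBound_morreyNorm hp0 hq0 ut).congr_ae hT).add hp.le hq.le hTm hSm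
      ((morreyBound_morreyNorm hp0 hq0 D2u).congr_ae hS)
  have hFMt : v * (morreyNorm p q β ut + morreyNorm p q β D2u) ≠ ⊤ :=
    ENNReal.mul_ne_top hv (ENNReal.add_ne_top.2 ⟨hu.mem_time.2.ne, hu.mem_space₂.2.ne⟩)
  have hF₁ : ∀ᵐ w, ‖ut w‖ₑ ≤ F w := hT.mono fun w hw => by
    exact hw.le.trans le_self_add
  have hF₂ : ∀ᵐ w, ‖D2u w‖ₑ ≤ F w := hS.mono fun w hw => by
    exact hw.le.trans le_add_self
  set W : ℝ → SpaceTime d → V := fun σ => conv u (scaleFamily γ P σ) with hWdef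
  have hW : ∀ σ, 0 < σ → Continuous (W σ) := fun σ hσ =>
    continuous_conv_scaleFamily hker.kernel γ hloc hσ
  have hinc : ∀ a b : ℝ, 0 < a → a ≤ b → b ≤ 1 → ∀ z,
      ‖W b z - W a z‖ₑ ≤ A * potential γ F b z := fun a b ha hab hb z =>
    hker.enorm_conv_sub_le hu.weak_time hu.weak_space hu.weak_space₂ hC₁ hC₂ hF₁ hF₂ ha hab hb z
  have hκ2 : (γ : ℝ) + d / p + 2 / q - d / r < 2 := by linarith
  obtain ⟨g, hgm, hg⟩ := exists_trace hA hW hinc (show (0 : ℝ) < 1 / 2 by norm_num)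
    (hFM.ae_potential_ne_top hp hq hr hβ0 hFm hFMt hκ2 0)
  refine ⟨g, hgm, fun ζ hζ G hG x₀ R => ?_, fun ν s hκν hν0 hν hs hs1 => ?_⟩
  · exact tendsto_lintegral_ball_of_small hr0 (fun x₁ => hFM.tendsto_Lr_trace hp hq hr hβ0 hFm
      hFMt hκ2 hA hW hinc hg hζ hG (by norm_num) le_rfl x₁) x₀ R
  · have hgle : ∀ᵐ x, ‖g x‖ₑ ≤ A * potential γ F s (0, x) +
        ENNReal.ofReal C * ENNReal.ofReal (s ^ (-(γ : ℝ))) * cylAvg U s (0, x) := by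
      filter_upwards [hg] with x hx
      have h1 := hx s ⟨hs, hs1⟩
      have h2 : ‖W s (0, x)‖ₑ ≤ _ := hker.kernel.enorm_conv_scaleFamily_le γ hC hs
        (hU.mono fun w hw => hw.le) (0, x)
      calc ‖g x‖ₑ = ‖(g x - W s (0, x)) + W s (0, x)‖ₑ := by rw [sub_add_cancel]
        _ ≤ ‖g x - W s (0, x)‖ₑ + ‖W s (0, x)‖ₑ := enorm_add_le _ _
        _ ≤ _ := by
          rw [mul_assoc]
          refine add_le_add ?_ h2
          rw [← enorm_neg, neg_sub]
          exact h1
    set X := morreyNorm p q β ut + morreyNorm p q β D2u with hX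
    set Y := morreyNorm p q β u with hY
    set a := ENNReal.ofReal (s ^ (2 - ν)) with ha
    set b := ENNReal.ofReal (s ^ (-ν)) with hb
    have hfin : ∀ ρ ∈ Ioc (0 : ℝ) (1 / 2), ∀ x, ENNReal.ofReal (ρ ^ (β + γ - ν)) *
        avgLr r (Metric.ball x ρ) (fun y => ‖g y‖ₑ) ≤ v * L * (a * X + b * Y) := by
      intro ρ hρ x
      have h1 := hFM.ofReal_mul_avgLr_potential_le hp hq hr hFm hβ0 hβ hκ hμ hκν hν hs hs1 hρ.1
        hρ.2 x
      have h2 := hUM.ofReal_mul_avgLr_cylAvg_le hp hq hr hUm hβ0 hβ hκν hν hs hs1 hρ.1 hρ.2 x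
      have hm1 : Measurable fun x : Space d => potential γ F s (0, x) :=
        (measurable_potential _ hFm s).comp measurable_prodMk_left
      have hm2 : Measurable fun x : Space d => cylAvg U s (0, x) :=
        (measurable_cylAvg hUm).comp
          (show Measurable fun x : Space d => (s, ((0 : ℝ), x)) by fun_prop)
      set B := Metric.ball x ρ
      set w := ENNReal.ofReal (ρ ^ (β + γ - ν))
      set J₁ := avgLr r B fun x => potential γ F s (0, x)
      set J₂ := avgLr r B fun x => cylAvg U s (0, x)
      calc w * avgLr r B (fun y => ‖g y‖ₑ)
          ≤ w * (A * J₁ + ENNReal.ofReal C * ENNReal.ofReal (s ^ (-(γ : ℝ))) * J₂) := by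
            refine mul_le_mul_right ((avgLr_mono_ae hr0 hgle).trans
              ((avgLr_add_le hr1 _ (hm1.const_mul _) (hm2.const_mul _)).trans_eq ?_)) _
            rw [avgLr_const_mul hr0 _ hA, avgLr_const_mul hr0 _
              (ENNReal.mul_ne_top ENNReal.ofReal_ne_top ENNReal.ofReal_ne_top)]
        _ = A * (w * J₁) + ENNReal.ofReal C * (w * (ENNReal.ofReal (s ^ (-(γ : ℝ))) * J₂)) := by
            ring
        _ ≤ A * (potConst d p q β γ μ * (a * (v * X))) + ENNReal.ofReal C * (c * (b * (v * Y))) :=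
            add_le_add (mul_le_mul_right h1 _) (mul_le_mul_right h2 _)
        _ ≤ A * (potConst d p q β γ μ * (a * (v * X))) + ENNReal.ofReal C * (c * (b * (v * Y))) +
            (v * (A * potConst d p q β γ μ) * (b * Y) + v * (ENNReal.ofReal C * c) * (a * X)) :=
            le_self_add
        _ = v * L * (a * X + b * Y) := by rw [hLdef]; ring
    refine (hn hr1 g _ hfin).trans ?_
    have h2 : ENNReal.ofReal (2 ^ (β + γ - ν)) ≤ ENNReal.ofReal (2 ^ (β + (γ : ℝ))) :=
      ENNReal.ofReal_le_ofReal (Real.rpow_le_rpow_of_exponent_le (by norm_num) (by linarith))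
    calc _ ≤ n * ENNReal.ofReal (2 ^ (β + (γ : ℝ))) * (v * L * (a * X + b * Y)) := by gcongr
      _ = K * (a * X + b * Y) := by rw [hKdef]; ring

end

section

variable {d : ℕ}

/-! ### Traces as multilinear forms -/

theorem IsTrace.ae_eq {r : ℝ} (hr : 1 ≤ r) {γ : ℕ} {ζ u : SpaceTime d → ℝ}
    (hm : ∀ᶠ ε in 𝓝[>] (0 : ℝ), Continuous fun x : Space d =>
      iteratedFDeriv ℝ γ (fun y => mollify ζ ε u (0, y)) x)
    {g h : Space d → ContinuousMultilinearMap ℝ (fun _ : Fin γ => Space d) ℝ}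
    (hg : IsTrace r γ ζ u g) (hh : IsTrace r γ ζ u h) : h =ᵐ[volume] g := by
  have hr0 : ENNReal.ofReal r ≠ 0 := by simp; linarith
  have hr1 : 1 ≤ ENNReal.ofReal r := by simpa using hr
  have hball : ∀ n : ℕ, ∀ᵐ x ∂volume.restrict (Metric.ball (0 : Space d) (n + 1)), h x = g x := by
    intro n
    have hR : (0 : ℝ) < n + 1 := by positivity
    have h0 : eLpNorm (h - g) (ENNReal.ofReal r) (volume.restrict (Metric.ball 0 (n + 1))) = 0 := by
      refine le_antisymm ?_ zero_le
      have hlim := (hg.2 0 _ hR).add (hh.2 0 _ hR)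
      rw [add_zero] at hlim
      refine ge_of_tendsto hlim ?_
      filter_upwards [hm] with ε hε
      set D := fun x : Space d => iteratedFDeriv ℝ γ (fun y => mollify ζ ε u (0, y)) x
      have e : h - g = (fun x => D x - g x) - fun x => D x - h x := by
        ext1 x; simp
      rw [e]
      exact eLpNorm_sub_le (hε.aestronglyMeasurable.sub hg.1.restrict)
        (hε.aestronglyMeasurable.sub hh.1.restrict) hr1
    rw [eLpNorm_eq_zero_iff (hh.1.restrict.sub hg.1.restrict) hr0] at h0
    filter_upwards [h0] with x hx
    simpa [sub_eq_zero] using hx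
  have hU : (⋃ n : ℕ, Metric.ball (0 : Space d) (n + 1)) = univ := by
    refine eq_univ_of_forall fun x => ?_
    obtain ⟨n, hn⟩ := exists_nat_gt ‖x‖
    exact mem_iUnion.2 ⟨n, by rw [mem_ball_zero_iff]; linarith⟩
  have := (ae_restrict_iUnion_iff (fun n : ℕ => Metric.ball (0 : Space d) (n + 1))
    fun x => h x = g x).2 hball
  rwa [hU, Measure.restrict_univ] at this

/-- Transfer of a trace with values in a space `V` of forms to multilinear forms along an
isometry. -/
theorem exists_isTrace_of_isometry {V : Type} [NormedAddCommGroup V] [NormedSpace ℝ V] {r : ℝ}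
    (hr : 1 ≤ r) {γ : ℕ}
    (I : V ≃ₗᵢ[ℝ] ContinuousMultilinearMap ℝ (fun _ : Fin γ => Space d) ℝ) {u : SpaceTime d → ℝ}
    (hu : LocallyIntegrable u volume) {D : (SpaceTime d → ℝ) → SpaceTime d → V}
    (hD : ∀ v : SpaceTime d → ℝ, ContDiff ℝ ∞ v → Continuous (D v) ∧
      ∀ x, iteratedFDeriv ℝ γ (fun y => v (0, y)) x = I (D v (0, x)))
    {g : Space d → V} (hg : AEStronglyMeasurable g volume) {ζ : SpaceTime d → ℝ}
    (hζ : IsMollifier ζ)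
    (hlim : ∀ (x₀ : Space d) (R : ℝ), Tendsto (fun ε => (∫⁻ x in Metric.ball x₀ R,
      ‖D (mollify ζ ε u) (0, x) - g x‖ₑ ^ r) ^ (1 / r)) (𝓝[>] 0) (𝓝 0)) :
    IsTrace r γ ζ u (fun x => I (g x)) ∧
      ∀ h, IsTrace r γ ζ u h → h =ᵐ[volume] fun x => I (g x) := by
  have hr0 : 0 < r := by linarith
  have htr : IsTrace r γ ζ u (fun x => I (g x)) := by
    refine ⟨I.continuous.comp_aestronglyMeasurable hg, fun x₀ R _ => ?_⟩
    refine (hlim x₀ R).congr' ?_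
    filter_upwards [self_mem_nhdsWithin] with ε hε
    rw [eLpNorm_eq_lintegral_rpow_enorm_toReal (by simpa using hr0) (by simp),
      ENNReal.toReal_ofReal hr0.le]
    congr 1
    refine lintegral_congr fun x => ?_
    rw [(hD _ (hζ.contDiff_mollify hu hε)).2, ← map_sub, I.enorm_map]
  refine ⟨htr, fun h hh => htr.ae_eq hr ?_ hh⟩
  filter_upwards [self_mem_nhdsWithin] with ε hε
  obtain ⟨h1, h2⟩ := hD _ (hζ.contDiff_mollify hu hε)
  simp only [h2]
  exact I.continuous.comp (h1.comp (by fun_prop))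

theorem spaceMorreyNorm_comp_isometry {V V' : Type*} [NormedAddCommGroup V] [NormedSpace ℝ V]
    [NormedAddCommGroup V'] [NormedSpace ℝ V'] (I : V ≃ₗᵢ[ℝ] V') (r b : ℝ) (g : Space d → V) :
    spaceMorreyNorm r b (fun x => I (g x)) = spaceMorreyNorm r b g := by
  simp only [spaceMorreyNorm, I.enorm_map]

/-- The estimate at the scale `s` is used for two exponents: `ν = μ`, with `s` chosen so that
`s ^ (2 - μ) = ε`, and `ν = 2` with `s = 1`. -/
theorem interpolation_of_scale_estimate {V : Type*} [NormedAddCommGroup V] {r b μ κ : ℝ}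
    {N N' : ℝ≥0} (hN : N' ≤ N) {X Y : ℝ≥0∞} (hμ0 : 0 < μ) (hμ : μ < 2) (hκ : κ ≤ μ)
    {g : Space d → V}
    (h : ∀ ν s : ℝ, κ ≤ ν → 0 ≤ ν → ν ≤ 2 → 0 < s → s ≤ 1 →
      spaceMorreyNorm r (b - ν) g ≤
        N' * (ENNReal.ofReal (s ^ (2 - ν)) * X + ENNReal.ofReal (s ^ (-ν)) * Y)) :
    (∀ ε : ℝ, 0 < ε → ε ≤ 1 → spaceMorreyNorm r (b - μ) g ≤
      N * ENNReal.ofReal ε * X + N * ENNReal.ofReal (ε ^ (-(μ / (2 - μ)))) * Y) ∧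
      ∀ Z, spaceMorreyNorm r (b - 2) g ≤ N * (X + Y + Z) := by
  have hNN : (N' : ℝ≥0∞) ≤ N := by exact_mod_cast hN
  constructor
  · intro ε hε hε1
    have h2 : 0 < 2 - μ := by linarith
    refine (h μ (ε ^ (1 / (2 - μ))) hκ hμ0.le hμ.le (by positivity)
      (Real.rpow_le_one hε.le hε1 (by positivity))).trans ?_
    rw [← Real.rpow_mul hε.le, ← Real.rpow_mul hε.le, one_div_mul_cancel h2.ne', Real.rpow_one,
      show 1 / (2 - μ) * -μ = -(μ / (2 - μ)) by ring, mul_assoc, mul_assoc, ← mul_add]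
    gcongr
  · intro Z
    refine (h 2 1 (by linarith) (by norm_num) le_rfl one_pos le_rfl).trans ?_
    simp only [Real.one_rpow, ENNReal.ofReal_one, one_mul]
    exact mul_le_mul' hNN le_self_add

end

end ParabolicMorrey

theorem theorem3p1 (d : ℕ) (hd : 2 ≤ d) (p q β μ : ℝ) (hp : 1 < p) (hq : 1 < q) (hμ : 0 < μ) :
    ∃ N : ℝ≥0, ∀ (γ : ℕ) (r : ℝ), (γ = 0 ∨ γ = 1) → p ≤ r →
      2 - (γ : ℝ) < β → β ≤ d / p + 2 / q → d / p + 2 / q < 2 - (γ : ℝ) + d / r →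
      (γ : ℝ) + d / p + 2 / q - d / r ≤ μ → μ < 2 →
      ∀ (u ut : SpaceTime d → ℝ) (Du : SpaceTime d → EuclideanSpace ℝ (Fin d))
        (D2u : SpaceTime d → EuclideanSpace ℝ (Fin d × Fin d)),
        MemMorreySobolev p q β u ut Du D2u →
        ∃ g : Space d → ContinuousMultilinearMap ℝ (fun _ : Fin γ => Space d) ℝ,
          (∀ ζ : SpaceTime d → ℝ, IsMollifier ζ →
            IsTrace r γ ζ u g ∧ ∀ h, IsTrace r γ ζ u h → h =ᵐ[volume] g) ∧
          (∀ ε : ℝ, 0 < ε → ε ≤ 1 →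
            spaceMorreyNorm r (β + γ - μ) g ≤
              N * ENNReal.ofReal ε * (morreyNorm p q β ut + morreyNorm p q β D2u) +
              N * ENNReal.ofReal (ε ^ (-(μ / (2 - μ)))) * morreyNorm p q β u) ∧
          spaceMorreyNorm r (β + γ - 2) g ≤
            N * (morreyNorm p q β u + morreyNorm p q β Du +
              morreyNorm p q β D2u + morreyNorm p q β ut) := by
  obtain ⟨φ, R₁, R₂, hφ, hker⟩ := exists_scaleKernel d
  obtain ⟨N₀, h₀⟩ := hker.exists_trace_estimate (p := p) (q := q) β μ hp hq
  obtain ⟨N₁, h₁⟩ := hker.spatialDeriv.exists_trace_estimate (p := p) (q := q) β μ hp hq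
  have hsum : ∀ N a b c e : ℝ≥0∞, N * (a + b + c + e) = N * (c + e + b + a) := fun N a b c e => by
    ring
  refine ⟨max N₀ N₁, fun γ r hγ hr hβ hβ' hκ' hκ hμ2 u ut Du D2u hu => ?_⟩
  have hr1 : 1 ≤ r := by linarith
  have hloc := hu.weak_time.1
  rcases hγ with rfl | rfl
  · have hβ0 : 0 ≤ β := by push_cast at hβ; linarith
    obtain ⟨g, hg, hlim, hest⟩ := h₀ r hr hβ0 hβ hκ hμ2 u ut Du D2u hu
    obtain ⟨hε, h2⟩ := interpolation_of_scale_estimate (le_max_left N₀ N₁) hμ hμ2 hκ hest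
    set I := (continuousMultilinearCurryFin0 ℝ (Space d) ℝ).symm
    simp only [← spaceMorreyNorm_comp_isometry I] at hε h2
    refine ⟨fun x => I (g x), fun ζ hζ => ?_, hε, (h2 _).trans_eq (hsum _ _ _ _ _)⟩
    refine exists_isTrace_of_isometry hr1 I hloc (D := fun v => v)
      (fun v hv => ⟨hv.continuous, fun x => ?_⟩) hg hζ
      (hlim ζ hζ _ fun ε hε x => hζ.tendsto_conv_scaleFamily_zero hφ hloc hε (0, x))
    rw [iteratedFDeriv_zero_eq_comp]; rfl
  · have hβ0 : 0 ≤ β := by push_cast at hβ; linarith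
    obtain ⟨g, hg, hlim, hest⟩ := h₁ r hr hβ0 hβ hκ hμ2 u ut Du D2u hu
    obtain ⟨hε, h2⟩ := interpolation_of_scale_estimate (le_max_right N₀ N₁) hμ hμ2 hκ hest
    set I := (continuousMultilinearCurryFin1 ℝ (Space d) ℝ).symm
    simp only [← spaceMorreyNorm_comp_isometry I] at hε h2
    refine ⟨fun x => I (g x), fun ζ hζ => ?_, hε, (h2 _).trans_eq (hsum _ _ _ _ _)⟩
    refine exists_isTrace_of_isometry hr1 I hloc (D := spatialDeriv)
      (fun v hv => ⟨(contDiff_spatialDeriv hv).continuous, fun x => ?_⟩) hg hζ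
      (hlim ζ hζ _ fun ε hε x => hζ.tendsto_conv_scaleFamily_one hφ hloc hε (0, x))
    ext m
    rw [iteratedFDeriv_one_apply, spatialDeriv_eq_fderiv_slice hv,
      continuousMultilinearCurryFin1_symm_apply]
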